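/- Let $p$ be a prime, $k$ a field of characteristic $p$, and let $n \ge 2$ and $1 \le d < p$ be integers. Put $$R = k[x_0,\ldots,x_n]/(x_0^d + \cdots + x_{n-1}^d - x_n^d), \qquad S = k[u,v],$$ with their standard gradings, and let $T = R \# S = \bigoplus_{t \ge 0} [R]_t \otimes_k [S]_t$ be their Segre product. Write $\mathfrak m_R$ and $\mathfrak m_T$ for the homogeneous maximal ideals. For a graded $k$-algebra $A$ with homogeneous maximal ideal $\mathfrak m$, the Frobenius of $A$ induces a Frobenius action $F$ on each local cohomology module $H^j_{\mathfrak m}(A)$. This module is nilpotent (respectively nilpotent in degree $t\in\mathbf Z$) if each of its elements (respectively each of its homogeneous elements of degree $t$) is killed by some power of $F$. Further, $b_j(A) = \sup\{t \in \mathbf Z : H^j_{\mathfrak m}(A) \text{ is not nilpotent in degree } t\} \in \mathbf Z\cup\{\pm\infty\}$, $\operatorname{F-depth} A = \inf\{j \in \mathbf N : H^j_{\mathfrak m}(A) \text{ is not nilpotent}\}$, and $A$ is weakly $F$-nilpotent if $H^j_{\mathfrak m}(A)$ is nilpotent for all $j < \dim A$. 1. If $p \equiv 1 \bmod d$ and $d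 > n$, then $b_n(R) = 0$ and $\operatorname{F-depth} T = n$. 2. If $p \equiv -1 \bmod d$, then $H^j_{\mathfrak m_T}(T)$ is nilpotent for all $j \le n$, $\operatorname{F-depth} T = n+1$, and $T$ is weakly $F$-nilpotent. In particular, for $n = 2$: if $p \equiv 1 \bmod d$ and $d \geq 3$, then $b_2(R) = 0$ and $\operatorname{F-depth} T = 2$; if $p \equiv -1 \bmod d$, then $H^2_{\mathfrak m_T}(T)$ is nilpotent, $\operatorname{F-depth} T = 3$, and $T$ is weakly $F$-nilpotent. -/

import Mathlib

open scoped TensorProduct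

open scoped Pointwise in
/-- Products of a span and a submodule are spanned by products. -/
theorem span_mul_submodule {k A : Type*} [Field k] [CommRing A] [Algebra k A] (s : Set A)
    (M : Submodule k A) : Submodule.span k s * M =
      Submodule.span k (Set.image2 (· * ·) s (M : Set A)) := by
  rw [Set.image2_mul, ← Submodule.span_mul_span, Submodule.span_eq]

noncomputable section

/-! ### The Čech complex of a finite family of elements, and local cohomology -/

section Cech

variable {A : Type*} [CommRing A] {ι : Type*}

/-- The module of Čech `j`-cochains of the family `x`:
the product of the localizations `A[1 / ∏ i ∈ I, x i]` over the `j`-element subsets `I`. -/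
abbrev CechCochain (x : ι → A) (j : ℕ) : Type _ :=
  (I : {I : Finset ι // I.card = j}) → Localization.Away (∏ i ∈ I.1, x i)

theorem cech_isUnit (x : ι → A) {I J : Finset ι} (h : I ⊆ J) :
    IsUnit (Algebra.ofId A (Localization.Away (∏ i ∈ J, x i)) (∏ i ∈ I, x i)) := by
  have hu := IsLocalization.Away.algebraMap_isUnit (S := Localization.Away (∏ i ∈ J, x i))
    (∏ i ∈ J, x i)
  exact isUnit_of_dvd_unit (map_dvd _ (Finset.prod_dvd_prod_of_subset I J x h)) hu

/-- The canonical map `A[1 / ∏ i ∈ I, x i] → A[1 / ∏ i ∈ J, x i]` for `I ⊆ J`. -/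
def cechRes (x : ι → A) {I J : Finset ι} (h : I ⊆ J) :
    Localization.Away (∏ i ∈ I, x i) →ₐ[A] Localization.Away (∏ i ∈ J, x i) :=
  IsLocalization.Away.liftAlgHom (∏ i ∈ I, x i) (f := Algebra.ofId A _) (cech_isUnit x h)

variable [LinearOrder ι]

/-- The Čech differential
`(∂ c)_J = ∑ i ∈ J, (-1) ^ #{i' ∈ J | i' < i} • c_{J \ {i}}`. -/
def cechD (x : ι → A) (j : ℕ) : CechCochain x j →ₗ[A] CechCochain x (j + 1) :=
  LinearMap.pi fun J => ∑ i : {i // i ∈ J.1},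
    ((-1 : A) ^ (J.1.filter (· < i.1)).card) •
      ((cechRes x (J.1.erase_subset i.1)).toLinearMap ∘ₗ
        LinearMap.proj (R := A)
          (φ := fun I : {I : Finset ι // I.card = j} => Localization.Away (∏ i ∈ I.1, x i))
          ⟨J.1.erase i.1, by rw [Finset.card_erase_of_mem i.2, J.2, Nat.add_sub_cancel]⟩)

/-- Čech `j`-cocycles. -/
def cechZ (x : ι → A) (j : ℕ) : Submodule A (CechCochain x j) :=
  LinearMap.ker (cechD x j)

/-- Čech `j`-coboundaries. -/
def cechB (x : ι → A) : (j : ℕ) → Submodule A (CechCochain x j)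
  | 0 => ⊥
  | j + 1 => LinearMap.range (cechD x j)

/-- The local cohomology module `H^j_J(A)` for the ideal `J` generated by the finite family `x`,
as the `j`-th cohomology of the Čech complex of `x`. -/
abbrev LocalCoh (x : ι → A) (j : ℕ) : Type _ :=
  cechZ x j ⧸ (cechB x j).comap (cechZ x j).subtype

end Cech

/-! ### The Frobenius action -/

section Frobenius

variable (k : Type*) [Field k] (p : ℕ) [hp : Fact p.Prime] [CharP k p]

/-- The Frobenius endomorphism of a `k`-algebra, as an additive map (the algebra may be zero). -/
def frobAdd (B : Type*) [CommRing B] [Algebra k B] : B →+ B where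
  toFun b := b ^ p
  map_zero' := zero_pow hp.out.ne_zero
  map_add' a b := by
    obtain ⟨r, hr⟩ := exists_add_pow_prime_eq hp.out a b
    have h0 : (p : B) = 0 := by
      rw [← map_natCast (algebraMap k B), CharP.cast_eq_zero, map_zero]
    rw [hr, h0]
    ring

variable {A : Type*} [CommRing A] [Algebra k A] {ι : Type*} [LinearOrder ι]

/-- The Frobenius on Čech cochains: the Frobenius of each localization. -/
def cechFrob (x : ι → A) (j : ℕ) : CechCochain x j →+ CechCochain x j :=
  AddMonoidHom.mk' (fun c I => frobAdd k p _ (c I)) fun a b => by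
    funext I
    exact map_add (frobAdd k p _) (a I) (b I)

theorem cechD_frob (x : ι → A) (j : ℕ) (c : CechCochain x j) :
    cechD x j (cechFrob k p x j c) = cechFrob k p x (j + 1) (cechD x j c) := by
  funext J
  simp only [cechD, cechFrob, LinearMap.pi_apply, LinearMap.sum_apply, LinearMap.smul_apply,
    AddMonoidHom.mk'_apply, map_sum]
  refine Finset.sum_congr rfl fun i _ => ?_
  have h1 := map_pow (cechRes x (J.1.erase_subset i.1))
    (c ⟨J.1.erase i.1, by rw [Finset.card_erase_of_mem i.2, J.2, Nat.add_sub_cancel]⟩) p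
  rcases neg_one_pow_eq_or A (J.1.filter (· < i.1)).card with h | h <;> rw [h]
  · rw [one_smul, one_smul]
    exact h1
  · rw [neg_smul, neg_smul, one_smul, one_smul, map_neg]
    exact congrArg Neg.neg h1

theorem cechFrob_mem_cechZ (x : ι → A) (j : ℕ) {c : CechCochain x j} (hc : c ∈ cechZ x j) :
    cechFrob k p x j c ∈ cechZ x j := by
  have h : cechD x j c = 0 := hc
  change cechD x j _ = 0
  rw [cechD_frob, h, map_zero]

theorem cechFrob_mem_cechB (x : ι → A) (j : ℕ) {c : CechCochain x j} (hc : c ∈ cechB x j) :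
    cechFrob k p x j c ∈ cechB x j := by
  cases j with
  | zero =>
    have h : c = 0 := hc
    rw [h, map_zero]
    exact zero_mem _
  | succ j =>
    obtain ⟨b, rfl⟩ := hc
    exact ⟨cechFrob k p x j b, cechD_frob k p x j b⟩

/-- The Frobenius on Čech cocycles. -/
def cocycleFrob (x : ι → A) (j : ℕ) : cechZ x j →+ cechZ x j :=
  AddMonoidHom.mk' (fun z => ⟨cechFrob k p x j z, cechFrob_mem_cechZ k p x j z.2⟩)
    fun a b => Subtype.ext (map_add (cechFrob k p x j) a.1 b.1)

/-- The canonical Frobenius action on local cohomology. -/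
def lcFrob (x : ι → A) (j : ℕ) : LocalCoh x j →+ LocalCoh x j :=
  QuotientAddGroup.map _ _ (cocycleFrob k p x j) fun z hz => by
    have h : z.1 ∈ cechB x j := hz
    exact cechFrob_mem_cechB k p x j h

/-- `H^j` is nilpotent: each element is killed by some power of the Frobenius action. -/
def LCNilpotent (x : ι → A) (j : ℕ) : Prop :=
  ∀ h : LocalCoh x j, ∃ e : ℕ, (lcFrob k p x j)^[e] h = 0

/-- The `F`-depth: the infimum of all `j` such that `H^j` is not nilpotent (`⊤` if there is none).
Here `x` is a finite family of generators of the (homogeneous) maximal ideal. -/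
def FDepth (x : ι → A) : ℕ∞ :=
  sInf ((fun j : ℕ => (j : ℕ∞)) '' {j | ¬ LCNilpotent k p x j})

/-- `A` is weakly `F`-nilpotent: `H^j` is nilpotent for all `j < dim A`.
Here `x` is a finite family of generators of the (homogeneous) maximal ideal. -/
def WeaklyFNilpotent (x : ι → A) : Prop :=
  ∀ j : ℕ, ((j : ℕ∞) : WithBot ℕ∞) < ringKrullDim A → LCNilpotent k p x j

/-- The degree `n` part of the Čech `j`-cochains, where `A` is graded by `𝒜` and all `x i` have
degree one, so that `a / (∏ i ∈ I, x i) ^ m` has degree `t - m * j` for `a ∈ 𝒜 t`, `#I = j`. -/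
def cechDeg (𝒜 : ℕ → Submodule k A) (x : ι → A) (j : ℕ) (n : ℤ) : Set (CechCochain x j) :=
  {c | ∀ I : {I : Finset ι // I.card = j}, ∃ (m t : ℕ) (a : A), a ∈ 𝒜 t ∧
    (t : ℤ) - (m : ℤ) * (j : ℤ) = n ∧
    c I = Localization.mk a (⟨(∏ i ∈ I.1, x i) ^ m, m, rfl⟩ : Submonoid.powers (∏ i ∈ I.1, x i))}

/-- The degree `n` part of `H^j`. -/
def lcDeg (𝒜 : ℕ → Submodule k A) (x : ι → A) (j : ℕ) (n : ℤ) : Set (LocalCoh x j) :=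
  {h | ∃ z : cechZ x j, z.1 ∈ cechDeg k 𝒜 x j n ∧ Submodule.Quotient.mk z = h}

/-- `H^j` is nilpotent in degree `n`. -/
def LCNilpotentInDegree (𝒜 : ℕ → Submodule k A) (x : ι → A) (j : ℕ) (n : ℤ) : Prop :=
  ∀ h ∈ lcDeg k 𝒜 x j n, ∃ e : ℕ, (lcFrob k p x j)^[e] h = 0

/-- The base-nilpotent index
`b_j = sup {n ∈ ℤ | H^j is not nilpotent in degree n} ∈ ℤ ∪ {-∞, ∞}`. -/
def baseNilpotentIndex (𝒜 : ℕ → Submodule k A) (x : ι → A) (j : ℕ) : WithBot (WithTop ℤ) :=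
  sSup ((fun n : ℤ => ((n : WithTop ℤ) : WithBot (WithTop ℤ))) ''
    {n | ¬ LCNilpotentInDegree k p 𝒜 x j n})

end Frobenius

/-! ### Segre products -/

section Segre

variable {k : Type*} [Field k] {A B : Type*} [CommRing A] [Algebra k A] [CommRing B] [Algebra k B]

/-- The homogeneous ideal `⨁_{n > 0} 𝒜 n`. -/
def irrelevantIdeal (𝒜 : ℕ → Submodule k A) : Ideal A :=
  Ideal.span {a | ∃ n, 0 < n ∧ a ∈ 𝒜 n}

/-- The image of `𝒜 n ⊗ ℬ n` in `A ⊗ B`. -/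
def segrePiece (𝒜 : ℕ → Submodule k A) (ℬ : ℕ → Submodule k B) (n : ℕ) :
    Submodule k (A ⊗[k] B) :=
  Submodule.map₂ (TensorProduct.mk k A B) (𝒜 n) (ℬ n)

/-- The Segre product `⨁ₙ 𝒜 n ⊗ ℬ n`, a subalgebra of `A ⊗ B`. -/
def segre (𝒜 : ℕ → Submodule k A) [SetLike.GradedMonoid 𝒜]
    (ℬ : ℕ → Submodule k B) [SetLike.GradedMonoid ℬ] : Subalgebra k (A ⊗[k] B) :=
  Submodule.toSubalgebra (⨆ n, segrePiece 𝒜 ℬ n)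
    (Submodule.mem_iSup_of_mem 0 (Submodule.apply_mem_map₂ _
      (SetLike.GradedOne.one_mem (A := 𝒜)) (SetLike.GradedOne.one_mem (A := ℬ))))
    (by
      intro y z hy hz
      have hle : (⨆ n, segrePiece 𝒜 ℬ n) * (⨆ n, segrePiece 𝒜 ℬ n) ≤
          ⨆ n, segrePiece 𝒜 ℬ n := by
        rw [Submodule.iSup_mul]
        refine iSup_le fun m => ?_
        rw [Submodule.mul_iSup]
        refine iSup_le fun n => ?_
        refine le_trans ?_ (le_iSup _ (m + n))
        unfold segrePiece
        rw [Submodule.map₂_eq_span_image2, Submodule.map₂_eq_span_image2, Submodule.span_mul_span,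
          Submodule.span_le]
        rintro _ ⟨_, ⟨a, ha, b, hb, rfl⟩, _, ⟨a', ha', b', hb', rfl⟩, rfl⟩
        simp only [TensorProduct.mk_apply, Algebra.TensorProduct.tmul_mul_tmul]
        exact Submodule.apply_mem_map₂ (TensorProduct.mk k A B)
          (SetLike.GradedMul.mul_mem ha ha') (SetLike.GradedMul.mul_mem hb hb')
      exact hle (Submodule.mul_mem_mul hy hz))

theorem tmul_mem_segre (𝒜 : ℕ → Submodule k A) [SetLike.GradedMonoid 𝒜]
    (ℬ : ℕ → Submodule k B) [SetLike.GradedMonoid ℬ] {n : ℕ} {a : A} {b : B}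
    (ha : a ∈ 𝒜 n) (hb : b ∈ ℬ n) : a ⊗ₜ[k] b ∈ segre 𝒜 ℬ :=
  Submodule.mem_iSup_of_mem n (Submodule.apply_mem_map₂ (TensorProduct.mk k A B) ha hb)

/-- The grading of the Segre product. -/
def segreGrading (𝒜 : ℕ → Submodule k A) [SetLike.GradedMonoid 𝒜]
    (ℬ : ℕ → Submodule k B) [SetLike.GradedMonoid ℬ] (n : ℕ) : Submodule k (segre 𝒜 ℬ) :=
  (segrePiece 𝒜 ℬ n).comap (segre 𝒜 ℬ).val.toLinearMap

/-- The elements `x i ⊗ y j` of the Segre product, for elements `x i`, `y j` of degree one. -/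
def segreGens (𝒜 : ℕ → Submodule k A) [SetLike.GradedMonoid 𝒜]
    (ℬ : ℕ → Submodule k B) [SetLike.GradedMonoid ℬ] {ι κ : Type*}
    (x : ι → A) (hx : ∀ i, x i ∈ 𝒜 1) (y : κ → B) (hy : ∀ i, y i ∈ ℬ 1) :
    ι ×ₗ κ → segre 𝒜 ℬ :=
  fun ij => ⟨x (ofLex ij).1 ⊗ₜ[k] y (ofLex ij).2, tmul_mem_segre 𝒜 ℬ (hx _) (hy _)⟩

/-- If `A` and `B` are standard graded, generated by `x` and `y` in degree one, then the
`x i ⊗ y j` generate the homogeneous maximal ideal of the Segre product. -/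
theorem span_segreGens (𝒜 : ℕ → Submodule k A) [SetLike.GradedMonoid 𝒜]
    (ℬ : ℕ → Submodule k B) [SetLike.GradedMonoid ℬ] {ι κ : Type*}
    (x : ι → A) (hx : ∀ i, x i ∈ 𝒜 1) (y : κ → B) (hy : ∀ i, y i ∈ ℬ 1)
    (hA : ∀ n, 𝒜 (n + 1) ≤ Submodule.span k (Set.range x) * 𝒜 n)
    (hB : ∀ n, ℬ (n + 1) ≤ Submodule.span k (Set.range y) * ℬ n) :
    Ideal.span (Set.range (segreGens 𝒜 ℬ x hx y hy)) = irrelevantIdeal (segreGrading 𝒜 ℬ) := by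
  apply le_antisymm
  · rw [Ideal.span_le]
    rintro _ ⟨ij, rfl⟩
    refine Ideal.subset_span ⟨1, one_pos, ?_⟩
    exact Submodule.apply_mem_map₂ (TensorProduct.mk k A B) (hx _) (hy _)
  · unfold irrelevantIdeal
    rw [Ideal.span_le]
    rintro a ⟨n, hn, ha⟩
    obtain ⟨n, rfl⟩ := Nat.exists_eq_succ_of_ne_zero hn.ne'
    set I := Ideal.span (Set.range (segreGens 𝒜 ℬ x hx y hy)) with hI
    let L : Submodule k (A ⊗[k] B) :=
      (I.restrictScalars k).map (segre 𝒜 ℬ).val.toLinearMap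
    have hle : segrePiece 𝒜 ℬ (n + 1) ≤ L := by
      have h1 : segrePiece 𝒜 ℬ (n + 1) ≤ Submodule.map₂ (TensorProduct.mk k A B)
          (Submodule.span k (Set.range x) * 𝒜 n) (Submodule.span k (Set.range y) * ℬ n) :=
        Submodule.map₂_le_map₂ (hA n) (hB n)
      refine h1.trans ?_
      rw [span_mul_submodule, span_mul_submodule, Submodule.map₂_span_span, Submodule.span_le]
      rintro _ ⟨_, ⟨_, ⟨i, rfl⟩, a', ha', rfl⟩, _, ⟨_, ⟨j, rfl⟩, b', hb', rfl⟩, rfl⟩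
      refine ⟨segreGens 𝒜 ℬ x hx y hy (toLex (i, j)) *
        ⟨a' ⊗ₜ[k] b', tmul_mem_segre 𝒜 ℬ ha' hb'⟩, ?_, ?_⟩
      · exact I.mul_mem_right _ (Ideal.subset_span ⟨_, rfl⟩)
      · simp [segreGens]
    obtain ⟨b, hb, hab⟩ := hle ha
    have : b = a := Subtype.ext hab
    exact this ▸ hb

end Segre

/-! ### Fermat hypersurfaces -/

section Fermat

variable (k : Type*) [Field k]

/-- The polynomial `x_0 ^ d + ⋯ + x_{n-1} ^ d - x_n ^ d` in the variables `x_0, …, x_n`. -/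
def fermatPoly (n d : ℕ) : MvPolynomial (Fin (n + 1)) k :=
  ∑ i : Fin n, MvPolynomial.X i.castSucc ^ d - MvPolynomial.X (Fin.last n) ^ d

/-- The ring `k[x_0, …, x_n] / (x_0 ^ d + ⋯ + x_{n-1} ^ d - x_n ^ d)`. -/
abbrev FermatRing (n d : ℕ) : Type _ :=
  MvPolynomial (Fin (n + 1)) k ⧸ Ideal.span {fermatPoly k n d}

/-- The standard grading: `[R]_t` is the image of the homogeneous polynomials of degree `t`. -/
def fermatGrading (n d t : ℕ) : Submodule k (FermatRing k n d) :=
  (MvPolynomial.homogeneousSubmodule (Fin (n + 1)) k t).map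
    (Ideal.Quotient.mkₐ k (Ideal.span {fermatPoly k n d})).toLinearMap

instance fermatGrading_gradedMonoid (n d : ℕ) : SetLike.GradedMonoid (fermatGrading k n d) where
  one_mem := ⟨1, MvPolynomial.isHomogeneous_one _ _, map_one (Ideal.Quotient.mkₐ k (Ideal.span {fermatPoly k n d}))⟩
  mul_mem := by
    rintro i j _ _ ⟨a, ha, rfl⟩ ⟨b, hb, rfl⟩
    exact ⟨a * b, MvPolynomial.IsHomogeneous.mul ha hb,
      map_mul (Ideal.Quotient.mkₐ k (Ideal.span {fermatPoly k n d})) a b⟩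

/-- The classes of the variables `x_0, …, x_n`. -/
def fermatVar (n d : ℕ) (i : Fin (n + 1)) : FermatRing k n d :=
  Ideal.Quotient.mk _ (MvPolynomial.X i)

theorem fermatVar_mem (n d : ℕ) (i : Fin (n + 1)) : fermatVar k n d i ∈ fermatGrading k n d 1 :=
  ⟨MvPolynomial.X i, MvPolynomial.isHomogeneous_X k i, rfl⟩

theorem homogeneous_succ_le {σ : Type*} (t : ℕ) :
    MvPolynomial.homogeneousSubmodule σ k (t + 1) ≤
      Submodule.span k (Set.range (MvPolynomial.X (R := k))) *
        MvPolynomial.homogeneousSubmodule σ k t := by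
  have h1 := MvPolynomial.homogeneousSubmodule_one_pow (σ := σ) (R := k) (t + 1)
  have h2 := MvPolynomial.homogeneousSubmodule_one_pow (σ := σ) (R := k) t
  rw [← MvPolynomial.homogeneousSubmodule_one_eq_span_X, ← h1, ← h2, pow_succ']

theorem fermatGrading_succ_le (n d t : ℕ) :
    fermatGrading k n d (t + 1) ≤
      Submodule.span k (Set.range (fermatVar k n d)) * fermatGrading k n d t := by
  have h := Submodule.map_mono
    (f := (Ideal.Quotient.mkₐ k (Ideal.span {fermatPoly k n d})).toLinearMap)
    (homogeneous_succ_le k (σ := Fin (n + 1)) t)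
  rw [Submodule.map_mul, Submodule.map_span, ← Set.range_comp] at h
  exact h

/-- The variables generate the homogeneous maximal ideal. -/
theorem span_fermatVar (n d : ℕ) :
    Ideal.span (Set.range (fermatVar k n d)) = irrelevantIdeal (fermatGrading k n d) := by
  apply le_antisymm
  · rw [Ideal.span_le]
    rintro _ ⟨i, rfl⟩
    exact Ideal.subset_span ⟨1, one_pos, fermatVar_mem k n d i⟩
  · unfold irrelevantIdeal
    rw [Ideal.span_le]
    rintro a ⟨t, ht, ha⟩
    obtain ⟨t, rfl⟩ := Nat.exists_eq_succ_of_ne_zero ht.ne'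
    refine Submodule.mul_induction_on (fermatGrading_succ_le k n d t ha) ?_ ?_
    · intro u hu v _
      refine Ideal.mul_mem_right v _ ?_
      have hs : Submodule.span k (Set.range (fermatVar k n d)) ≤
          (Ideal.span (Set.range (fermatVar k n d))).restrictScalars k :=
        Submodule.span_le.2 Ideal.subset_span
      exact hs hu
    · intro u v hu hv
      exact add_mem hu hv

/-- The Segre product `T = R # S` of the Fermat hypersurface `R` and `S = k[u, v]`. -/
abbrev FermatSegre (n d : ℕ) : Type _ :=
  segre (fermatGrading k n d) (MvPolynomial.homogeneousSubmodule (Fin 2) k)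

/-- The generators `x_i ⊗ u`, `x_i ⊗ v` of the homogeneous maximal ideal of `T`. -/
def fermatSegreVar (n d : ℕ) : Fin (n + 1) ×ₗ Fin 2 → FermatSegre k n d :=
  segreGens _ _ (fermatVar k n d) (fermatVar_mem k n d)
    MvPolynomial.X (MvPolynomial.isHomogeneous_X k)

theorem span_fermatSegreVar (n d : ℕ) :
    Ideal.span (Set.range (fermatSegreVar k n d)) = irrelevantIdeal
      (segreGrading (fermatGrading k n d) (MvPolynomial.homogeneousSubmodule (Fin 2) k)) :=
  span_segreGens _ _ _ _ _ _ (fermatGrading_succ_le k n d) (homogeneous_succ_le k)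

end Fermat

end

/-! Everything is reduced to linear algebra on monomials. Let `L` be the ring of Laurent polynomials
in `x_0, …, x_{n-1}, u, v` with a root `x_n` of `X^d = x_0^d + ⋯ + x_{n-1}^d` adjoined. It has the
`k`-basis `x^a u^b v^c x_n^e` with `e < d`, and both `R` and `T` embed in it as spans of basis
monomials. All Čech localizations embed in the total ring of fractions of `L`. Since `x_n^d` lies in
the ideal of the other variables, the generators involving `x_n` may be dropped when testing for
coboundaries (`exists_altD_eq`). For the remaining generators each localization is again a span of
basis monomials, so the Čech complex splits into one complex per exponent
(`exists_altD_eq_of_monomials`).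

For `R`, only exponents with all `a_i < 0` contribute to `H^n`, in degree `e + ∑ a_i`. The `p`-th
power of such a monomial expands into monomials with exponents `p a_i + d b_i`, where `∑ b_i =
⌊pe/d⌋`. Comparing degrees, these cannot all be negative if the degree was positive
(`degree_nonpos_of_frobenius_neg`), nor in degree `0` if `p ≡ -1` (`degree_neg_of_frobenius_neg`).
If `p ≡ 1` and `n < d`, the class of `x_n^n / (x_0 ⋯ x_{n-1})`, of degree `0`, is multiplied by a
multinomial coefficient prime to `p`, so it is never killed (`repr_pow_pow_ne_zero`).

For `T`, a direct computation replaces the Künneth formula. In cohomological degree at most `n`, the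
only exponents that contribute have all `a_i < 0` and nonnegative exponents of `u, v`, and they
occur in degree `n` alone (`exists_altD_eq_segre`). This is the part of `H^n(R)` in degrees `≥ 0`.
Hence `H^j(T)` is nilpotent for `j < n`, `H^n(T)` is nilpotent if `p ≡ -1`, and for `p ≡ 1` the
class above pulls back to a non-nilpotent class of `H^n(T)`.

Finally `H^{n+1}(T)` is never nilpotent for `n ≥ 2`: it contains a class with monomial `1 / (x_0 ⋯
x_{n-1} u v^{n-1})`, detected by a telescoping sum along a staircase of index sets
(`not_lcNilpotent_segre_succ`). Weak `F`-nilpotence needs only `dim T ≤ n + 1`, which a Noether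
normalization by `n + 1` elements gives. -/

/-! ### Alternating sums over finite sets -/

section AltSum

variable {ι : Type*} [LinearOrder ι]

/-- The sign of the position of `i` in `J`. -/
def altSign (i : ι) (J : Finset ι) : ℤ := (-1) ^ (J.filter (· < i)).card

theorem altSign_mul_self (i : ι) (J : Finset ι) : altSign i J * altSign i J = 1 := by
  unfold altSign
  rw [← mul_pow]
  norm_num

theorem altSign_insert_of_lt {i w : ι} {J : Finset ι} (hw : w ∉ J) (h : w < i) :
    altSign i (insert w J) = -altSign i J := by
  unfold altSign
  rw [Finset.filter_insert, if_pos h, Finset.card_insert_of_notMem (by simp [hw]), pow_succ]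
  ring

theorem altSign_insert_of_le {i w : ι} {J : Finset ι} (h : i ≤ w) :
    altSign i (insert w J) = altSign i J := by
  unfold altSign
  rw [Finset.filter_insert, if_neg (not_lt.2 h)]

variable {M : Type*} [AddCommGroup M]

/-- The alternating coboundary `J ↦ ∑ i ∈ J, ± g (J \ {i})`. -/
def altD : (Finset ι → M) →+ (Finset ι → M) where
  toFun g J := ∑ i ∈ J, altSign i J • g (J.erase i)
  map_zero' := by funext J; simp
  map_add' a b := by funext J; simp [smul_add, Finset.sum_add_distrib]

theorem altD_apply (g : Finset ι → M) (J : Finset ι) :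
    altD g J = ∑ i ∈ J, altSign i J • g (J.erase i) := rfl

theorem map_altD {N : Type*} [AddCommGroup N] (f : M →+ N) (g : Finset ι → M) (J : Finset ι) :
    f (altD g J) = altD (fun I => f (g I)) J := by
  simp [altD_apply, map_sum, map_zsmul]

theorem altD_congr {g g' : Finset ι → M} {J : Finset ι}
    (h : ∀ i ∈ J, g (J.erase i) = g' (J.erase i)) : altD g J = altD g' J :=
  Finset.sum_congr rfl fun i hi => by rw [h i hi]

/-- The cone homotopy with vertex `w`. -/
def altH (w : ι) (g : Finset ι → M) (I : Finset ι) : M :=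
  if w ∈ I then 0 else altSign w I • g (insert w I)

theorem altH_of_mem {w : ι} {I : Finset ι} (h : w ∈ I) (g : Finset ι → M) : altH w g I = 0 :=
  if_pos h

theorem altH_of_notMem {w : ι} {I : Finset ι} (h : w ∉ I) (g : Finset ι → M) :
    altH w g I = altSign w I • g (insert w I) := if_neg h

/-- For `i ≠ w`, the terms that remove `i` and insert `w` in either order cancel: exactly one of the
two signs changes, according to whether `i < w` or `w < i`. Only the term removing the inserted `w`
survives. -/
theorem altD_altH (w : ι) (g : Finset ι → M) (J : Finset ι) :
    altD (altH w g) J + altH w (altD g) J = g J := by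
  by_cases hw : w ∈ J
  · rw [altH_of_mem hw, add_zero, altD_apply, Finset.sum_eq_single w]
    · rw [altH_of_notMem (Finset.notMem_erase w J), Finset.insert_erase hw, smul_smul]
      have : altSign w (J.erase w) = altSign w J := by
        conv_rhs => rw [← Finset.insert_erase hw, altSign_insert_of_le le_rfl]
      rw [this, altSign_mul_self, one_smul]
    · intro i _ hi
      rw [altH_of_mem (Finset.mem_erase.2 ⟨hi.symm, hw⟩), smul_zero]
    · exact fun h => absurd hw h
  · rw [altH_of_notMem hw, altD_apply, altD_apply, Finset.sum_insert hw, smul_add, smul_smul,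
      Finset.erase_insert hw, altSign_insert_of_le le_rfl, altSign_mul_self, one_smul,
      add_left_comm, Finset.smul_sum, ← Finset.sum_add_distrib, add_eq_left]
    refine Finset.sum_eq_zero fun i hi => ?_
    have hiw : i ≠ w := fun h => hw (h ▸ hi)
    have hwe : w ∉ J.erase i := fun h => hw (Finset.mem_of_mem_erase h)
    rw [altH_of_notMem hwe, Finset.erase_insert_of_ne hiw.symm, smul_smul, smul_smul, ← add_smul]
    have h0 : i ∉ J.erase i := Finset.notMem_erase i J
    rcases lt_or_gt_of_ne hiw with h | h
    · rw [altSign_insert_of_le h.le]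
      have : altSign w J = - altSign w (J.erase i) := by
        conv_lhs => rw [← Finset.insert_erase hi, altSign_insert_of_lt h0 h]
      rw [this]
      convert zero_smul ℤ _
      ring
    · rw [altSign_insert_of_lt hw h]
      have : altSign w J = altSign w (J.erase i) := by
        conv_lhs => rw [← Finset.insert_erase hi, altSign_insert_of_le h.le]
      rw [this]
      convert zero_smul ℤ _
      ring

/-- Deduced from the homotopy formula instead of a double sum. Applying the formula to `g` and to
`altD g` shows that `altD ∘ altD` commutes with `altH w` on coboundaries; for `w ∈ J` that part
vanishes at `J`, and the rest is a sum over smaller sets. -/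
theorem altD_altD (g : Finset ι → M) (J : Finset ι) : altD (altD g) J = 0 := by
  induction hn : J.card generalizing g J with
  | zero => rw [Finset.card_eq_zero.1 hn, altD_apply, Finset.sum_empty]
  | succ n ih =>
    obtain ⟨w, hw⟩ := Finset.card_pos.1 (by omega : 0 < J.card)
    have hid : ∀ f : Finset ι → M, altD (altH w f) + altH w (altD f) = f :=
      fun f => funext (altD_altH w f)
    have h1 : altD (altD (altH w (altD g))) = altH w (altD (altD (altD g))) := by
      have h2 := congrArg altD (hid (altD g))
      rw [map_add] at h2
      exact add_right_cancel (h2.trans ((hid (altD (altD g))).symm.trans (add_comm _ _)))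
    rw [← hid g, map_add, map_add, Pi.add_apply, h1, altH_of_mem hw, add_zero, altD_apply]
    refine Finset.sum_eq_zero fun i hi => ?_
    rw [ih _ _ (by rw [Finset.card_erase_of_mem hi]; omega), smul_zero]

end AltSum

/-! ### The Čech complex inside a ring in which all elements become units -/

section CechInRing

variable {A : Type*} [CommRing A] {K : Type*} [CommRing K] (φ : A →+* K)
  {ι : Type*} (x : ι → A) (hu : ∀ i, IsUnit (φ (x i)))

include hu in
theorem isUnit_map_prod (J : Finset ι) : IsUnit (φ (∏ i ∈ J, x i)) := by
  rw [map_prod]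
  exact IsUnit.prod_iff.2 fun i _ => hu i

/-- The map `A[1 / ∏ i ∈ J, x i] → K` induced by `φ : A → K`. -/
noncomputable def cechLift (J : Finset ι) : Localization.Away (∏ i ∈ J, x i) →+* K :=
  IsLocalization.Away.lift (∏ i ∈ J, x i) (isUnit_map_prod φ x hu J)

theorem cechLift_algebraMap (J : Finset ι) (a : A) :
    cechLift φ x hu J (algebraMap A _ a) = φ a :=
  IsLocalization.Away.lift_eq _ _ a

theorem cechLift_mk (J : Finset ι) (a : A) (m : ℕ) :
    cechLift φ x hu J (Localization.mk a ⟨(∏ i ∈ J, x i) ^ m, m, rfl⟩) *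
      φ (∏ i ∈ J, x i) ^ m = φ a := by
  rw [← map_pow, ← cechLift_algebraMap φ x hu J, ← cechLift_algebraMap φ x hu J, ← map_mul,
    Localization.mk_eq_mk']
  exact congrArg _ (IsLocalization.mk'_spec _ a
    (⟨(∏ i ∈ J, x i) ^ m, m, rfl⟩ : Submonoid.powers (∏ i ∈ J, x i)))

theorem cechLift_injective (hφ : Function.Injective φ) (J : Finset ι) :
    Function.Injective (cechLift φ x hu J) := by
  refine (IsLocalization.lift_injective_iff _).2 fun a b => ⟨fun h => ?_, fun h => ?_⟩
  · rw [← cechLift_algebraMap φ x hu J, h, cechLift_algebraMap]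
  · rw [hφ h]

theorem cechLift_cechRes {I J : Finset ι} (h : I ⊆ J) (y : Localization.Away (∏ i ∈ I, x i)) :
    cechLift φ x hu J (cechRes x h y) = cechLift φ x hu I y := by
  have : (cechLift φ x hu J).comp (cechRes x h).toRingHom = cechLift φ x hu I := by
    refine IsLocalization.ringHom_ext (Submonoid.powers (∏ i ∈ I, x i)) ?_
    ext a
    simp [cechLift_algebraMap]
  exact congrArg (fun f => f y) this

/-- The image of `A[1 / ∏ i ∈ J, x i]` in `K`. -/
noncomputable def cechRange (J : Finset ι) : Subring K := (cechLift φ x hu J).range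

theorem mem_cechRange {J : Finset ι} {y : K} : y ∈ cechRange φ x hu J ↔
    ∃ (m : ℕ) (a : A), y * φ (∏ i ∈ J, x i) ^ m = φ a := by
  constructor
  · rintro ⟨z, rfl⟩
    obtain ⟨m, a, h⟩ := IsLocalization.Away.surj (∏ i ∈ J, x i) z
    refine ⟨m, a, ?_⟩
    rw [← cechLift_algebraMap φ x hu J, ← map_pow, ← map_mul, h, cechLift_algebraMap]
  · rintro ⟨m, a, h⟩
    refine ⟨Localization.mk a ⟨(∏ i ∈ J, x i) ^ m, m, rfl⟩, ?_⟩
    have h1 := cechLift_mk φ x hu J a m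
    rw [← h] at h1
    exact ((isUnit_map_prod φ x hu J).pow m).mul_right_cancel h1

theorem cechRange_mono {I J : Finset ι} (h : I ⊆ J) : cechRange φ x hu I ≤ cechRange φ x hu J := by
  rintro _ ⟨y, rfl⟩
  exact ⟨cechRes x h y, cechLift_cechRes φ x hu h y⟩

theorem map_mem_cechRange (J : Finset ι) (a : A) : φ a ∈ cechRange φ x hu J :=
  ⟨algebraMap A _ a, cechLift_algebraMap φ x hu J a⟩

/-- A Čech cochain as a `K`-valued function on finite sets. -/
noncomputable def cochainFun {j : ℕ} (c : CechCochain x j) (J : Finset ι) : K :=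
  if h : J.card = j then cechLift φ x hu J (c ⟨J, h⟩) else 0

theorem cochainFun_of_card {j : ℕ} (c : CechCochain x j) {J : Finset ι} (h : J.card = j) :
    cochainFun φ x hu c J = cechLift φ x hu J (c ⟨J, h⟩) := dif_pos h

theorem cochainFun_mem {j : ℕ} (c : CechCochain x j) (J : Finset ι) :
    cochainFun φ x hu c J ∈ cechRange φ x hu J := by
  unfold cochainFun
  split_ifs
  · exact ⟨_, rfl⟩
  · exact zero_mem _

theorem cochainFun_injective (hφ : Function.Injective φ) {j : ℕ} {c c' : CechCochain x j}
    (h : ∀ J : Finset ι, J.card = j → cochainFun φ x hu c J = cochainFun φ x hu c' J) : c = c' := by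
  funext J
  have := h J.1 J.2
  rw [cochainFun_of_card φ x hu _ J.2, cochainFun_of_card φ x hu _ J.2] at this
  exact cechLift_injective φ x hu hφ _ this

theorem exists_cochainFun_eq {j : ℕ} {g : Finset ι → K}
    (hg : ∀ J, J.card = j → g J ∈ cechRange φ x hu J) :
    ∃ c : CechCochain x j, ∀ J, J.card = j → cochainFun φ x hu c J = g J := by
  choose f hf using hg
  exact ⟨fun J => f J.1 J.2, fun J hJ => by rw [cochainFun_of_card φ x hu _ hJ, hf]⟩

variable [LinearOrder ι]

theorem cochainFun_cechD {j : ℕ} (c : CechCochain x j) {J : Finset ι} (h : J.card = j + 1) :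
    cochainFun φ x hu (cechD x j c) J = altD (cochainFun φ x hu c) J := by
  rw [cochainFun_of_card φ x hu _ h, altD_apply, cechD]
  simp only [LinearMap.pi_apply, LinearMap.sum_apply, LinearMap.smul_apply, map_sum]
  rw [← Finset.sum_coe_sort J]
  refine Finset.sum_congr rfl fun i _ => ?_
  rw [cochainFun_of_card φ x hu c (by rw [Finset.card_erase_of_mem i.2, h, Nat.add_sub_cancel]),
    ← cechLift_cechRes φ x hu (J.erase_subset i.1)]
  unfold altSign
  rw [Algebra.smul_def, map_mul, cechLift_algebraMap, zsmul_eq_mul]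
  simp

end CechInRing

/-! ### Killing a class by Frobenius, as an equation between `K`-valued cochains -/

section Nilpotent

variable (k : Type*) [Field k] (p : ℕ) [hp : Fact p.Prime] [CharP k p]
  {A : Type*} [CommRing A] [Algebra k A] {K : Type*} [CommRing K] (φ : A →+* K)
  {ι : Type*} [LinearOrder ι] (x : ι → A) (hu : ∀ i, IsUnit (φ (x i)))

theorem lcFrob_iterate_mk {j : ℕ} (e : ℕ) (z : cechZ x j) :
    (lcFrob k p x j)^[e] (Submodule.Quotient.mk z) =
      Submodule.Quotient.mk ((cocycleFrob k p x j)^[e] z) := by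
  induction e generalizing z with
  | zero => rfl
  | succ e ih =>
    rw [Function.iterate_succ_apply, Function.iterate_succ_apply, ← ih]
    rfl

theorem cocycleFrob_iterate_apply {j : ℕ} (e : ℕ) (z : cechZ x j) (I) :
    ((cocycleFrob k p x j)^[e] z).1 I = (z.1 I) ^ p ^ e := by
  induction e generalizing z with
  | zero => simp
  | succ e ih =>
    rw [Function.iterate_succ_apply, ih, pow_succ', pow_mul]
    rfl

theorem cochainFun_cocycleFrob {j : ℕ} (e : ℕ) (z : cechZ x j) {J : Finset ι} (hJ : J.card = j) :
    cochainFun φ x hu ((cocycleFrob k p x j)^[e] z).1 J = cochainFun φ x hu z.1 J ^ p ^ e := by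
  rw [cochainFun_of_card φ x hu _ hJ, cochainFun_of_card φ x hu _ hJ, cocycleFrob_iterate_apply,
    map_pow]

/-- Injectivity of `φ` makes equalities of cochains testable in `K`. The values of `b` outside size
`j` are arbitrary, since `altD b` at a set of size `j + 1` does not see them. -/
theorem lcFrob_iterate_eq_zero_iff (hφ : Function.Injective φ) {j : ℕ} (e : ℕ)
    (z : cechZ x (j + 1)) :
    (lcFrob k p x (j + 1))^[e] (Submodule.Quotient.mk z) = 0 ↔
      ∃ b : Finset ι → K, (∀ I, I.card = j → b I ∈ cechRange φ x hu I) ∧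
        ∀ J, J.card = j + 1 → altD b J = cochainFun φ x hu z.1 J ^ p ^ e := by
  rw [lcFrob_iterate_mk, Submodule.Quotient.mk_eq_zero]
  constructor
  · rintro ⟨b, hb⟩
    refine ⟨cochainFun φ x hu b, fun I _ => cochainFun_mem φ x hu b I, fun J hJ => ?_⟩
    rw [← cochainFun_cechD φ x hu b hJ, hb, ← cochainFun_cocycleFrob k p φ x hu e z hJ]
    rfl
  · rintro ⟨b, hb, h⟩
    obtain ⟨c, hc⟩ := exists_cochainFun_eq φ x hu hb
    refine ⟨c, cochainFun_injective φ x hu hφ fun J hJ => ?_⟩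
    rw [cochainFun_cechD φ x hu c hJ]
    refine (altD_congr fun i hi => ?_).trans ((h J hJ).trans
      (cochainFun_cocycleFrob k p φ x hu e z hJ).symm)
    exact hc _ (by rw [Finset.card_erase_of_mem hi, hJ, Nat.add_sub_cancel])

theorem altD_cochainFun_eq_zero {j : ℕ} (z : cechZ x j) {J : Finset ι} (hJ : J.card = j + 1) :
    altD (cochainFun φ x hu z.1) J = 0 := by
  have h : cechD x j z.1 = 0 := z.2
  rw [← cochainFun_cechD φ x hu z.1 hJ, h, cochainFun_of_card φ x hu _ hJ]
  exact map_zero _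

theorem exists_cocycle (hφ : Function.Injective φ) {j : ℕ} {g : Finset ι → K}
    (hg : ∀ J, J.card = j → g J ∈ cechRange φ x hu J)
    (hd : ∀ J, J.card = j + 1 → altD g J = 0) :
    ∃ z : cechZ x j, ∀ J, J.card = j → cochainFun φ x hu z.1 J = g J := by
  obtain ⟨c, hc⟩ := exists_cochainFun_eq φ x hu hg
  refine ⟨⟨c, cochainFun_injective φ x hu hφ fun J hJ => ?_⟩, hc⟩
  rw [cochainFun_cechD φ x hu c hJ, cochainFun_of_card φ x hu _ hJ]
  refine Eq.trans ?_ (map_zero _).symm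
  rw [← hd J hJ]
  exact altD_congr fun i hi => hc _ (by rw [Finset.card_erase_of_mem hi, hJ, Nat.add_sub_cancel])

end Nilpotent

/-! ### Enlarging the family without changing the radical -/

section Removal

variable {A : Type*} [CommRing A] {K : Type*} [CommRing K] (φ : A →+* K)
  {ι : Type*} [LinearOrder ι] (x : ι → A) (hu : ∀ i, IsUnit (φ (x i)))

theorem exists_pow_mul_mem_cechRange {I : Finset ι} {i : ι} {y : K}
    (hy : y ∈ cechRange φ x hu (insert i I)) : ∃ N, ∀ m, N ≤ m → φ (x i) ^ m * y ∈ cechRange φ x hu I := by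
  obtain ⟨N, a, h⟩ := (mem_cechRange φ x hu).1 hy
  by_cases hi : i ∈ I
  · rw [Finset.insert_eq_of_mem hi] at hy
    exact ⟨0, fun m _ => mul_mem (pow_mem (map_mem_cechRange φ x hu I _) m) hy⟩
  · refine ⟨N, fun m hm => ?_⟩
    refine (mem_cechRange φ x hu).2 ⟨N, x i ^ (m - N) * a, ?_⟩
    rw [map_mul, ← h, Finset.prod_insert hi, map_mul, map_pow]
    conv_lhs => rw [← Nat.sub_add_cancel hm, pow_add]
    ring

/-- If a cocycle restricted to `Λ` is a coboundary, and `i₀` lies in the radical of the ideal of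
`Λ`, then the restriction to `insert i₀ Λ` is a coboundary. -/
theorem exists_altD_eq_insert [Finite ι] {j : ℕ} {g : Finset ι → K}
    (hg : ∀ J, J.card = j + 1 → g J ∈ cechRange φ x hu J)
    (hd : ∀ J, J.card = j + 2 → altD g J = 0) (Λ : Finset ι) (i₀ : ι)
    (hrad : x i₀ ∈ (Ideal.span (x '' Λ)).radical)
    (h : ∃ b : Finset ι → K, (∀ I, I.card = j → b I ∈ cechRange φ x hu I) ∧
      ∀ J ⊆ Λ, J.card = j + 1 → altD b J = g J) :
    ∃ b : Finset ι → K, (∀ I, I.card = j → b I ∈ cechRange φ x hu I) ∧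
      ∀ J ⊆ insert i₀ Λ, J.card = j + 1 → altD b J = g J := by
  classical
  by_cases hΛ : i₀ ∈ Λ
  · rwa [Finset.insert_eq_of_mem hΛ]
  obtain ⟨b, hb, hbg⟩ := h
  -- After subtracting the known coboundary, the cocycle vanishes on sets avoiding `i₀`. Cutting it
  -- off outside `insert i₀ Λ` makes that vanishing hold for all sets.
  set g' : Finset ι → K := fun J => if J ⊆ insert i₀ Λ then g J - altD b J else 0 with hg'
  have hbr : ∀ J : Finset ι, J.card = j + 1 → altD b J ∈ cechRange φ x hu J := fun J hJ =>
    sum_mem fun i hi => zsmul_mem (cechRange_mono φ x hu (J.erase_subset i)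
      (hb _ (by rw [Finset.card_erase_of_mem hi, hJ, Nat.add_sub_cancel]))) _
  have hg'r : ∀ J, J.card = j + 1 → g' J ∈ cechRange φ x hu J := by
    intro J hJ
    rw [hg']
    dsimp only
    split_ifs
    · exact sub_mem (hg J hJ) (hbr J hJ)
    · exact zero_mem _
  have hg'd : ∀ J ⊆ insert i₀ Λ, J.card = j + 2 → altD g' J = 0 := by
    intro J hJ hc
    have : altD g' J = altD (g - altD b) J := altD_congr fun i hi => by
      rw [hg']
      exact if_pos ((J.erase_subset i).trans hJ)
    rw [this, map_sub, Pi.sub_apply, hd J hc, altD_altD, sub_zero]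
  have hg'0 : ∀ J, J.card = j + 1 → i₀ ∉ J → g' J = 0 := by
    intro J hc hi
    rw [hg']
    dsimp only
    split_ifs with h1
    · rw [hbg J ((Finset.subset_insert_iff_of_notMem hi).1 h1) hc, sub_self]
    · rfl
  -- The multipliers `a` for which `a g'` bounds a cochain living on sets that contain `i₀`. This
  -- support condition allows a later division by a power of `x i₀`.
  let 𝔞 : Ideal A :=
    { carrier := {a | ∃ c : Finset ι → K, (∀ I, I.card = j → c I ∈ cechRange φ x hu I) ∧
        (∀ I, I.card = j → i₀ ∉ I → c I = 0) ∧
        ∀ J ⊆ insert i₀ Λ, J.card = j + 1 → altD c J = φ a * g' J}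
      zero_mem' := ⟨0, fun _ _ => zero_mem _, fun _ _ _ => rfl, fun J _ _ => by simp⟩
      add_mem' := by
        rintro a a' ⟨c, h1, h2, h3⟩ ⟨c', h1', h2', h3'⟩
        refine ⟨c + c', fun I hI => add_mem (h1 I hI) (h1' I hI), fun I hI hi => ?_,
          fun J hJ hc => ?_⟩
        · rw [Pi.add_apply, h2 I hI hi, h2' I hI hi, add_zero]
        · rw [map_add, Pi.add_apply, h3 J hJ hc, h3' J hJ hc, map_add, add_mul]
      smul_mem' := by
        rintro a a' ⟨c, h1, h2, h3⟩
        refine ⟨fun I => φ a * c I, fun I hI => mul_mem (map_mem_cechRange φ x hu I a) (h1 I hI),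
          fun I hI hi => by simp only [h2 I hI hi, mul_zero], fun J hJ hc => ?_⟩
        rw [smul_eq_mul, map_mul, mul_assoc, ← h3 J hJ hc]
        exact (map_altD (AddMonoidHom.mulLeft (φ a)) c J).symm }
  have hmem : ∀ i ∈ Λ, x i ∈ 𝔞.radical := by
    intro i hi
    have hN : ∀ I : Finset ι, I.card = j → ∃ N, ∀ m, N ≤ m →
        φ (x i) ^ m * altH i g' I ∈ cechRange φ x hu I := by
      intro I hI
      by_cases hiI : i ∈ I
      · exact ⟨0, fun m _ => by rw [altH_of_mem hiI, mul_zero]; exact zero_mem _⟩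
      · obtain ⟨N, hN⟩ := exists_pow_mul_mem_cechRange φ x hu
          (hg'r (insert i I) (by rw [Finset.card_insert_of_notMem hiI, hI]))
        refine ⟨N, fun m hm => ?_⟩
        rw [altH_of_notMem hiI, mul_smul_comm]
        exact zsmul_mem (hN m hm) _
    have := Fintype.ofFinite ι
    choose! N hN using hN
    -- A power of `x i` clears the denominators introduced by the cone homotopy with vertex `i`.
    -- There are finitely many sets `I`, so the sum of the local exponents works for all of them.
    refine ⟨∑ I : Finset ι, N I, fun I => φ (x i) ^ (∑ I, N I) * altH i g' I,
      fun I hI => hN I hI _ (Finset.single_le_sum (fun _ _ => Nat.zero_le _) (Finset.mem_univ I)),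
      fun I hI hi0 => ?_, fun J hJ hc => ?_⟩
    · beta_reduce
      by_cases hiI : i ∈ I
      · rw [altH_of_mem hiI, mul_zero]
      · have hii : i ≠ i₀ := fun h => hΛ (h ▸ hi)
        rw [altH_of_notMem hiI, hg'0 _ (by rw [Finset.card_insert_of_notMem hiI, hI]),
          smul_zero, mul_zero]
        rw [Finset.mem_insert, not_or]
        exact ⟨fun h => hii h.symm, hi0⟩
    · have h1 := map_altD (AddMonoidHom.mulLeft (φ (x i) ^ ∑ I, N I)) (altH i g') J
      refine h1.symm.trans ?_
      have h2 := altD_altH i g' J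
      have h3 : altH i (altD g') J = 0 := by
        by_cases hiJ : i ∈ J
        · exact altH_of_mem hiJ _
        · rw [altH_of_notMem hiJ, hg'd _ (Finset.insert_subset (Finset.mem_insert_of_mem hi) hJ)
            (by rw [Finset.card_insert_of_notMem hiJ, hc]), smul_zero]
      rw [h3, add_zero] at h2
      rw [h2, map_pow]
      rfl
  have hx0 : x i₀ ∈ 𝔞.radical := by
    have h1 : Ideal.span (x '' Λ) ≤ 𝔞.radical := by
      rw [Ideal.span_le]
      rintro _ ⟨i, hi, rfl⟩
      exact hmem i hi
    have h2 := Ideal.radical_mono h1 hrad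
    rwa [Ideal.radical_idem] at h2
  obtain ⟨M, c, hc1, hc2, hc3⟩ := hx0
  obtain ⟨u, hu0⟩ := (hu i₀).pow M
  -- Some `x i₀ ^ M` lies in `𝔞`. Dividing the resulting cochain by it stays in the localizations,
  -- because the cochain lives on sets containing `i₀`.
  refine ⟨b + fun I => (↑u⁻¹ : K) * c I, fun I hI => add_mem (hb I hI) ?_, fun J hJ hc => ?_⟩
  · by_cases hi : i₀ ∈ I
    · refine mul_mem ?_ (hc1 I hI)
      refine (mem_cechRange φ x hu).2 ⟨M, (∏ i ∈ I.erase i₀, x i) ^ M, ?_⟩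
      rw [← Finset.mul_prod_erase I _ hi, map_mul, mul_pow, ← hu0, ← mul_assoc,
        Units.inv_mul, one_mul, map_pow]
    · simp only [hc2 I hI hi, mul_zero]
      exact zero_mem _
  · rw [map_add, Pi.add_apply]
    have h1 := map_altD (AddMonoidHom.mulLeft (↑u⁻¹ : K)) c J
    have h2 : g' J = g J - altD b J := if_pos hJ
    refine (congrArg _ h1.symm).trans ?_
    rw [hc3 J hJ hc, map_pow, ← hu0, h2]
    rw [AddMonoidHom.coe_mulLeft, ← mul_assoc, Units.inv_mul, one_mul]
    abel

/-- Indices are added to `Λ` one at a time; the radical hypothesis only gets weaker as the ideal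
grows. -/
theorem exists_altD_eq [Finite ι] {j : ℕ} {g : Finset ι → K}
    (hg : ∀ J, J.card = j + 1 → g J ∈ cechRange φ x hu J)
    (hd : ∀ J, J.card = j + 2 → altD g J = 0) (Λ : Finset ι)
    (hrad : ∀ i, x i ∈ (Ideal.span (x '' Λ)).radical)
    (h : ∃ b : Finset ι → K, (∀ I, I.card = j → b I ∈ cechRange φ x hu I) ∧
      ∀ J ⊆ Λ, J.card = j + 1 → altD b J = g J) :
    ∃ b : Finset ι → K, (∀ I, I.card = j → b I ∈ cechRange φ x hu I) ∧
      ∀ J, J.card = j + 1 → altD b J = g J := by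
  classical
  have := Fintype.ofFinite ι
  have key : ∀ s : Finset ι, ∃ b : Finset ι → K, (∀ I, I.card = j → b I ∈ cechRange φ x hu I) ∧
      ∀ J ⊆ s ∪ Λ, J.card = j + 1 → altD b J = g J := by
    intro s
    induction s using Finset.induction_on with
    | empty => simpa using h
    | insert i s _ ih =>
      rw [Finset.insert_union]
      refine exists_altD_eq_insert φ x hu hg hd (s ∪ Λ) i ?_ ih
      exact Ideal.radical_mono (Ideal.span_mono (Set.image_mono (by intro a ha; exact Finset.mem_union_right _ ha))) (hrad i)
  obtain ⟨b, hb, h⟩ := key Finset.univ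
  exact ⟨b, hb, fun J hJ => h J (fun a _ => Finset.mem_union_left _ (Finset.mem_univ a)) hJ⟩

end Removal

/-! ### The Laurent ring of a Fermat hypersurface -/

section FermatLaurent

variable (k : Type*) [Field k] (n d : ℕ)

/-- Exponents of Laurent monomials in `x_0, …, x_{n-1}` and `u, v`. -/
abbrev FermatExp (n : ℕ) : Type := (Fin n → ℤ) × (Fin 2 → ℤ)

/-- The Laurent polynomial `x_0 ^ d + ⋯ + x_{n-1} ^ d`. -/
noncomputable def fermatSum : AddMonoidAlgebra k (FermatExp n) :=
  ∑ i, AddMonoidAlgebra.single (Pi.single i (d : ℤ), 0) 1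

/-- The ring `k[x_0^±, …, x_{n-1}^±, u^±, v^±][x_n] / (x_n ^ d - x_0 ^ d - ⋯ - x_{n-1} ^ d)`. -/
abbrev FermatLaurent : Type _ :=
  AdjoinRoot (Polynomial.X ^ d - Polynomial.C (fermatSum k n d))

/-- The Laurent monomial with exponent `v`. -/
noncomputable def fMon (v : FermatExp n) : FermatLaurent k n d :=
  algebraMap (AddMonoidAlgebra k (FermatExp n)) _ (AddMonoidAlgebra.single v 1)

/-- The class of `x_n`. -/
noncomputable def fRoot : FermatLaurent k n d := AdjoinRoot.root _

theorem fMon_zero : fMon k n d 0 = 1 := map_one (algebraMap _ _)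

theorem fMon_add (v w : FermatExp n) : fMon k n d (v + w) = fMon k n d v * fMon k n d w := by
  unfold fMon
  rw [← map_mul, AddMonoidAlgebra.single_mul_single, one_mul]

theorem fMon_nsmul (m : ℕ) (v : FermatExp n) : fMon k n d (m • v) = fMon k n d v ^ m := by
  induction m with
  | zero => rw [zero_smul, fMon_zero, pow_zero]
  | succ m ih => rw [succ_nsmul, fMon_add, ih, pow_succ]

theorem fMon_sum {ι : Type*} (s : Finset ι) (v : ι → FermatExp n) :
    fMon k n d (∑ i ∈ s, v i) = ∏ i ∈ s, fMon k n d (v i) := by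
  classical
  induction s using Finset.induction_on with
  | empty => simp [fMon_zero]
  | insert i s hi ih => rw [Finset.sum_insert hi, Finset.prod_insert hi, fMon_add, ih]

theorem isUnit_fMon (v : FermatExp n) : IsUnit (fMon k n d v) :=
  IsUnit.of_mul_eq_one (fMon k n d (-v)) (by rw [← fMon_add, add_neg_cancel, fMon_zero])

theorem fRoot_pow : fRoot k n d ^ d = ∑ i, fMon k n d (Pi.single i (d : ℤ), 0) := by
  have h := AdjoinRoot.mk_self (f := Polynomial.X ^ d - Polynomial.C (fermatSum k n d))
  rw [map_sub, map_pow, AdjoinRoot.mk_X, AdjoinRoot.mk_C, sub_eq_zero] at h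
  exact h.trans (map_sum (algebraMap (AddMonoidAlgebra k (FermatExp n)) (FermatLaurent k n d))
    (fun i => AddMonoidAlgebra.single (Pi.single i (d : ℤ), 0) 1) Finset.univ)

variable [NeZero d]

/-- The `k`-basis of monomials `x^a u^b v^c x_n^e` with `e < d`. -/
noncomputable def fBasis : Module.Basis (FermatExp n × Fin d) k (FermatLaurent k n d) :=
  ((AddMonoidAlgebra.basis (FermatExp n) k).smulTower (AdjoinRoot.powerBasis'
    (Polynomial.monic_X_pow_sub_C (fermatSum k n d) (NeZero.ne d))).basis).reindex
    ((Equiv.refl _).prodCongr (finCongr Polynomial.natDegree_X_pow_sub_C))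

theorem fBasis_apply (μ : FermatExp n × Fin d) :
    fBasis k n d μ = fMon k n d μ.1 * fRoot k n d ^ (μ.2 : ℕ) := by
  unfold fBasis
  rw [Module.Basis.reindex_apply, Module.Basis.smulTower_apply, PowerBasis.basis_eq_pow,
    AddMonoidAlgebra.basis_apply, Algebra.smul_def]
  rfl

theorem fMon_mul_fBasis (v : FermatExp n) (μ : FermatExp n × Fin d) :
    fMon k n d v * fBasis k n d μ = fBasis k n d (v + μ.1, μ.2) := by
  rw [fBasis_apply, fBasis_apply, fMon_add, mul_assoc]

/-- The span of the monomials with exponent in `s`. -/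
noncomputable def fSpan (s : Set (FermatExp n × Fin d)) : Submodule k (FermatLaurent k n d) :=
  Submodule.span k (fBasis k n d '' s)

variable {k n d}

theorem mem_fSpan {s : Set (FermatExp n × Fin d)} {f : FermatLaurent k n d} :
    f ∈ fSpan k n d s ↔ ∀ μ, (fBasis k n d).repr f μ ≠ 0 → μ ∈ s := by
  unfold fSpan
  rw [Module.Basis.mem_span_image]
  simp [Set.subset_def]

theorem fBasis_mem_fSpan {s : Set (FermatExp n × Fin d)} {μ : FermatExp n × Fin d} (h : μ ∈ s) :
    fBasis k n d μ ∈ fSpan k n d s := Submodule.subset_span ⟨μ, h, rfl⟩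

theorem fSpan_mono {s t : Set (FermatExp n × Fin d)} (h : s ⊆ t) :
    fSpan k n d s ≤ fSpan k n d t := Submodule.span_mono (Set.image_mono h)

theorem fermatSum_ne_zero (hn : 0 < n) : fermatSum k n d ≠ 0 := by
  intro h
  have h1 := congrArg (fun f => f.coeff (Pi.single ⟨0, hn⟩ (d : ℤ), 0)) h
  have hd : (d : ℤ) ≠ 0 := by exact_mod_cast NeZero.ne d
  unfold fermatSum at h1
  simp only [AddMonoidAlgebra.coeff_sum, Finsupp.finsetSum_apply] at h1
  rw [Finset.sum_eq_single ⟨0, hn⟩] at h1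
  · simp at h1
  · intro i _ hi
    rw [AddMonoidAlgebra.coeff_single, Finsupp.single_eq_of_ne]
    intro h2
    have h3 := congrFun (congrArg Prod.fst h2) i
    simp only [Pi.single_eq_same, Pi.single_eq_of_ne hi] at h3
    exact hd h3.symm
  · simp

/-- The Laurent ring is free over a domain that contains `x_n ^ d` as a nonzero element, so `x_n`
kills nothing. This makes `x_n` a unit in the total ring of fractions. -/
theorem fRoot_mem_nonZeroDivisors (hn : 0 < n) :
    fRoot k n d ∈ nonZeroDivisors (FermatLaurent k n d) := by
  have hfree : Module.Free (AddMonoidAlgebra k (FermatExp n)) (FermatLaurent k n d) :=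
    Module.Free.of_basis (AdjoinRoot.powerBasis'
      (Polynomial.monic_X_pow_sub_C (fermatSum k n d) (NeZero.ne d))).basis
  rw [mem_nonZeroDivisors_iff_right]
  intro y hy
  have h1 : fermatSum k n d • y = 0 := by
    have h2 : algebraMap _ (FermatLaurent k n d) (fermatSum k n d) = fRoot k n d ^ d := by
      rw [fRoot_pow]
      exact (map_sum (algebraMap (AddMonoidAlgebra k (FermatExp n)) (FermatLaurent k n d))
        (fun i => AddMonoidAlgebra.single (Pi.single i (d : ℤ), 0) 1) Finset.univ)
    have h3 : fRoot k n d ^ d = fRoot k n d * fRoot k n d ^ (d - 1) :=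
      (mul_pow_sub_one (NeZero.ne d) _).symm
    rw [Algebra.smul_def, h2, mul_comm, h3, ← mul_assoc, hy, zero_mul]
  exact (smul_eq_zero.1 h1).resolve_left (fermatSum_ne_zero hn)

/-- Reduction of the powers of `x_n`. -/
theorem fMon_mul_fRoot_pow_mem (v : FermatExp n) (N : ℕ) :
    fMon k n d v * fRoot k n d ^ N ∈ fSpan k n d {μ | ∃ b : Fin n → ℕ, ∑ i, b i = N / d ∧
      μ.1 = (v.1 + fun i => (d : ℤ) * b i, v.2) ∧ (μ.2 : ℕ) = N % d} := by
  -- Induction on the quotient `m = N / d` with the residue fixed: each factor `x_n ^ d` is replaced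
  -- by `∑ x_i ^ d`, which raises one `b i` by one.
  have key : ∀ m : ℕ, ∀ v : FermatExp n, fMon k n d v * fRoot k n d ^ (d * m + N % d) ∈
      fSpan k n d {μ | ∃ b : Fin n → ℕ, ∑ i, b i = m ∧
        μ.1 = (v.1 + fun i => (d : ℤ) * b i, v.2) ∧ (μ.2 : ℕ) = N % d} := by
    intro m
    induction m with
    | zero =>
      intro v
      rw [mul_zero, zero_add]
      have := fBasis_apply k n d (v, ⟨N % d, Nat.mod_lt _ (NeZero.pos d)⟩)
      dsimp only at this
      rw [← this]
      refine fBasis_mem_fSpan ⟨0, by simp, ?_, rfl⟩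
      ext <;> simp
    | succ m ih =>
      intro v
      have : d * (m + 1) + N % d = d + (d * m + N % d) := by ring
      rw [this, pow_add, fRoot_pow, Finset.sum_mul, Finset.mul_sum]
      refine sum_mem fun i _ => ?_
      rw [← mul_assoc, ← fMon_add]
      refine fSpan_mono ?_ (ih _)
      rintro μ ⟨b, hb, h1, h2⟩
      refine ⟨b + Pi.single i 1, ?_, ?_, h2⟩
      · simp [Finset.sum_add_distrib, hb]
      · rw [h1]
        ext l
        · by_cases hl : l = i
          · subst hl; simp; ring
          · simp [hl]
        · simp
  have := key (N / d) v
  rwa [Nat.div_add_mod] at this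

/-- The Frobenius in coordinates: `x_n ^ (p e)` equals `x_n ^ (p e % d)` times the `⌊p e / d⌋`-th
power of `∑ x_i ^ d`, and `b` runs over the exponents of that expansion. -/
theorem fBasis_pow_mem (p : ℕ) (μ : FermatExp n × Fin d) : fBasis k n d μ ^ p ∈ fSpan k n d {ν |
    ∃ b : Fin n → ℕ, ∑ i, b i = (p * μ.2) / d ∧
      ν.1 = (fun i => (p : ℤ) * μ.1.1 i + (d : ℤ) * b i, fun c => (p : ℤ) * μ.1.2 c) ∧
      (ν.2 : ℕ) = (p * μ.2) % d} := by
  rw [fBasis_apply, mul_pow, ← fMon_nsmul, ← pow_mul, mul_comm (μ.2 : ℕ)]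
  refine fSpan_mono ?_ (fMon_mul_fRoot_pow_mem _ _)
  rintro ν ⟨b, hb, h1, h2⟩
  refine ⟨b, hb, ?_, h2⟩
  rw [h1]
  ext <;> simp

end FermatLaurent

/-! ### Degree bounds for monomials whose Frobenius power has a term with all exponents negative -/

section FrobeniusDegree

variable {n d : ℕ} [NeZero d] (p : ℕ)

/-- Frobenius powers of monomials of positive degree contain no monomial with negative exponents
at all of `x_0, …, x_{n-1}`. -/
theorem degree_nonpos_of_frobenius_neg (hn : 0 < n) (hpd : d < p) (a : Fin n → ℤ) (e : ℕ) (b : Fin n → ℕ)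
    (hb : ∑ i, b i = (p * e) / d) (h : ∀ i, (p : ℤ) * a i + (d : ℤ) * b i < 0) :
    (e : ℤ) + ∑ i, a i ≤ 0 := by
  by_contra! hlt
  -- Conservation of degree: `p` times the degree is `∑ (p a_i + d b_i) + (p e mod d)`, hence at
  -- most `-n + (d - 1) < p`.
  have h1 : ∑ i, ((p : ℤ) * a i + (d : ℤ) * b i) ≤ ∑ i : Fin n, (-1 : ℤ) :=
    Finset.sum_le_sum fun i _ => by have := h i; omega
  rw [Finset.sum_add_distrib, ← Finset.mul_sum, ← Finset.mul_sum, ← Nat.cast_sum, hb] at h1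
  have h2 := Nat.div_add_mod (p * e) d
  have h3 := Nat.mod_lt (p * e) (NeZero.pos d)
  have h2' : (d : ℤ) * ((p * e / d : ℕ) : ℤ) = p * e - ((p * e) % d : ℕ) := by
    have : ((d * (p * e / d) + (p * e) % d : ℕ) : ℤ) = (p * e : ℕ) := by rw [h2]
    push_cast at this ⊢
    linarith
  rw [h2'] at h1
  simp at h1
  have h4 : (p : ℤ) * 1 ≤ p * ((e : ℤ) + ∑ i, a i) := by
    apply mul_le_mul_of_nonneg_left <;> omega
  have h5 : (d : ℤ) < p := by exact_mod_cast hpd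
  have h6 : (((p * e) % d : ℕ) : ℤ) < d := by exact_mod_cast h3
  push_cast at h6
  nlinarith

/-- Only degree `0` has to be excluded. There `∑ (p a_i + d b_i) = -(p e mod d) = e - d`, while the
congruence bounds each negative term by `-a_i - d`, so the sum is at most `e - n d`. This
contradicts `n ≥ 2`. -/
theorem degree_neg_of_frobenius_neg (hp : 0 < p) (hn : 2 ≤ n) (hpd : d < p) (hp1 : (p : ℤ) ≡ -1 [ZMOD (d : ℤ)])
    (a : Fin n → ℤ) (e : ℕ) (he : e < d) (b : Fin n → ℕ)
    (hb : ∑ i, b i = (p * e) / d) (h : ∀ i, (p : ℤ) * a i + (d : ℤ) * b i < 0) :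
    (e : ℤ) + ∑ i, a i < 0 := by
  refine lt_of_le_of_ne (degree_nonpos_of_frobenius_neg p (by omega) hpd a e b hb h) fun h0 => ?_
  have hp0 : (0 : ℤ) < p := by exact_mod_cast hp
  have ha : ∀ i, a i < 0 := fun i => by
    by_contra! hi
    have := h i
    have : 0 ≤ (p : ℤ) * a i := mul_nonneg hp0.le hi
    have : 0 ≤ (d : ℤ) * b i := by positivity
    omega
  have hae : ∀ i, -a i ≤ e := fun i => by
    have h1 : ∑ j, a j ≤ a i := by
      rw [← Finset.add_sum_erase _ _ (Finset.mem_univ i)]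
      have : ∑ j ∈ Finset.univ.erase i, a j ≤ 0 := Finset.sum_nonpos fun j _ => (ha j).le
      omega
    omega
  obtain ⟨c, hc⟩ := hp1.symm.dvd
  -- Since `p ≡ -1`, the left side is `-a_i` plus a multiple of `d`. As `-a_i > 0`, it is negative
  -- only if that multiple is at most `-d`.
  have hkey : ∀ i, (p : ℤ) * a i + (d : ℤ) * b i ≤ -(d + a i) := by
    intro i
    have h1 := h i
    have h2 : (p : ℤ) * a i + d * b i = -a i + d * (c * a i + b i) := by
      have : (p : ℤ) = d * c - 1 := by linarith
      rw [this]; ring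
    rw [h2] at h1 ⊢
    have h3 : c * a i + b i ≤ -1 := by
      by_contra! h4
      have : 0 ≤ (d : ℤ) * (c * a i + b i) := mul_nonneg (by positivity) (by omega)
      have := ha i
      omega
    nlinarith
  have hs : ∑ i, ((p : ℤ) * a i + (d : ℤ) * b i) ≤ ∑ i, -((d : ℤ) + a i) :=
    Finset.sum_le_sum fun i _ => hkey i
  rw [Finset.sum_add_distrib, ← Finset.mul_sum, ← Finset.mul_sum, ← Nat.cast_sum, hb,
    Finset.sum_neg_distrib, Finset.sum_add_distrib] at hs
  have h2 := Nat.div_add_mod (p * e) d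
  have h2' : (d : ℤ) * ((p * e / d : ℕ) : ℤ) = p * e - ((p * e) % d : ℕ) := by
    have : ((d * (p * e / d) + (p * e) % d : ℕ) : ℤ) = (p * e : ℕ) := by rw [h2]
    push_cast at this ⊢
    linarith
  -- Positivity of `e` makes `d - e` a genuine residue below `d`, so that it equals `p e % d`.
  have he0 : 0 < e := by
    have := ha ⟨0, by omega⟩
    have := hae ⟨0, by omega⟩
    omega
  have hmod : ((p * e) % d : ℕ) = d - e := by
    have h5 : ((p * e : ℕ) : ℤ) ≡ ((d - e : ℕ) : ℤ) [ZMOD d] := by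
      rw [Nat.cast_sub he.le]
      refine Int.ModEq.symm ((Int.modEq_iff_dvd).2 ⟨c * e - 1, ?_⟩)
      have : (p : ℤ) = d * c - 1 := by linarith
      push_cast
      rw [this]
      ring
    rw [Int.natCast_modEq_iff] at h5
    rw [h5, Nat.mod_eq_of_lt (by omega)]
  rw [h2', hmod, Nat.cast_sub he.le] at hs
  have hsum : ∑ i, a i = -e := by linarith
  rw [hsum] at hs
  simp at hs
  have hn' : (2 : ℤ) ≤ n := by exact_mod_cast hn
  have hd0 : (0 : ℤ) < d := by exact_mod_cast NeZero.pos d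
  nlinarith

end FrobeniusDegree

/-! ### Frobenius on spans of monomials, and the socle monomial -/

section FermatLaurentFrobenius

variable {k : Type*} [Field k] {n d : ℕ} [NeZero d] (p : ℕ) [hp : Fact p.Prime] [CharP k p]

include hp in
-- In characteristic `p` the power map is additive and semilinear, so it suffices to look at
-- monomials.
theorem pow_mem_fSpan {s t : Set (FermatExp n × Fin d)}
    (h : ∀ μ ∈ s, fBasis k n d μ ^ p ∈ fSpan k n d t) {f : FermatLaurent k n d}
    (hf : f ∈ fSpan k n d s) : f ^ p ∈ fSpan k n d t := by
  refine Submodule.span_induction (p := fun f _ => f ^ p ∈ fSpan k n d t) ?_ ?_ ?_ ?_ hf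
  · rintro _ ⟨μ, hμ, rfl⟩
    exact h μ hμ
  · rw [zero_pow hp.out.ne_zero]
    exact zero_mem _
  · intro x y _ _ hx hy
    have := map_add (frobAdd k p (FermatLaurent k n d)) x y
    change (x + y) ^ p = x ^ p + y ^ p at this
    rw [this]
    exact add_mem hx hy
  · intro a x _ hx
    rw [smul_pow]
    exact Submodule.smul_mem _ _ hx

/-- Exponents such that some `x_i`, `i < n`, has a nonnegative exponent. -/
def someNonneg (n d : ℕ) : Set (FermatExp n × Fin d) := {μ | ∃ i, 0 ≤ μ.1.1 i}

include hp in
theorem pow_mem_fSpan_someNonneg {f : FermatLaurent k n d} (hf : f ∈ fSpan k n d (someNonneg n d)) :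
    f ^ p ∈ fSpan k n d (someNonneg n d) := by
  refine pow_mem_fSpan p ?_ hf
  rintro μ ⟨i, hi⟩
  refine fSpan_mono ?_ (fBasis_pow_mem p μ)
  rintro ν ⟨b, -, h, -⟩
  refine ⟨i, ?_⟩
  rw [h]
  dsimp only
  positivity

/-- The exponent of `x_n ^ n / (x_0 ⋯ x_{n-1})`. -/
def socleExp (n d : ℕ) (h : n < d) : FermatExp n × Fin d := ((fun _ => -1, 0), ⟨n, h⟩)

include hp in
theorem exists_eq_mul_add_one {d : ℕ} (hp1 : (p : ℤ) ≡ 1 [ZMOD (d : ℤ)]) :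
    ∃ c : ℕ, p = d * c + 1 := by
  have h1 : (d : ℤ) ∣ (p - 1 : ℕ) := by
    rw [Nat.cast_sub hp.out.one_le]
    exact hp1.symm.dvd
  obtain ⟨c, hc⟩ := Int.natCast_dvd_natCast.1 h1
  exact ⟨c, by have := hp.out.one_le; omega⟩

omit [CharP k p] in
-- With `p = d c + 1` one has `p n = n + d (n c)`, so the terms have exponents `-p + d b_i` with `∑
-- b_i = n c`. If all are negative, then `b_i ≤ c` for every `i`, and the sum forces `b_i = c`: the
-- exponent is the original one.
theorem fBasis_socleExp_pow (hnd : n < d) (hp1 : (p : ℤ) ≡ 1 [ZMOD (d : ℤ)]) :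
    fBasis k n d (socleExp n d hnd) ^ p ∈
      fSpan k n d (insert (socleExp n d hnd) (someNonneg n d)) := by
  refine fSpan_mono ?_ (fBasis_pow_mem p _)
  obtain ⟨c, hc⟩ := exists_eq_mul_add_one p hp1
  rintro ν ⟨b, hb, h1, h2⟩
  by_cases h : ∃ i, 0 ≤ ν.1.1 i
  · exact Or.inr h
  push Not at h
  left
  have hpn : p * n = n + d * (n * c) := by rw [hc]; ring
  simp only [socleExp, hpn, Nat.add_mul_div_left _ _ (NeZero.pos d), Nat.div_eq_of_lt hnd,
    zero_add, Nat.add_mul_mod_self_left, Nat.mod_eq_of_lt hnd] at hb h1 h2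
  have hle : ∀ i ∈ Finset.univ, b i ≤ c := by
    intro i _
    have h3 := h i
    rw [h1] at h3
    dsimp only at h3
    have h4 : d * b i < d * c + 1 := by
      rw [← hc]
      zify
      linarith
    exact Nat.le_of_mul_le_mul_left (Nat.lt_succ_iff.1 h4) (NeZero.pos d)
  have heq := (Finset.sum_eq_sum_iff_of_le hle).1 (by simp [hb])
  refine Prod.ext ?_ (Fin.ext h2)
  rw [h1]
  refine Prod.ext (funext fun i => ?_) (funext fun i => ?_)
  · dsimp only [socleExp]
    rw [heq i (Finset.mem_univ i), hc]
    push_cast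
    ring
  · simp [socleExp]

/-- The coefficient is the multinomial `(n c)! / (c!)^n`. It is nonzero in `k` because `n c ≤ d c <
p`. -/
theorem repr_fBasis_socleExp_pow (hnd : n < d) (hp1 : (p : ℤ) ≡ 1 [ZMOD (d : ℤ)]) :
    (fBasis k n d).repr (fBasis k n d (socleExp n d hnd) ^ p) (socleExp n d hnd) ≠ 0 := by
  obtain ⟨c, hc⟩ := exists_eq_mul_add_one p hp1
  have h1 : fBasis k n d (socleExp n d hnd) ^ p = ∑ b ∈ Finset.piAntidiag Finset.univ (n * c),
      (Nat.multinomial Finset.univ b : k) •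
        fBasis k n d ((fun i => -(p : ℤ) + d * b i, 0), ⟨n, hnd⟩) := by
    have hpn : n * p = n + d * (n * c) := by rw [hc]; ring
    rw [fBasis_apply, mul_pow, ← fMon_nsmul, ← pow_mul]
    change _ * fRoot k n d ^ (n * p) = _
    rw [hpn, pow_add, pow_mul _ d, fRoot_pow,
      Finset.sum_pow_eq_sum_piAntidiag, Finset.mul_sum, Finset.mul_sum]
    refine Finset.sum_congr rfl fun b _ => ?_
    have hm : ∏ i, fMon k n d (Pi.single i (d : ℤ), 0) ^ b i =
        fMon k n d (fun i => (d : ℤ) * b i, 0) := by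
      simp_rw [← fMon_nsmul]
      rw [← fMon_sum]
      congr 1
      refine Prod.ext (funext fun i => ?_) (funext fun i => ?_)
      · simp [Prod.fst_sum, Finset.sum_apply, Pi.single_apply, mul_comm]
      · simp [Prod.snd_sum]
    have hv : ((fun i => -(p : ℤ) + d * b i, 0) : FermatExp n) =
        p • (socleExp n d hnd).1 + (fun i => (d : ℤ) * b i, 0) := by
      refine Prod.ext (funext fun i => ?_) (funext fun i => ?_) <;> simp [socleExp]
    rw [fBasis_apply, hm, hv, fMon_add, Nat.cast_smul_eq_nsmul, nsmul_eq_mul]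
    ring
  rw [h1, map_sum, Finsupp.finsetSum_apply, Finset.sum_eq_single (fun _ => c)]
  · have h2 : ((fun i => -(p : ℤ) + d * ((fun _ => c : Fin n → ℕ) i : ℕ), 0), ⟨n, hnd⟩) =
        socleExp n d hnd := by
      refine Prod.ext (Prod.ext (funext fun i => ?_) rfl) rfl
      rw [hc]
      dsimp only [socleExp]
      push_cast
      ring
    rw [h2, map_smul, Module.Basis.repr_self, Finsupp.smul_single, Finsupp.single_eq_same,
      smul_eq_mul, mul_one, Ne, CharP.cast_eq_zero_iff k p]
    intro h3
    have h4 : p ∣ (n * c).factorial := by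
      have := Nat.multinomial_spec Finset.univ (fun _ : Fin n => c)
      simp only [Finset.sum_const, Finset.card_univ, Fintype.card_fin, smul_eq_mul] at this
      rw [← this]
      exact h3.mul_left _
    have h5 := (Nat.Prime.dvd_factorial hp.out).1 h4
    have h6 : n * c ≤ d * c := Nat.mul_le_mul_right _ hnd.le
    omega
  · intro b _ hb
    rw [map_smul, Module.Basis.repr_self, Finsupp.smul_single, Finsupp.single_eq_of_ne]
    intro h2
    apply hb
    funext i
    have h3 := congrFun (congrArg (fun μ => μ.1.1) h2) i
    simp only [socleExp] at h3
    have h4 : (d : ℤ) * b i = d * c := by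
      rw [hc] at h3
      push_cast at h3
      linarith
    exact_mod_cast mul_left_cancel₀ (by exact_mod_cast NeZero.ne d) h4
  · intro h
    exact absurd (by simp) h

/-- Elements congruent to a nonzero multiple of `x_n ^ n / (x_0 ⋯ x_{n-1})` remain so under
Frobenius. -/
theorem repr_pow_pow_ne_zero (hnd : n < d) (hp1 : (p : ℤ) ≡ 1 [ZMOD (d : ℤ)])
    {f : FermatLaurent k n d} (hf : f ∈ fSpan k n d (insert (socleExp n d hnd) (someNonneg n d)))
    (h0 : (fBasis k n d).repr f (socleExp n d hnd) ≠ 0) (s : ℕ) :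
    (fBasis k n d).repr (f ^ p ^ s) (socleExp n d hnd) ≠ 0 := by
  have hS : socleExp n d hnd ∉ someNonneg n d := by
    rintro ⟨i, hi⟩
    simp [socleExp] at hi
  suffices h : f ^ p ^ s ∈ fSpan k n d (insert (socleExp n d hnd) (someNonneg n d)) ∧
      (fBasis k n d).repr (f ^ p ^ s) (socleExp n d hnd) ≠ 0 from h.2
  induction s with
  | zero => rw [pow_zero, pow_one]; exact ⟨hf, h0⟩
  | succ s ih =>
    obtain ⟨h1, h2⟩ := ih
    rw [pow_succ, pow_mul]
    set g := f ^ p ^ s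
    refine ⟨pow_mem_fSpan p ?_ h1, ?_⟩
    · rintro μ (rfl | hμ)
      · exact fBasis_socleExp_pow p hnd hp1
      · exact fSpan_mono (Set.subset_insert _ _)
          (pow_mem_fSpan_someNonneg p (fBasis_mem_fSpan hμ))
    · unfold fSpan at h1
      -- Write the element as a nonzero multiple of the socle monomial plus `w` with exponents in
      -- `someNonneg`. Frobenius is additive and keeps `w` there, so only the first summand matters.
      rw [Set.image_insert_eq, Submodule.mem_span_insert] at h1
      obtain ⟨c, w, hw, hg⟩ := h1
      have hwp := pow_mem_fSpan_someNonneg p hw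
      have h3 : ∀ w ∈ fSpan k n d (someNonneg n d),
          (fBasis k n d).repr w (socleExp n d hnd) = 0 := fun w hw => by
        by_contra h
        exact hS (mem_fSpan.1 hw _ h)
      have hc : c ≠ 0 := by
        rintro rfl
        rw [zero_smul, zero_add] at hg
        exact h2 (hg ▸ h3 w hw)
      have h4 := map_add (frobAdd k p (FermatLaurent k n d)) (c • fBasis k n d (socleExp n d hnd)) w
      change (_ + w) ^ p = _ ^ p + w ^ p at h4
      rw [hg, h4, map_add, Finsupp.add_apply, h3 _ hwp, add_zero, smul_pow, map_smul,
        Finsupp.smul_apply, smul_eq_mul]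
      exact mul_ne_zero (pow_ne_zero _ hc) (repr_fBasis_socleExp_pow p hnd hp1)

end FermatLaurentFrobenius

/-! ### The Fermat ring and the Segre product inside the Laurent ring -/

/-- Used for injectivity of the embeddings in the Laurent ring: only spanning is known of the
monomials in the source, and their independence is inherited from the images. -/
theorem eq_zero_of_mem_span_of_map_eq_zero {k V W I : Type*} [Field k] [AddCommGroup V] [Module k V]
    [AddCommGroup W] [Module k W] (f : V →ₗ[k] W) (v : I → V)
    {w : I → W} (hw : LinearIndependent k w) (hv : ∀ i, f (v i) = w i) {y : V} (hy : y ∈ Submodule.span k (Set.range v))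
    (h : f y = 0) : y = 0 := by
  obtain ⟨l, rfl⟩ := (Finsupp.mem_span_range_iff_exists_finsupp).1 hy
  rw [Finsupp.sum, map_sum] at h
  have h1 : l = 0 := by
    refine linearIndependent_iff.1 hw l ?_
    rw [Finsupp.linearCombination_apply, Finsupp.sum, ← h]
    exact Finset.sum_congr rfl fun i _ => by rw [map_smul, hv]
  rw [h1, Finsupp.sum_zero_index]

section Maps

variable (k : Type*) [Field k] (n d : ℕ)

/-- The images of `x_0, …, x_n` in the Laurent ring. -/
noncomputable def fVar : Fin (n + 1) → FermatLaurent k n d :=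
  Fin.lastCases (fRoot k n d) (fun i => fMon k n d (Pi.single i 1, 0))

theorem fVar_castSucc (i : Fin n) : fVar k n d i.castSucc = fMon k n d (Pi.single i 1, 0) := by
  simp [fVar]

theorem fVar_last : fVar k n d (Fin.last n) = fRoot k n d := by simp [fVar]

theorem fVar_last_pow : fVar k n d (Fin.last n) ^ d = ∑ i : Fin n, fVar k n d i.castSucc ^ d := by
  rw [fVar_last, fRoot_pow]
  refine Finset.sum_congr rfl fun i _ => ?_
  rw [fVar_castSucc, ← fMon_nsmul]
  congr 1
  ext l
  · by_cases h : l = i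
    · subst h; simp
    · simp [h]
  · simp

/-- The images of `u, v` in the Laurent ring. -/
noncomputable def fUV (c : Fin 2) : FermatLaurent k n d := fMon k n d (0, Pi.single c 1)

/-- The embedding of the Fermat ring in the Laurent ring. -/
noncomputable def fermatToLaurent : FermatRing k n d →ₐ[k] FermatLaurent k n d :=
  Ideal.Quotient.liftₐ _ (MvPolynomial.aeval (fVar k n d)) (by
    intro a ha
    have h : Ideal.span {fermatPoly k n d} ≤ RingHom.ker (MvPolynomial.aeval (R := k) (fVar k n d)) := by
      rw [Ideal.span_le, Set.singleton_subset_iff]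
      change MvPolynomial.aeval (fVar k n d) (fermatPoly k n d) = 0
      simp [fermatPoly, fVar_last_pow]
    exact h ha)

theorem fermatToLaurent_fermatVar (i : Fin (n + 1)) :
    fermatToLaurent k n d (fermatVar k n d i) = fVar k n d i := by
  change MvPolynomial.aeval (fVar k n d) (MvPolynomial.X i) = _
  rw [MvPolynomial.aeval_X]

/-- The embedding of `k[u, v]` in the Laurent ring. -/
noncomputable def uvToLaurent : MvPolynomial (Fin 2) k →ₐ[k] FermatLaurent k n d :=
  MvPolynomial.aeval (fUV k n d)

/-- The embedding of the Segre product in the Laurent ring. -/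
noncomputable def segreToLaurent : FermatSegre k n d →ₐ[k] FermatLaurent k n d :=
  (Algebra.TensorProduct.productMap (fermatToLaurent k n d) (uvToLaurent k n d)).comp
    (segre (fermatGrading k n d) (MvPolynomial.homogeneousSubmodule (Fin 2) k)).val

theorem segreToLaurent_mk (r : FermatRing k n d) (s : MvPolynomial (Fin 2) k) (h) :
    segreToLaurent k n d ⟨r ⊗ₜ[k] s, h⟩ = fermatToLaurent k n d r * uvToLaurent k n d s := rfl

theorem segreToLaurent_var (w : Fin (n + 1) ×ₗ Fin 2) :
    segreToLaurent k n d (fermatSegreVar k n d w) =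
      fVar k n d (ofLex w).1 * fUV k n d (ofLex w).2 := by
  refine (segreToLaurent_mk k n d _ _ _).trans ?_
  rw [fermatToLaurent_fermatVar]
  simp [uvToLaurent]

/-- The monomial `x_0^{a_0} ⋯ x_{n-1}^{a_{n-1}} x_n^e` of the Fermat ring. -/
noncomputable def fermatMon (a : Fin n → ℕ) (e : ℕ) : FermatRing k n d :=
  (∏ i, fermatVar k n d i.castSucc ^ a i) * fermatVar k n d (Fin.last n) ^ e

/-- The monomial `u^b v^c`. -/
noncomputable def uvMon (b : Fin 2 → ℕ) : MvPolynomial (Fin 2) k := ∏ c, MvPolynomial.X c ^ b c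

theorem fermatVar_mul_fermatMon (i : Fin n) (a : Fin n → ℕ) (e : ℕ) :
    fermatVar k n d i.castSucc * fermatMon k n d a e = fermatMon k n d (a + Pi.single i 1) e := by
  unfold fermatMon
  have h : ∏ l, fermatVar k n d (Fin.castSucc l) ^ (Pi.single i 1 : Fin n → ℕ) l =
      fermatVar k n d i.castSucc := by
    rw [Finset.prod_eq_single i]
    · simp
    · intro l _ hl; simp [hl]
    · simp
  simp only [Pi.add_apply, pow_add, Finset.prod_mul_distrib, h]
  ring

theorem fermatVar_pow_mul_fermatMon (i : Fin n) (m : ℕ) (a : Fin n → ℕ) (e : ℕ) :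
    fermatVar k n d i.castSucc ^ m * fermatMon k n d a e = fermatMon k n d (a + m • Pi.single i 1) e := by
  induction m with
  | zero => simp
  | succ m ih => rw [pow_succ', mul_assoc, ih, fermatVar_mul_fermatMon, succ_nsmul, add_assoc]

theorem fermatVar_last_pow :
    fermatVar k n d (Fin.last n) ^ d = ∑ i : Fin n, fermatVar k n d i.castSucc ^ d := by
  have h : Ideal.Quotient.mk (Ideal.span {fermatPoly k n d}) (fermatPoly k n d) = 0 :=
    Ideal.Quotient.eq_zero_iff_mem.2 (Ideal.subset_span rfl)
  unfold fermatPoly at h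
  rw [map_sub, map_sum, sub_eq_zero] at h
  simp only [map_pow] at h
  exact h.symm

theorem fermatMon_mem (a : Fin n → ℕ) (e : ℕ) :
    fermatMon k n d a e ∈ fermatGrading k n d (∑ i, a i + e) := by
  refine SetLike.GradedMul.mul_mem ?_ ?_
  · have h := SetLike.prod_mem_graded (A := fermatGrading k n d) a (fun i => fermatVar k n d i.castSucc ^ a i)
      (F := Finset.univ) (fun i _ => by
        have := SetLike.pow_mem_graded (A := fermatGrading k n d) (a i) (fermatVar_mem k n d i.castSucc)
        simpa using this)
    exact h
  · have := SetLike.pow_mem_graded (A := fermatGrading k n d) e (fermatVar_mem k n d (Fin.last n))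
    simpa using this

theorem uvMon_mem (b : Fin 2 → ℕ) :
    uvMon k b ∈ MvPolynomial.homogeneousSubmodule (Fin 2) k (∑ c, b c) := by
  refine MvPolynomial.IsHomogeneous.prod _ _ _ fun c _ => ?_
  simpa using (MvPolynomial.isHomogeneous_X k c).pow (b c)

theorem homogeneousSubmodule_zero_le {σ : Type*} :
    MvPolynomial.homogeneousSubmodule σ k 0 ≤ Submodule.span k {1} := by
  intro f hf
  have h := MvPolynomial.totalDegree_eq_zero_iff_eq_C.1
    (Nat.le_zero.1 (MvPolynomial.IsHomogeneous.totalDegree_le hf))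
  rw [h, ← mul_one (MvPolynomial.C _), ← MvPolynomial.smul_eq_C_mul]
  exact Submodule.smul_mem _ _ (Submodule.subset_span rfl)

theorem homogeneousSubmodule_le_span (t : ℕ) : MvPolynomial.homogeneousSubmodule (Fin 2) k t ≤
    Submodule.span k (uvMon k '' {b | ∑ c, b c = t}) := by
  induction t with
  | zero =>
    refine (homogeneousSubmodule_zero_le k).trans (Submodule.span_mono ?_)
    rintro _ rfl
    exact ⟨0, by simp, by simp [uvMon]⟩
  | succ t ih =>
    refine (homogeneous_succ_le k t).trans ?_
    refine (mul_le_mul' le_rfl ih).trans ?_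
    rw [Submodule.span_mul_span, Submodule.span_le]
    rintro _ ⟨_, ⟨c, rfl⟩, _, ⟨b, hb, rfl⟩, rfl⟩
    refine Submodule.subset_span ⟨b + Pi.single c 1, ?_, ?_⟩
    · change ∑ c, b c = t at hb
      rw [Fin.sum_univ_two] at hb
      fin_cases c <;> simp <;> omega
    · fin_cases c <;> simp [uvMon, Fin.prod_univ_two] <;> ring

theorem uvToLaurent_uvMon (b : Fin 2 → ℕ) :
    uvToLaurent k n d (uvMon k b) = fMon k n d (0, fun c => (b c : ℤ)) := by
  unfold uvMon uvToLaurent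
  have h : ((0, fun c => (b c : ℤ)) : FermatExp n) = ∑ c, b c • ((0, Pi.single c 1) : FermatExp n) := by
    refine Prod.ext (funext fun i => ?_) (funext fun i => ?_)
    · simp
    · fin_cases i <;> simp
  rw [h, fMon_sum, map_prod]
  refine Finset.prod_congr rfl fun c _ => ?_
  rw [map_pow, MvPolynomial.aeval_X, fMon_nsmul]
  rfl

variable [NeZero d]

/-- Multiplication by `x_n` leaves the range `e < d` only at `e = d - 1`, where the defining
relation trades `x_n ^ d` for the sum of the `x_i ^ d`. -/
theorem fermatGrading_le_span (t : ℕ) : fermatGrading k n d t ≤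
    Submodule.span k ((fun q : (Fin n → ℕ) × Fin d => fermatMon k n d q.1 q.2) ''
      {q | ∑ i, q.1 i + q.2 = t}) := by
  induction t with
  | zero =>
    refine (Submodule.map_mono (homogeneousSubmodule_zero_le k)).trans ?_
    rw [Submodule.map_span, Submodule.span_le]
    rintro _ ⟨_, rfl, rfl⟩
    refine Submodule.subset_span ⟨(0, ⟨0, NeZero.pos d⟩), by simp, ?_⟩
    simp [fermatMon]
  | succ t ih =>
    refine (fermatGrading_succ_le k n d t).trans ?_
    refine (mul_le_mul' le_rfl ih).trans ?_
    rw [Submodule.span_mul_span, Submodule.span_le]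
    rintro _ ⟨_, ⟨j, rfl⟩, _, ⟨⟨a, e⟩, hq, rfl⟩, rfl⟩
    change ∑ i, a i + (e : ℕ) = t at hq
    dsimp only
    induction j using Fin.lastCases with
    | last =>
      by_cases he : (e : ℕ) + 1 < d
      · refine Submodule.subset_span ⟨(a, ⟨e + 1, he⟩), ?_, ?_⟩
        · simp; omega
        · simp only [fermatMon]
          ring
      · have he' : (e : ℕ) + 1 = d := by have := e.2; omega
        have : fermatVar k n d (Fin.last n) * fermatMon k n d a e =
            ∑ i : Fin n, fermatMon k n d (a + d • Pi.single i 1) 0 := by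
          have h1 : fermatVar k n d (Fin.last n) * fermatMon k n d a e =
              fermatVar k n d (Fin.last n) ^ ((e : ℕ) + 1) * fermatMon k n d a 0 := by
            unfold fermatMon
            ring
          have h2 : fermatVar k n d (Fin.last n) ^ ((e : ℕ) + 1) =
              fermatVar k n d (Fin.last n) ^ d := congrArg _ he'
          rw [h1, h2, fermatVar_last_pow, Finset.sum_mul]
          exact Finset.sum_congr rfl fun i _ => fermatVar_pow_mul_fermatMon k n d i d a 0
        rw [this]
        refine sum_mem fun i _ => Submodule.subset_span
          ⟨(a + d • Pi.single i 1, ⟨0, NeZero.pos d⟩), ?_, rfl⟩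
        simp [Finset.sum_add_distrib, ← Finset.mul_sum]
        omega
    | cast i =>
      refine Submodule.subset_span ⟨(a + Pi.single i 1, e), ?_, ?_⟩
      · simp [Finset.sum_add_distrib]; omega
      · exact (fermatVar_mul_fermatMon k n d i a e).symm

theorem fermatToLaurent_fermatMon (a : Fin n → ℕ) (e : Fin d) :
    fermatToLaurent k n d (fermatMon k n d a e) =
      fBasis k n d ((fun i => (a i : ℤ), 0), e) := by
  unfold fermatMon
  rw [map_mul, map_prod, map_pow, fermatToLaurent_fermatVar, fVar_last, fBasis_apply]
  congr 1
  have h : ((fun i => (a i : ℤ), 0) : FermatExp n) = ∑ i, a i • ((Pi.single i 1, 0) : FermatExp n) := by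
    refine Prod.ext (funext fun i => ?_) (funext fun i => ?_)
    · simp [Prod.fst_sum, Finset.sum_apply, Pi.single_apply]
    · simp [Prod.snd_sum]
  rw [h, fMon_sum]
  refine Finset.prod_congr rfl fun i _ => ?_
  rw [map_pow, fermatToLaurent_fermatVar, fVar_castSucc, fMon_nsmul]

theorem fermatToLaurent_mem {t : ℕ} {r : FermatRing k n d} (hr : r ∈ fermatGrading k n d t) :
    fermatToLaurent k n d r ∈ fSpan k n d {μ | (∀ i, 0 ≤ μ.1.1 i) ∧ μ.1.2 = 0 ∧
      (μ.2 : ℤ) + ∑ i, μ.1.1 i = t} := by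
  have h := Submodule.mem_map_of_mem (f := (fermatToLaurent k n d).toLinearMap)
    (fermatGrading_le_span k n d t hr)
  rw [Submodule.map_span] at h
  refine Submodule.span_mono ?_ h
  rintro _ ⟨_, ⟨⟨a, e⟩, hq, rfl⟩, rfl⟩
  refine ⟨((fun i => (a i : ℤ), 0), e), ⟨fun i => by simp, rfl, ?_⟩,
    (fermatToLaurent_fermatMon k n d a e).symm⟩
  change ∑ i, a i + (e : ℕ) = t at hq
  rw [← hq]
  push_cast
  ring

/-- The index map of the monomial basis of the Segre product. -/
abbrev SegreIdx (n d : ℕ) : Type :=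
  {q : ((Fin n → ℕ) × (Fin 2 → ℕ)) × Fin d // ∑ i, q.1.1 i + q.2 = ∑ c, q.1.2 c}

theorem mem_span_of_mem_segre {y : FermatRing k n d ⊗[k] MvPolynomial (Fin 2) k}
    (hy : y ∈ segre (fermatGrading k n d) (MvPolynomial.homogeneousSubmodule (Fin 2) k)) : y ∈ Submodule.span k (Set.range fun q : SegreIdx n d =>
      fermatMon k n d q.1.1.1 q.1.2 ⊗ₜ[k] uvMon k q.1.1.2) := by
  have h : (⨆ t, segrePiece (fermatGrading k n d) (MvPolynomial.homogeneousSubmodule (Fin 2) k) t) ≤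
      Submodule.span k (Set.range fun q : SegreIdx n d =>
        fermatMon k n d q.1.1.1 q.1.2 ⊗ₜ[k] uvMon k q.1.1.2) := by
    refine iSup_le fun t => ?_
    unfold segrePiece
    refine (Submodule.map₂_le_map₂ (fermatGrading_le_span k n d t)
      (homogeneousSubmodule_le_span k t)).trans ?_
    rw [Submodule.map₂_span_span]
    refine Submodule.span_mono ?_
    rintro _ ⟨_, ⟨⟨a, e⟩, hq, rfl⟩, _, ⟨b, hb, rfl⟩, rfl⟩
    exact ⟨⟨((a, b), e), hq.trans hb.symm⟩, rfl⟩
  exact h hy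

theorem segreToLaurent_mon (q : SegreIdx n d) (h) :
    segreToLaurent k n d ⟨fermatMon k n d q.1.1.1 q.1.2 ⊗ₜ[k] uvMon k q.1.1.2, h⟩ =
      fBasis k n d ((fun i => (q.1.1.1 i : ℤ), fun c => (q.1.1.2 c : ℤ)), q.1.2) := by
  rw [segreToLaurent_mk, fermatToLaurent_fermatMon, uvToLaurent_uvMon, mul_comm, fMon_mul_fBasis]
  congr 2
  ext <;> simp

/-- The Segre product is spanned by tensors of monomials of equal degree, and these go to distinct
basis monomials. -/
theorem segreToLaurent_injective : Function.Injective (segreToLaurent k n d) := by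
  rw [injective_iff_map_eq_zero]
  intro y hy
  refine Subtype.ext (eq_zero_of_mem_span_of_map_eq_zero (Algebra.TensorProduct.productMap
    (fermatToLaurent k n d) (uvToLaurent k n d)).toLinearMap _ ?_ (fun q =>
      segreToLaurent_mon k n d q (tmul_mem_segre _ _ (fermatMon_mem k n d _ _)
        (by rw [q.2]; exact uvMon_mem k _)))
    (mem_span_of_mem_segre k n d y.2) hy)
  exact (fBasis k n d).linearIndependent.comp (fun q : SegreIdx n d =>
    (((fun i => (q.1.1.1 i : ℤ), fun c => (q.1.1.2 c : ℤ)), q.1.2) : FermatExp n × Fin d)) (by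
      rintro ⟨⟨⟨a, b⟩, e⟩, hq⟩ ⟨⟨⟨a', b'⟩, e'⟩, hq'⟩ h
      simp only [Prod.mk.injEq, funext_iff, Nat.cast_inj] at h
      obtain ⟨⟨h1, h2⟩, h3⟩ := h
      simp [funext h1, funext h2, h3])

theorem fermatToLaurent_injective : Function.Injective (fermatToLaurent k n d) := by
  rw [injective_iff_map_eq_zero]
  intro y hy
  refine eq_zero_of_mem_span_of_map_eq_zero (fermatToLaurent k n d).toLinearMap
    (fun q : (Fin n → ℕ) × Fin d => fermatMon k n d q.1 q.2) ?_
    (fun q => fermatToLaurent_fermatMon k n d q.1 q.2) ?_ hy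
  · exact (fBasis k n d).linearIndependent.comp (fun q : (Fin n → ℕ) × Fin d =>
      (((fun i => (q.1 i : ℤ), 0), q.2) : FermatExp n × Fin d)) (by
        rintro ⟨a, e⟩ ⟨a', e'⟩ h
        simp only [Prod.mk.injEq, funext_iff, Nat.cast_inj] at h
        obtain ⟨⟨h1, -⟩, h3⟩ := h
        simp [funext h1, h3])
  · obtain ⟨f, rfl⟩ := Ideal.Quotient.mk_surjective y
    rw [← MvPolynomial.sum_homogeneousComponent f, map_sum]
    refine sum_mem fun t _ => ?_
    refine Submodule.span_mono (Set.image_subset_range _ _) (fermatGrading_le_span k n d t ?_)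
    exact ⟨_, MvPolynomial.homogeneousComponent_mem t f, rfl⟩

theorem mem_range_segreToLaurent {f : FermatLaurent k n d} :
    f ∈ (segreToLaurent k n d).range ↔ f ∈ fSpan k n d {μ | (∀ i, 0 ≤ μ.1.1 i) ∧
      (∀ c, 0 ≤ μ.1.2 c) ∧ (μ.2 : ℤ) + ∑ i, μ.1.1 i = ∑ c, μ.1.2 c} := by
  constructor
  · rintro ⟨y, rfl⟩
    have h := Submodule.mem_map_of_mem (f := (Algebra.TensorProduct.productMap
      (fermatToLaurent k n d) (uvToLaurent k n d)).toLinearMap) (mem_span_of_mem_segre k n d y.2)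
    rw [Submodule.map_span] at h
    refine Submodule.span_mono ?_ h
    rintro _ ⟨_, ⟨q, rfl⟩, rfl⟩
    refine ⟨((fun i => (q.1.1.1 i : ℤ), fun c => (q.1.1.2 c : ℤ)), q.1.2),
      ⟨fun i => by simp, fun c => by simp, ?_⟩,
      (segreToLaurent_mon k n d q (tmul_mem_segre _ _ (fermatMon_mem k n d _ _)
        (by rw [q.2]; exact uvMon_mem k _))).symm⟩
    have := q.2
    zify at this
    linarith
  · intro h
    have hle : fSpan k n d {μ | (∀ i, 0 ≤ μ.1.1 i) ∧
        (∀ c, 0 ≤ μ.1.2 c) ∧ (μ.2 : ℤ) + ∑ i, μ.1.1 i = ∑ c, μ.1.2 c} ≤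
        Subalgebra.toSubmodule (segreToLaurent k n d).range := by
      unfold fSpan
      rw [Submodule.span_le]
      rintro _ ⟨⟨⟨a, b⟩, e⟩, ⟨h1, h2, h3⟩, rfl⟩
      dsimp only at h1 h2 h3
      lift a to Fin n → ℕ using h1
      lift b to Fin 2 → ℕ using h2
      have hq : ∑ i, a i + (e : ℕ) = ∑ c, b c := by
        zify
        linarith
      exact ⟨_, segreToLaurent_mon k n d ⟨((a, b), e), hq⟩ (tmul_mem_segre _ _
        (fermatMon_mem k n d _ _) (by rw [hq]; exact uvMon_mem k _))⟩
    exact hle h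

theorem mem_range_fermatToLaurent {f : FermatLaurent k n d} :
    f ∈ (fermatToLaurent k n d).range ↔ f ∈ fSpan k n d {μ | (∀ i, 0 ≤ μ.1.1 i) ∧ μ.1.2 = 0} := by
  constructor
  · rintro ⟨y, rfl⟩
    obtain ⟨f, rfl⟩ := Ideal.Quotient.mk_surjective y
    rw [← MvPolynomial.sum_homogeneousComponent f, map_sum]
    change fermatToLaurent k n d _ ∈ _
    rw [map_sum]
    refine sum_mem fun t _ => fSpan_mono ?_ (fermatToLaurent_mem k n d (t := t)
      ⟨_, MvPolynomial.homogeneousComponent_mem t f, rfl⟩)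
    exact fun μ h => ⟨h.1, h.2.1⟩
  · intro h
    have hle : fSpan k n d {μ | (∀ i, 0 ≤ μ.1.1 i) ∧ μ.1.2 = 0} ≤
        Subalgebra.toSubmodule (fermatToLaurent k n d).range := by
      unfold fSpan
      rw [Submodule.span_le]
      rintro _ ⟨⟨⟨a, b⟩, e⟩, ⟨h1, h2⟩, rfl⟩
      dsimp only at h1 h2
      subst h2
      lift a to Fin n → ℕ using h1
      exact ⟨_, fermatToLaurent_fermatMon k n d a e⟩
    exact hle h

end Maps

/-! ### Čech complexes in terms of Laurent monomials -/

section Monomials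

variable {k : Type*} [Field k] {n d : ℕ} [NeZero d] {A : Type*} [CommRing A] [Algebra k A]

theorem fMon_mul_mem_fSpan {s : Set (FermatExp n × Fin d)} {f : FermatLaurent k n d}
    (hf : f ∈ fSpan k n d s) (v : FermatExp n) :
    fMon k n d v * f ∈ fSpan k n d {μ | (-v + μ.1, μ.2) ∈ s} := by
  refine Submodule.span_induction (p := fun f _ => fMon k n d v * f ∈ fSpan k n d _) ?_ ?_ ?_ ?_ hf
  · rintro _ ⟨μ, hμ, rfl⟩
    rw [fMon_mul_fBasis]
    refine fBasis_mem_fSpan ?_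
    simpa using hμ
  · rw [mul_zero]; exact zero_mem _
  · intro x y _ _ hx hy
    rw [mul_add]
    exact add_mem hx hy
  · intro a x _ hx
    rw [mul_smul_comm]
    exact Submodule.smul_mem _ _ hx

/-- A map to the Laurent ring, followed by the map to its total ring of fractions. -/
noncomputable abbrev toFrac (φ : A →ₐ[k] FermatLaurent k n d) : A →+* FractionRing (FermatLaurent k n d) :=
  (algebraMap _ _).comp φ.toRingHom

omit [NeZero d] in
theorem algebraMap_frac_injective : Function.Injective
    (algebraMap (FermatLaurent k n d) (FractionRing (FermatLaurent k n d))) :=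
  IsFractionRing.injective _ _

omit [NeZero d] in
theorem toFrac_injective {φ : A →ₐ[k] FermatLaurent k n d} (hφ : Function.Injective φ) :
    Function.Injective (toFrac φ) := algebraMap_frac_injective.comp hφ

variable {ι : Type*} (φ : A →ₐ[k] FermatLaurent k n d) (x : ι → A)
  (hu : ∀ i, IsUnit (toFrac φ (x i)))

/-- Inverting a monomial translates exponent sets. This requires the generators indexed by `J` to
map to Laurent monomials, which excludes those involving `x_n`. -/
theorem mem_cechRange_iff_fSpan {D : Set (FermatExp n × Fin d)}
    (hD : ∀ f, f ∈ φ.range ↔ f ∈ fSpan k n d D) {J : Finset ι} {v : ι → FermatExp n}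
    (hv : ∀ i ∈ J, φ (x i) = fMon k n d (v i)) {y : FractionRing (FermatLaurent k n d)} :
    y ∈ cechRange (toFrac φ) x hu J ↔
      ∃ f ∈ fSpan k n d {μ | ∃ m : ℕ, (m • ∑ i ∈ J, v i + μ.1, μ.2) ∈ D},
        algebraMap _ _ f = y := by
  have hx : φ (∏ i ∈ J, x i) = fMon k n d (∑ i ∈ J, v i) := by
    rw [map_prod, fMon_sum]
    exact Finset.prod_congr rfl hv
  have hx' : toFrac φ (∏ i ∈ J, x i) = algebraMap _ _ (fMon k n d (∑ i ∈ J, v i)) :=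
    congrArg (algebraMap _ _) hx
  constructor
  · intro hy
    obtain ⟨m, a, h⟩ := (mem_cechRange _ _ _).1 hy
    refine ⟨fMon k n d (-(m • ∑ i ∈ J, v i)) * φ a, ?_, ?_⟩
    · refine fSpan_mono ?_ (fMon_mul_mem_fSpan ((hD _).1 ⟨a, rfl⟩) _)
      intro μ hμ
      refine ⟨m, ?_⟩
      simpa using hμ
    · refine ((isUnit_map_prod _ _ hu J).pow m).mul_right_cancel (Eq.trans ?_ h.symm)
      rw [hx', ← map_pow, ← fMon_nsmul, ← map_mul, mul_right_comm, ← fMon_add, neg_add_cancel,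
        fMon_zero, one_mul]
      rfl
  · rintro ⟨f, hf, rfl⟩
    refine Submodule.span_induction
      (p := fun f _ => algebraMap _ _ f ∈ cechRange (toFrac φ) x hu J) ?_ ?_ ?_ ?_ hf
    · rintro _ ⟨μ, ⟨m, hm⟩, rfl⟩
      obtain ⟨a, ha⟩ := (hD _).2 (fBasis_mem_fSpan hm)
      refine (mem_cechRange _ _ _).2 ⟨m, a, ?_⟩
      rw [hx', ← map_pow, ← fMon_nsmul, ← map_mul, mul_comm, fMon_mul_fBasis, ← ha]
      rfl
    · rw [map_zero]; exact zero_mem _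
    · intro f g _ _ hf hg
      rw [map_add]
      exact add_mem hf hg
    · intro c f _ hf
      rw [Algebra.smul_def, map_mul]
      refine mul_mem ?_ hf
      have := map_mem_cechRange (toFrac φ) x hu J (algebraMap k A c)
      simpa [toFrac] using this

variable [LinearOrder ι]

/-- A cocycle is a coboundary if this holds monomial by monomial. -/
theorem exists_altD_eq_of_monomials [Finite ι] (Λ : Finset ι)
    (D : Finset ι → Set (FermatExp n × Fin d)) (G : Set (FermatExp n × Fin d))
    (hD : ∀ J ⊆ Λ, ∀ f ∈ fSpan k n d (D J), algebraMap _ _ f ∈ cechRange (toFrac φ) x hu J)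
    {j : ℕ} {g : Finset ι → FractionRing (FermatLaurent k n d)}
    (hg : ∀ J ⊆ Λ, J.card = j + 1 → ∃ f ∈ fSpan k n d (D J ∩ G), algebraMap _ _ f = g J)
    (hd : ∀ J, J.card = j + 2 → altD g J = 0)
    (hsolve : ∀ μ ∈ G, ∀ c : Finset ι → k, (∀ J ⊆ Λ, J.card = j + 1 → c J ≠ 0 → μ ∈ D J) →
      (∀ J ⊆ Λ, J.card = j + 2 → altD c J = 0) →
      ∃ b : Finset ι → k, (∀ I ⊆ Λ, I.card = j → b I ≠ 0 → μ ∈ D I) ∧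
        ∀ J ⊆ Λ, J.card = j + 1 → altD b J = c J) :
    ∃ b : Finset ι → FractionRing (FermatLaurent k n d),
      (∀ I, I.card = j → b I ∈ cechRange (toFrac φ) x hu I) ∧
        ∀ J ⊆ Λ, J.card = j + 1 → altD b J = g J := by
  classical
  have := Fintype.ofFinite ι
  have hf : ∀ J : Finset ι, ∃ f : FermatLaurent k n d, J ⊆ Λ → J.card = j + 1 →
      f ∈ fSpan k n d (D J ∩ G) ∧ algebraMap _ _ f = g J := by
    intro J
    by_cases h : J ⊆ Λ ∧ J.card = j + 1
    · obtain ⟨f, hf⟩ := hg J h.1 h.2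
      exact ⟨f, fun _ _ => hf⟩
    · exact ⟨0, fun h1 h2 => absurd ⟨h1, h2⟩ h⟩
  choose f hf using hf
  have hfd : ∀ J ⊆ Λ, J.card = j + 2 → altD f J = 0 := by
    intro J hJ hc
    apply algebraMap_frac_injective
    have h1 := map_altD (algebraMap (FermatLaurent k n d)
      (FractionRing (FermatLaurent k n d))).toAddMonoidHom f J
    refine h1.trans ?_
    rw [map_zero, ← hd J hc]
    exact altD_congr fun i hi => (hf _ ((J.erase_subset i).trans hJ)
      (by rw [Finset.card_erase_of_mem hi, hc]; omega)).2
  -- Taking the coefficient at `μ` commutes with `altD`, so each exponent gives its own cocycle over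
  -- `k`. For `μ ∉ G` this cocycle vanishes in the relevant size.
  have hb : ∀ μ, ∃ b : Finset ι → k, (∀ I ⊆ Λ, I.card = j → b I ≠ 0 → μ ∈ D I) ∧
      ∀ J ⊆ Λ, J.card = j + 1 → altD b J = (fBasis k n d).repr (f J) μ := by
    intro μ
    by_cases hμ : μ ∈ G
    · refine hsolve μ hμ _ (fun J hJ hc h => (mem_fSpan.1 (hf J hJ hc).1 μ h).1)
        fun J hJ hc => ?_
      have h1 := map_altD ((Finsupp.applyAddHom μ).comp
        (fBasis k n d).repr.toAddEquiv.toAddMonoidHom) f J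
      rw [hfd J hJ hc, map_zero] at h1
      exact h1.symm
    · refine ⟨0, fun I _ _ h => absurd rfl h, fun J hJ hc => ?_⟩
      rw [map_zero]
      by_contra h
      exact hμ (mem_fSpan.1 (hf J hJ hc).1 μ (Ne.symm h)).2
  choose b hb1 hb2 using hb
  -- Only finitely many exponents occur in the values `f J`, so the solutions can be summed over
  -- `S`.
  set S : Finset (FermatExp n × Fin d) :=
    Finset.univ.biUnion fun J : Finset ι => ((fBasis k n d).repr (f J)).support with hS
  set B : Finset ι → FermatLaurent k n d := fun I =>
    if I ⊆ Λ then ∑ μ ∈ S, b μ I • fBasis k n d μ else 0 with hB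
  refine ⟨fun I => algebraMap _ _ (B I), fun I hI => ?_, fun J hJ hc => ?_⟩
  · rw [hB]
    dsimp only
    split_ifs with h
    · refine hD I h _ (sum_mem fun μ _ => ?_)
      by_cases h0 : b μ I = 0
      · rw [h0, zero_smul]; exact zero_mem _
      · exact Submodule.smul_mem _ _ (fBasis_mem_fSpan (hb1 μ I h hI h0))
    · rw [map_zero]; exact zero_mem _
  · have h1 := map_altD (algebraMap (FermatLaurent k n d)
      (FractionRing (FermatLaurent k n d))).toAddMonoidHom B J
    refine h1.symm.trans ((congrArg _ ?_).trans (hf J hJ hc).2)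
    have h2 : altD B J = ∑ μ ∈ S, altD (b μ) J • fBasis k n d μ := by
      have h3 : altD B J = altD (fun I => ∑ μ ∈ S, b μ I • fBasis k n d μ) J :=
        altD_congr fun i _ => if_pos ((J.erase_subset i).trans hJ)
      rw [h3]
      simp only [altD_apply, Finset.smul_sum, Finset.sum_smul]
      rw [Finset.sum_comm]
      exact Finset.sum_congr rfl fun μ _ => Finset.sum_congr rfl fun i _ => (smul_assoc _ _ _).symm
    rw [h2]
    have h4 := (fBasis k n d).linearCombination_repr (f J)
    rw [Finsupp.linearCombination_apply, Finsupp.sum_of_support_subset (s := S)] at h4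
    · exact (Finset.sum_congr rfl fun μ _ => by rw [hb2 μ J hJ hc]).trans h4
    · exact Finset.subset_biUnion_of_mem (fun J : Finset ι => ((fBasis k n d).repr (f J)).support)
        (Finset.mem_univ J)
    · intro μ _
      exact zero_smul _ _

end Monomials

/-! ### The localizations of `R` and `T` as spans of monomials -/

section FermatRanges

variable (k : Type*) [Field k] (n d : ℕ) [NeZero d]

theorem isUnit_frac_fVar (hn : 0 < n) (i : Fin (n + 1)) :
    IsUnit (algebraMap _ (FractionRing (FermatLaurent k n d)) (fVar k n d i)) := by
  induction i using Fin.lastCases with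
  | last =>
    rw [fVar_last]
    exact IsLocalization.map_units _ (⟨_, fRoot_mem_nonZeroDivisors hn⟩ :
      nonZeroDivisors (FermatLaurent k n d))
  | cast i =>
    rw [fVar_castSucc]
    exact (isUnit_fMon k n d _).map _

theorem isUnit_fermatVar (hn : 0 < n) (i : Fin (n + 1)) :
    IsUnit (toFrac (fermatToLaurent k n d) (fermatVar k n d i)) := by
  have := isUnit_frac_fVar k n d hn i
  rwa [← fermatToLaurent_fermatVar] at this

theorem isUnit_fermatSegreVar (hn : 0 < n) (w : Fin (n + 1) ×ₗ Fin 2) :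
    IsUnit (toFrac (segreToLaurent k n d) (fermatSegreVar k n d w)) := by
  have h := (isUnit_frac_fVar k n d hn (ofLex w).1).mul
    ((isUnit_fMon k n d (0, Pi.single (ofLex w).2 1)).map (algebraMap _ _))
  rw [← map_mul] at h
  have h2 := segreToLaurent_var k n d w
  unfold fUV at h2
  rw [← h2] at h
  exact h

/-- Indices of the variables `x_0, …, x_{n-1}`. -/
def fermatIdx : Finset (Fin (n + 1)) := Finset.univ.filter (· ≠ Fin.last n)

/-- Indices of the variables `x_i u, x_i v` with `i < n`. -/
def segreIdx : Finset (Fin (n + 1) ×ₗ Fin 2) :=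
  Finset.univ.filter fun w => (ofLex w).1 ≠ Fin.last n

/-- Exponents occurring in the localization of the Fermat ring at `∏ i ∈ J, x_i`. -/
def fermatExps (J : Finset (Fin (n + 1))) : Set (FermatExp n × Fin d) :=
  {μ | (∀ i : Fin n, i.castSucc ∉ J → 0 ≤ μ.1.1 i) ∧ μ.1.2 = 0}

/-- Exponents occurring in the localization of the Segre product at `∏ w ∈ J, z_w`. -/
def segreExps (J : Finset (Fin (n + 1) ×ₗ Fin 2)) : Set (FermatExp n × Fin d) :=
  {μ | (∀ i : Fin n, (∀ c, toLex (i.castSucc, c) ∉ J) → 0 ≤ μ.1.1 i) ∧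
    (∀ c, (∀ i : Fin n, toLex (i.castSucc, c) ∉ J) → 0 ≤ μ.1.2 c) ∧
    (μ.2 : ℤ) + ∑ i, μ.1.1 i = ∑ c, μ.1.2 c}

theorem exists_forall_nonneg_mul_add {σ : Type*} [Fintype σ] (a : σ → ℤ) :
    ∃ m : ℕ, ∀ i, ∀ N : ℤ, 1 ≤ N → 0 ≤ m * N + a i := by
  refine ⟨(∑ i, |a i|).toNat, fun i N hN => ?_⟩
  have h0 : 0 ≤ ∑ i, |a i| := Finset.sum_nonneg fun i _ => abs_nonneg _
  have h1 : |a i| ≤ ∑ i, |a i| :=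
    Finset.single_le_sum (f := fun i => |a i|) (fun i _ => abs_nonneg _) (Finset.mem_univ i)
  have h2 := neg_abs_le (a i)
  rw [Int.toNat_of_nonneg h0]
  nlinarith

theorem mem_cechRange_fermat (hn : 0 < n) {J : Finset (Fin (n + 1))} (hJ : J ⊆ fermatIdx n)
    {y : FractionRing (FermatLaurent k n d)} :
    y ∈ cechRange (toFrac (fermatToLaurent k n d)) (fermatVar k n d) (isUnit_fermatVar k n d hn) J ↔
      ∃ f ∈ fSpan k n d (fermatExps n d J), algebraMap _ _ f = y := by
  rw [mem_cechRange_iff_fSpan (fermatToLaurent k n d) (fermatVar k n d) (isUnit_fermatVar k n d hn)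
    (fun f => mem_range_fermatToLaurent k n d)
    (v := fun j => ((fun i => if i.castSucc = j then 1 else 0), 0))]
  · have hs : ∑ j ∈ J, ((fun i => if Fin.castSucc i = j then 1 else 0), 0) =
        ((fun i => if Fin.castSucc i ∈ J then 1 else 0, 0) : FermatExp n) := by
      refine Prod.ext (funext fun i => ?_) (funext fun i => ?_)
      · simp [Prod.fst_sum, Finset.sum_apply]
      · simp [Prod.snd_sum]
    rw [hs]
    have : {μ : FermatExp n × Fin d | ∃ m : ℕ, (m • ((fun i => if Fin.castSucc i ∈ J then 1 else 0, 0) :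
        FermatExp n) + μ.1, μ.2) ∈ {μ : FermatExp n × Fin d | (∀ i, 0 ≤ μ.1.1 i) ∧ μ.1.2 = 0}} =
        fermatExps n d J := by
      ext ⟨⟨a, b⟩, e⟩
      constructor
      · rintro ⟨m, h1, h2⟩
        refine ⟨fun i hi => ?_, by simpa using h2⟩
        simpa [hi] using h1 i
      · rintro ⟨h1, h2⟩
        obtain ⟨m, hm⟩ := exists_forall_nonneg_mul_add a
        refine ⟨m, fun i => ?_, by simpa using h2⟩
        by_cases hi : i.castSucc ∈ J
        · simpa [hi] using hm i 1 le_rfl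
        · simpa [hi] using h1 i hi
    rw [this]
  · intro j hj
    have hj' : j ≠ Fin.last n := (Finset.mem_filter.1 (hJ hj)).2
    obtain ⟨i, rfl⟩ := Fin.exists_castSucc_eq.2 hj'
    rw [fermatToLaurent_fermatVar, fVar_castSucc]
    congr 2
    funext l
    simp [Pi.single_apply]

theorem mem_cechRange_segre (hn : 0 < n) {J : Finset (Fin (n + 1) ×ₗ Fin 2)} (hJ : J ⊆ segreIdx n)
    {y : FractionRing (FermatLaurent k n d)} :
    y ∈ cechRange (toFrac (segreToLaurent k n d)) (fermatSegreVar k n d)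
        (isUnit_fermatSegreVar k n d hn) J ↔
      ∃ f ∈ fSpan k n d (segreExps n d J), algebraMap _ _ f = y := by
  rw [mem_cechRange_iff_fSpan (segreToLaurent k n d) (fermatSegreVar k n d)
    (isUnit_fermatSegreVar k n d hn) (fun f => mem_range_segreToLaurent k n d)
    (v := fun w => ((fun i => if i.castSucc = (ofLex w).1 then 1 else 0),
      (fun c => if c = (ofLex w).2 then 1 else 0)))]
  · set V : FermatExp n := ∑ w ∈ J, ((fun i => if Fin.castSucc i = (ofLex w).1 then 1 else 0),
      (fun c => if c = (ofLex w).2 then 1 else 0)) with hV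
    have hV1 : ∀ i, V.1 i = (J.filter fun w => i.castSucc = (ofLex w).1).card := fun i => by
      simp [hV, Prod.fst_sum, Finset.sum_apply]
    have hV2 : ∀ c, V.2 c = (J.filter fun w => c = (ofLex w).2).card := fun c => by
      simp [hV, Prod.snd_sum, Finset.sum_apply]
    -- Each generator `x_i u` or `x_i v` has the same degree in both groups of variables, so
    -- multiplying by it preserves the Segre condition.
    have hVd : ∑ i, V.1 i = ∑ c, V.2 c := by
      simp only [hV, Prod.fst_sum, Prod.snd_sum, Finset.sum_apply]
      rw [Finset.sum_comm, Finset.sum_comm (t := J)]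
      refine Finset.sum_congr rfl fun w hw => ?_
      obtain ⟨i, hi⟩ := Fin.exists_castSucc_eq.2 (Finset.mem_filter.1 (hJ hw)).2
      simp [← hi]
    have : {μ : FermatExp n × Fin d | ∃ m : ℕ, (m • V + μ.1, μ.2) ∈ {μ : FermatExp n × Fin d |
        (∀ i, 0 ≤ μ.1.1 i) ∧ (∀ c, 0 ≤ μ.1.2 c) ∧
          (μ.2 : ℤ) + ∑ i, μ.1.1 i = ∑ c, μ.1.2 c}} = segreExps n d J := by
      ext ⟨⟨a, b⟩, e⟩
      constructor
      · rintro ⟨m, h1, h2, h3⟩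
        refine ⟨fun i hi => ?_, fun c hc => ?_, ?_⟩
        · have h4 : V.1 i = 0 := by
            rw [hV1, Finset.filter_false_of_mem]
            · simp
            · intro w hw h
              exact hi (ofLex w).2 (by rw [h]; exact hw)
          simpa [h4] using h1 i
        · have h4 : V.2 c = 0 := by
            rw [hV2, Finset.filter_false_of_mem]
            · simp
            · intro w hw h
              obtain ⟨i, hi⟩ := Fin.exists_castSucc_eq.2 (Finset.mem_filter.1 (hJ hw)).2
              exact hc i (by rw [h, hi]; exact hw)
          simpa [h4] using h2 c
        · simp only [Prod.fst_add, Prod.snd_add, Prod.smul_fst, Prod.smul_snd, Pi.add_apply,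
            Pi.smul_apply, Finset.sum_add_distrib, ← Finset.smul_sum, hVd] at h3
          dsimp only
          linarith
      · rintro ⟨h1, h2, h3⟩
        obtain ⟨m, hm⟩ := exists_forall_nonneg_mul_add (Sum.elim a b)
        refine ⟨m, fun i => ?_, fun c => ?_, ?_⟩
        · by_cases hi : ∀ c, toLex (i.castSucc, c) ∉ J
          · have := h1 i hi
            have h5 : 0 ≤ V.1 i := by rw [hV1]; positivity
            simp only [Prod.fst_add, Prod.smul_fst, Pi.add_apply, Pi.smul_apply]
            positivity
          · push Not at hi
            obtain ⟨c, hc⟩ := hi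
            have := hm (Sum.inl i) (V.1 i) (by
              rw [hV1]
              have h6 : 0 < (J.filter fun w => i.castSucc = (ofLex w).1).card :=
                Finset.card_pos.2 ⟨toLex (i.castSucc, c), Finset.mem_filter.2 ⟨hc, by rfl⟩⟩
              exact_mod_cast h6)
            simpa using this
        · by_cases hi : ∀ i : Fin n, toLex (i.castSucc, c) ∉ J
          · have := h2 c hi
            have h5 : 0 ≤ V.2 c := by rw [hV2]; positivity
            simp only [Prod.snd_add, Prod.smul_snd, Pi.add_apply, Pi.smul_apply]
            positivity
          · push Not at hi
            obtain ⟨i, hc⟩ := hi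
            have := hm (Sum.inr c) (V.2 c) (by
              rw [hV2]
              have h6 : 0 < (J.filter fun w => c = (ofLex w).2).card :=
                Finset.card_pos.2 ⟨toLex (i.castSucc, c), Finset.mem_filter.2 ⟨hc, by rfl⟩⟩
              exact_mod_cast h6)
            simpa using this
        · simp only [Prod.fst_add, Prod.snd_add, Prod.smul_fst, Prod.smul_snd, Pi.add_apply,
            Pi.smul_apply, Finset.sum_add_distrib, ← Finset.smul_sum, hVd]
          dsimp only at h3
          linarith
    rw [this]
  · intro w hw
    obtain ⟨i, hi⟩ := Fin.exists_castSucc_eq.2 (Finset.mem_filter.1 (hJ hw)).2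
    rw [segreToLaurent_var, ← hi, fVar_castSucc, fUV, ← fMon_add]
    congr 1
    refine Prod.ext (funext fun l => ?_) (funext fun l => ?_)
    · simp [Pi.single_apply]
    · simp [Pi.single_apply]

end FermatRanges

/-! ### Nilpotency -/

section Cone

variable {ι : Type*} [LinearOrder ι] {M : Type*} [AddCommGroup M]

/-- Acyclicity of a complex of cochains with supports that is a cone with vertex `w`. -/
theorem exists_altD_eq_of_cone (Λ : Finset ι) (P : Finset ι → Prop) {w : ι} (hw : w ∈ Λ)
    (hP : ∀ I, P (insert w I) → P I) {j : ℕ} {c : Finset ι → M}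
    (hc : ∀ J ⊆ Λ, J.card = j + 1 → c J ≠ 0 → P J)
    (hd : ∀ J ⊆ Λ, J.card = j + 2 → altD c J = 0) :
    ∃ b : Finset ι → M, (∀ I ⊆ Λ, I.card = j → b I ≠ 0 → P I) ∧
      ∀ J ⊆ Λ, J.card = j + 1 → altD b J = c J := by
  refine ⟨altH w c, fun I hI hcard h => ?_, fun J hJ hcard => ?_⟩
  · by_cases hwI : w ∈ I
    · exact absurd (altH_of_mem hwI c) h
    · rw [altH_of_notMem hwI] at h
      refine hP I (hc _ (Finset.insert_subset hw hI)
        (by rw [Finset.card_insert_of_notMem hwI, hcard]) fun h0 => h ?_)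
      rw [h0, smul_zero]
  · have h1 := altD_altH w c J
    have h2 : altH w (altD c) J = 0 := by
      by_cases hwJ : w ∈ J
      · exact altH_of_mem hwJ _
      · rw [altH_of_notMem hwJ, hd _ (Finset.insert_subset hw hJ)
          (by rw [Finset.card_insert_of_notMem hwJ, hcard]), smul_zero]
    rwa [h2, add_zero] at h1

end Cone

/-! ### Acyclicity of the Čech complex of `T` at a fixed exponent -/

section SegreSolve

variable {k : Type*} [Field k] {n d : ℕ}

theorem le_card_of_covers {J : Finset (Fin (n + 1) ×ₗ Fin 2)}
    (h : ∀ i : Fin n, ∃ c, toLex (i.castSucc, c) ∈ J) : n ≤ J.card := by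
  choose c hc using h
  have := Finset.card_le_card_of_injOn (s := (Finset.univ : Finset (Fin n)))
    (fun i => (toLex (i.castSucc, c i) : Fin (n + 1) ×ₗ Fin 2)) (fun i _ => hc i)
    (fun i _ i' _ h => by
      have := congrArg (fun w => (ofLex w).1) h
      exact Fin.castSucc_injective n this)
  simpa using this

/-- If row `i` is occupied twice, one of its elements can be erased and every row is still covered.
-/
theorem lt_card_of_covers {J : Finset (Fin (n + 1) ×ₗ Fin 2)}
    (h : ∀ i : Fin n, ∃ c, toLex (i.castSucc, c) ∈ J) {i : Fin n} {c c' : Fin 2} (hne : c ≠ c')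
    (h1 : toLex (i.castSucc, c) ∈ J) (h2 : toLex (i.castSucc, c') ∈ J) : n < J.card := by
  have h3 := le_card_of_covers (J := J.erase (toLex (i.castSucc, c))) (n := n) fun l => by
    by_cases hl : l = i
    · subst hl
      refine ⟨c', Finset.mem_erase.2 ⟨fun h => hne ?_, h2⟩⟩
      exact (congrArg (fun w => (ofLex w).2) h).symm
    · obtain ⟨c'', hc⟩ := h l
      refine ⟨c'', Finset.mem_erase.2 ⟨fun h => hl ?_, hc⟩⟩
      exact Fin.castSucc_injective n (congrArg (fun w => (ofLex w).1) h)
  rw [Finset.card_erase_of_mem h1] at h3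
  have := Finset.card_pos.2 ⟨_, h1⟩
  omega

theorem mem_segreIdx (i : Fin n) (c : Fin 2) : toLex (i.castSucc, c) ∈ segreIdx n :=
  Finset.mem_filter.2 ⟨Finset.mem_univ _, (Fin.castSucc_lt_last i).ne⟩

theorem mem_segreExps_iff {J : Finset (Fin (n + 1) ×ₗ Fin 2)} {μ : FermatExp n × Fin d} :
    μ ∈ segreExps n d J ↔ (∀ i : Fin n, μ.1.1 i < 0 → ∃ c, toLex (i.castSucc, c) ∈ J) ∧
      (∀ c, μ.1.2 c < 0 → ∃ i : Fin n, toLex (i.castSucc, c) ∈ J) ∧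
      (μ.2 : ℤ) + ∑ i, μ.1.1 i = ∑ c, μ.1.2 c := by
  unfold segreExps
  simp only [Set.mem_ofPred_eq]
  refine and_congr (forall_congr' fun i => ?_) (and_congr (forall_congr' fun c => ?_) Iff.rfl)
  · rw [← not_imp_not, not_le, not_forall]
    simp
  · rw [← not_imp_not, not_le, not_forall]
    simp

/-- Cochains of degree `n` supported on exponents negative at all `x_i` and at some of `u, v`. -/
theorem eq_zero_of_covers {μ : FermatExp n × Fin d} (hμ : ∀ i, μ.1.1 i < 0) {c₀ : Fin 2}
    (hc₀ : μ.1.2 c₀ < 0) {c : Finset (Fin (n + 1) ×ₗ Fin 2) → k}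
    (hc : ∀ J ⊆ segreIdx n, J.card = n → c J ≠ 0 → μ ∈ segreExps n d J)
    (hd : ∀ J ⊆ segreIdx n, J.card = n + 1 → altD c J = 0)
    {J : Finset (Fin (n + 1) ×ₗ Fin 2)} (hJ : J ⊆ segreIdx n) (hcard : J.card = n) : c J = 0 := by
  -- Induction on the number of elements of `J` in column `c₀`. With none, `J` fails the support
  -- condition forced by the negative exponent in that column.
  induction hN : (J.filter fun w => (ofLex w).2 = c₀).card generalizing J with
  | zero =>
    by_contra h0
    obtain ⟨i, hi⟩ := (mem_segreExps_iff.1 (hc J hJ hcard h0)).2.1 c₀ hc₀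
    have h1 := Finset.card_eq_zero.1 hN
    have h2 : toLex (i.castSucc, c₀) ∈ J.filter fun w => (ofLex w).2 = c₀ :=
      Finset.mem_filter.2 ⟨hi, rfl⟩
    rw [h1] at h2
    simp at h2
  | succ N ih =>
    by_contra h0
    have hcov : ∀ i : Fin n, ∃ c, toLex (i.castSucc, c) ∈ J := fun i =>
      (mem_segreExps_iff.1 (hc J hJ hcard h0)).1 i (hμ i)
    obtain ⟨w, hw⟩ := Finset.card_pos.1 (by omega : 0 < (J.filter fun w => (ofLex w).2 = c₀).card)
    obtain ⟨hwJ, hwc⟩ := Finset.mem_filter.1 hw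
    obtain ⟨i, hi⟩ := Fin.exists_castSucc_eq.2 (Finset.mem_filter.1 (hJ hwJ)).2
    have hw' : w = toLex (i.castSucc, c₀) := by rw [hi, ← hwc]; rfl
    obtain ⟨c₁, hc₁⟩ : ∃ c₁ : Fin 2, c₁ ≠ c₀ := ⟨c₀ + 1, by fin_cases c₀ <;> simp⟩
    set w' : Fin (n + 1) ×ₗ Fin 2 := toLex (i.castSucc, c₁) with hw'def
    have hne : w ≠ w' := fun h => hc₁ ((congrArg (fun w => (ofLex w).2) (hw' ▸ h)).symm)
    have hw'J : w' ∉ J := fun h =>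
      absurd (lt_card_of_covers hcov hc₁ h (hw' ▸ hwJ)) (by omega)
    -- The cocycle condition is applied to `J` with `w' = (i, c₁)` added beside `w = (i, c₀)`.
    -- Erasing `w'` gives back `J`; erasing `w` gives a set with fewer elements in column `c₀`;
    -- erasing anything else leaves `n` elements, two of them in row `i`, which cannot cover all
    -- rows.
    have hJ' : insert w' J ⊆ segreIdx n := Finset.insert_subset (mem_segreIdx i c₁) hJ
    have h1 := hd (insert w' J) hJ' (by rw [Finset.card_insert_of_notMem hw'J, hcard])
    rw [altD_apply, Finset.sum_insert hw'J, Finset.erase_insert hw'J,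
      Finset.sum_eq_zero, add_zero] at h1
    · have h2 := congrArg (fun y => altSign w' (insert w' J) • y) h1
      simp only [smul_smul, altSign_mul_self, one_smul, smul_zero] at h2
      exact h0 h2
    · intro l hl
      have hlw' : l ≠ w' := fun h => hw'J (h ▸ hl)
      have hsub : (insert w' J).erase l ⊆ segreIdx n := (Finset.erase_subset _ _).trans hJ'
      have hcard' : ((insert w' J).erase l).card = n := by
        rw [Finset.card_erase_of_mem (Finset.mem_insert_of_mem hl),
          Finset.card_insert_of_notMem hw'J, hcard, Nat.add_sub_cancel]
      suffices c ((insert w' J).erase l) = 0 by rw [this, smul_zero]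
      by_cases hlw : l = w
      · subst hlw
        refine ih hsub hcard' ?_
        rw [Finset.erase_insert_of_ne hlw'.symm, Finset.filter_insert, if_neg, Finset.filter_erase,
          Finset.card_erase_of_mem hw, hN, Nat.add_sub_cancel]
        exact hc₁
      · by_contra h3
        have h4 := (mem_segreExps_iff.1 (hc _ hsub hcard' h3)).1
        refine absurd (lt_card_of_covers (fun i => h4 i (hμ i)) hc₁ (i := i)
          (Finset.mem_erase.2 ⟨hlw'.symm, Finset.mem_insert_self _ _⟩)
          (Finset.mem_erase.2 ⟨fun h => hlw (h.symm.trans hw'.symm), ?_⟩)) (by omega)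
        exact Finset.mem_insert_of_mem (hw' ▸ hwJ)

/-- Supports must cover the negative rows and meet both columns. Without the condition on column `0`
the complex is a cone with vertex `(i₀, 0)`, which yields a primitive `b₀`. On sets inside column
`1` it is a cocycle for a second cone, with vertex `(i₀, 1)`, so a coboundary can be subtracted to
make it vanish there. That restores the missing condition. -/
theorem exists_altD_eq_of_two_cones {μ : FermatExp n × Fin d} {i₀ i₁ : Fin n}
    (h0 : 0 ≤ μ.1.1 i₀) (h1 : μ.1.1 i₁ < 0) (hb : ∀ c, μ.1.2 c < 0)
    (hdeg : (μ.2 : ℤ) + ∑ i, μ.1.1 i = ∑ c, μ.1.2 c)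
    {j : ℕ} {c : Finset (Fin (n + 1) ×ₗ Fin 2) → k}
    (hc : ∀ J ⊆ segreIdx n, J.card = j + 1 → c J ≠ 0 → μ ∈ segreExps n d J)
    (hd : ∀ J ⊆ segreIdx n, J.card = j + 2 → altD c J = 0) :
    ∃ b : Finset (Fin (n + 1) ×ₗ Fin 2) → k,
      (∀ I ⊆ segreIdx n, I.card = j → b I ≠ 0 → μ ∈ segreExps n d I) ∧
        ∀ J ⊆ segreIdx n, J.card = j + 1 → altD b J = c J := by
  classical
  have hi0 : ∀ (c : Fin 2) (I : Finset (Fin (n + 1) ×ₗ Fin 2)) (l : Fin n), μ.1.1 l < 0 →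
      (∃ c', toLex (l.castSucc, c') ∈ insert (toLex (i₀.castSucc, c)) I) →
      ∃ c', toLex (l.castSucc, c') ∈ I := by
    rintro c I l hl ⟨c', hc'⟩
    refine ⟨c', (Finset.mem_insert.1 hc').resolve_left fun h => ?_⟩
    have : l = i₀ := Fin.castSucc_injective n (congrArg (fun w => (ofLex w).1) h)
    rw [this] at hl
    omega
  obtain ⟨b₀, hb₀, hb₀d⟩ := exists_altD_eq_of_cone (segreIdx n)
    (fun J => (∀ i : Fin n, μ.1.1 i < 0 → ∃ c, toLex (i.castSucc, c) ∈ J) ∧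
      ∃ i : Fin n, toLex (i.castSucc, (1 : Fin 2)) ∈ J) (mem_segreIdx i₀ 0) (fun I hI => by
        refine ⟨fun l hl => hi0 0 I l hl (hI.1 l hl), ?_⟩
        obtain ⟨l, hl⟩ := hI.2
        refine ⟨l, (Finset.mem_insert.1 hl).resolve_left fun h => ?_⟩
        exact absurd (show (1 : Fin 2) = 0 from congrArg (fun w => (ofLex w).2) h) (by decide))
    (fun J hJ hcard h => ⟨(mem_segreExps_iff.1 (hc J hJ hcard h)).1,
      (mem_segreExps_iff.1 (hc J hJ hcard h)).2.1 1 (hb 1)⟩) hd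
  cases j with
  | zero =>
    -- The empty set does not meet column `1`, so `b₀` vanishes on it.
    refine ⟨b₀, fun I hI hcard h => ?_, hb₀d⟩
    obtain ⟨l, hl⟩ := (hb₀ I hI hcard h).2
    rw [Finset.card_eq_zero.1 hcard] at hl
    simp at hl
  | succ j =>
    set Λ₁ := (segreIdx n).filter fun w => (ofLex w).2 = 1 with hΛ₁
    have hsub : Λ₁ ⊆ segreIdx n := Finset.filter_subset _ _
    obtain ⟨e, he, hed⟩ := exists_altD_eq_of_cone Λ₁
      (fun J => ∀ i : Fin n, μ.1.1 i < 0 → ∃ c, toLex (i.castSucc, c) ∈ J)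
      (w := toLex (i₀.castSucc, 1)) (Finset.mem_filter.2 ⟨mem_segreIdx i₀ 1, rfl⟩)
      (fun I hI l hl => hi0 1 I l hl (hI l hl)) (c := b₀)
      (fun J hJ hcard h => (hb₀ J (hJ.trans hsub) hcard h).1) (fun J hJ hcard => by
        rw [hb₀d J (hJ.trans hsub) hcard]
        by_contra h
        obtain ⟨l, hl⟩ := (mem_segreExps_iff.1 (hc J (hJ.trans hsub) hcard h)).2.1 0 (hb 0)
        exact absurd (show (0 : Fin 2) = 1 from (Finset.mem_filter.1 (hJ hl)).2) (by decide))
    -- Extension by zero from column `1`. The support of `altD e'` still meets column `1` because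
    -- the negative row `i₁` must be covered from inside `Λ₁`.
    set e' : Finset (Fin (n + 1) ×ₗ Fin 2) → k := fun I => if I ⊆ Λ₁ then e I else 0 with he'
    refine ⟨b₀ - altD e', fun I hI hcard h => ?_, fun J hJ hcard => ?_⟩
    · have hnot : ¬ I ⊆ Λ₁ := by
        intro hsubI
        apply h
        have h2 : altD e' I = altD e I := altD_congr fun i _ =>
          if_pos ((I.erase_subset i).trans hsubI)
        rw [Pi.sub_apply, h2, hed I hsubI hcard, sub_self]
      have hz : ∃ i : Fin n, toLex (i.castSucc, (0 : Fin 2)) ∈ I := by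
        obtain ⟨w, hwI, hw⟩ := Finset.not_subset.1 hnot
        obtain ⟨i, hi⟩ := Fin.exists_castSucc_eq.2 (Finset.mem_filter.1 (hI hwI)).2
        have h2 : (ofLex w).2 = 0 := by
          have h3 : ¬ (ofLex w).2 = 1 := fun h3 => hw (Finset.mem_filter.2 ⟨hI hwI, h3⟩)
          omega
        refine ⟨i, ?_⟩
        rw [hi, ← h2]
        exact hwI
      have hcov : (∀ i : Fin n, μ.1.1 i < 0 → ∃ c, toLex (i.castSucc, c) ∈ I) ∧
          ∃ i : Fin n, toLex (i.castSucc, (1 : Fin 2)) ∈ I := by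
        by_cases hbI : b₀ I = 0
        · have h2 : altD e' I ≠ 0 := fun h2 => h (by rw [Pi.sub_apply, hbI, h2, sub_zero])
          obtain ⟨w, hwI, hw⟩ := Finset.exists_ne_zero_of_sum_ne_zero (altD_apply e' I ▸ h2)
          have h3 : e' (I.erase w) ≠ 0 := fun h3 => hw (by rw [h3, smul_zero])
          have h4 : I.erase w ⊆ Λ₁ := by
            by_contra h4
            exact h3 (if_neg h4)
          have h5 := he (I.erase w) h4 (by rw [Finset.card_erase_of_mem hwI, hcard]; rfl)
            (by rw [he'] at h3; simpa [h4] using h3)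
          refine ⟨fun i hi => (h5 i hi).imp fun c hc => Finset.mem_of_mem_erase hc, i₁, ?_⟩
          obtain ⟨c', hc'⟩ := h5 i₁ h1
          have h6 : c' = 1 := (Finset.mem_filter.1 (h4 hc')).2
          exact Finset.mem_of_mem_erase (h6 ▸ hc')
        · exact hb₀ I hI hcard hbI
      refine mem_segreExps_iff.2 ⟨hcov.1, fun c' _ => ?_, hdeg⟩
      fin_cases c'
      · exact hz
      · exact hcov.2
    · rw [map_sub, Pi.sub_apply, altD_altD, sub_zero, hb₀d J hJ hcard]

/-- If some `x`-exponent and some exponent of `u, v` are nonnegative, the complex is a cone. If only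
an `x`-exponent is, the two-cone argument applies; the degree equation then supplies a negative
`x`-exponent. If all `x`-exponents are negative, supports have at least `n` elements, so only `j + 1
= n` matters, and there `hμ` makes the cocycle zero. -/
theorem exists_altD_eq_segre {j : ℕ} (hj : j + 1 ≤ n) {μ : FermatExp n × Fin d}
    (hμ : j + 1 = n → (∀ i, μ.1.1 i < 0) → ∃ c, μ.1.2 c < 0)
    {c : Finset (Fin (n + 1) ×ₗ Fin 2) → k}
    (hc : ∀ J ⊆ segreIdx n, J.card = j + 1 → c J ≠ 0 → μ ∈ segreExps n d J)
    (hd : ∀ J ⊆ segreIdx n, J.card = j + 2 → altD c J = 0) :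
    ∃ b : Finset (Fin (n + 1) ×ₗ Fin 2) → k,
      (∀ I ⊆ segreIdx n, I.card = j → b I ≠ 0 → μ ∈ segreExps n d I) ∧
        ∀ J ⊆ segreIdx n, J.card = j + 1 → altD b J = c J := by
  by_cases hzero : ∀ J ⊆ segreIdx n, J.card = j + 1 → c J = 0
  · exact ⟨0, fun I _ _ h => absurd rfl h, fun J hJ hcard => by
      rw [hzero J hJ hcard, map_zero]; rfl⟩
  push Not at hzero
  obtain ⟨J₀, hJ₀, hcard₀, hne⟩ := hzero
  have hμ₀ := mem_segreExps_iff.1 (hc J₀ hJ₀ hcard₀ hne)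
  by_cases hN1 : ∀ i, μ.1.1 i < 0
  · exfalso
    have h1 := le_card_of_covers fun i => hμ₀.1 i (hN1 i)
    have hjn : j + 1 = n := by omega
    obtain ⟨c₀, hc₀⟩ := hμ hjn hN1
    exact hne (eq_zero_of_covers hN1 hc₀ (fun J hJ h => hc J hJ (h.trans hjn.symm))
      (fun J hJ h => hd J hJ (by omega)) hJ₀ (by omega))
  push Not at hN1
  obtain ⟨i₀, hi₀⟩ := hN1
  by_cases hN2 : ∀ c, μ.1.2 c < 0
  · obtain ⟨i₁, hi₁⟩ : ∃ i₁, μ.1.1 i₁ < 0 := by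
      by_contra! h
      have h1 : 0 ≤ ∑ i, μ.1.1 i := Finset.sum_nonneg fun i _ => h i
      have h2 := hμ₀.2.2
      rw [Fin.sum_univ_two] at h2
      have := hN2 0
      have := hN2 1
      omega
    exact exists_altD_eq_of_two_cones hi₀ hi₁ hN2 hμ₀.2.2 hc hd
  · push Not at hN2
    obtain ⟨c₀, hc₀⟩ := hN2
    refine exists_altD_eq_of_cone (segreIdx n) (fun J => μ ∈ segreExps n d J)
      (mem_segreIdx i₀ c₀) (fun I hI => ?_) hc hd
    have h1 := mem_segreExps_iff.1 hI
    refine mem_segreExps_iff.2 ⟨fun i hi => ?_, fun c' hc' => ?_, h1.2.2⟩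
    · obtain ⟨c', hc'⟩ := h1.1 i hi
      refine ⟨c', (Finset.mem_insert.1 hc').resolve_left fun h => ?_⟩
      have : i = i₀ := Fin.castSucc_injective n (congrArg (fun w => (ofLex w).1) h)
      rw [this] at hi
      omega
    · obtain ⟨i, hi⟩ := h1.2.1 c' hc'
      refine ⟨i, (Finset.mem_insert.1 hi).resolve_left fun h => ?_⟩
      have : c' = c₀ := congrArg (fun w => (ofLex w).2) h
      rw [this] at hc'
      omega

end SegreSolve

/-! ### Nilpotence in terms of Frobenius powers of cocycles -/

section NilpotencyCriteria

variable (k : Type*) [Field k] (p : ℕ) [hp : Fact p.Prime] [CharP k p]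
  {A : Type*} [CommRing A] [Algebra k A] {K : Type*} [CommRing K] (φ : A →+* K)
  {ι : Type*} [LinearOrder ι] (x : ι → A) (hu : ∀ i, IsUnit (φ (x i)))

/-- The `e`-th Frobenius power of the cocycle `z` is a coboundary. -/
def IsFrobBoundary {j : ℕ} (z : cechZ x (j + 1)) (e : ℕ) : Prop :=
  ∃ b : Finset ι → K, (∀ I, I.card = j → b I ∈ cechRange φ x hu I) ∧
    ∀ J, J.card = j + 1 → altD b J = cochainFun φ x hu z.1 J ^ p ^ e

theorem lcNilpotent_succ_iff (hφ : Function.Injective φ) (j : ℕ) :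
    LCNilpotent k p x (j + 1) ↔ ∀ z : cechZ x (j + 1), ∃ e, IsFrobBoundary p φ x hu z e := by
  constructor
  · intro h z
    obtain ⟨e, he⟩ := h (Submodule.Quotient.mk z)
    exact ⟨e, (lcFrob_iterate_eq_zero_iff k p φ x hu hφ e z).1 he⟩
  · intro h y
    obtain ⟨z, rfl⟩ := Submodule.Quotient.mk_surjective _ y
    obtain ⟨e, he⟩ := h z
    exact ⟨e, (lcFrob_iterate_eq_zero_iff k p φ x hu hφ e z).2 he⟩

theorem lcNilpotentInDegree_succ_iff (hφ : Function.Injective φ) (𝒜 : ℕ → Submodule k A) (j : ℕ)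
    (t : ℤ) : LCNilpotentInDegree k p 𝒜 x (j + 1) t ↔
      ∀ z : cechZ x (j + 1), z.1 ∈ cechDeg k 𝒜 x (j + 1) t → ∃ e, IsFrobBoundary p φ x hu z e := by
  constructor
  · intro h z hz
    obtain ⟨e, he⟩ := h _ ⟨z, hz, rfl⟩
    exact ⟨e, (lcFrob_iterate_eq_zero_iff k p φ x hu hφ e z).1 he⟩
  · rintro h _ ⟨z, hz, rfl⟩
    obtain ⟨e, he⟩ := h z hz
    exact ⟨e, (lcFrob_iterate_eq_zero_iff k p φ x hu hφ e z).2 he⟩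

include hu in
-- Here `H^0` itself vanishes: a `0`-cocycle maps to zero in each localization, and these maps are
-- injective.
theorem lcNilpotent_zero [Nonempty ι] (hφ : Function.Injective φ) : LCNilpotent k p x 0 := by
  intro h
  obtain ⟨z, rfl⟩ := Submodule.Quotient.mk_surjective _ h
  refine ⟨0, ?_⟩
  suffices hz : z = 0 by rw [hz]; rfl
  refine Subtype.ext (cochainFun_injective _ _ hu hφ fun J hJ => ?_)
  obtain ⟨w⟩ := ‹Nonempty ι›
  have h1 := altD_cochainFun_eq_zero φ _ hu z (J := {w}) (by simp)
  rw [altD_apply, Finset.sum_singleton, Finset.erase_singleton] at h1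
  have h2 := congrArg (fun y => altSign w {w} • y) h1
  simp only [smul_smul, altSign_mul_self, one_smul, smul_zero] at h2
  rw [Finset.card_eq_zero.1 hJ, h2, cochainFun_of_card _ _ _ _ (by simp)]
  exact (map_zero _).symm

end NilpotencyCriteria

/-! ### Nilpotence for `T` up to degree `n`, and for `R` in positive degrees -/

section Nilpotency

variable (k : Type*) [Field k] (n d : ℕ) [NeZero d]

theorem mem_fSpan_inter {s t : Set (FermatExp n × Fin d)} {f : FermatLaurent k n d}
    (hs : f ∈ fSpan k n d s) (ht : f ∈ fSpan k n d t) : f ∈ fSpan k n d (s ∩ t) :=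
  mem_fSpan.2 fun μ h => ⟨mem_fSpan.1 hs μ h, mem_fSpan.1 ht μ h⟩

theorem fermatVar_mem_radical (i : Fin (n + 1)) : fermatVar k n d i ∈
    (Ideal.span (fermatVar k n d '' fermatIdx n)).radical := by
  have hmem : ∀ i : Fin n, fermatVar k n d i.castSucc ∈
      Ideal.span (fermatVar k n d '' fermatIdx n) := fun i => by
    refine Ideal.subset_span ⟨_, ?_, rfl⟩
    exact Finset.mem_coe.2 (Finset.mem_filter.2 ⟨Finset.mem_univ _, (Fin.castSucc_lt_last i).ne⟩)
  induction i using Fin.lastCases with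
  | last =>
    refine ⟨d, ?_⟩
    rw [fermatVar_last_pow]
    exact sum_mem fun i _ => Ideal.pow_mem_of_mem _ (hmem i) d (NeZero.pos d)
  | cast i => exact Ideal.le_radical (hmem i)

theorem fermatSegreVar_last_pow (c : Fin 2) :
    fermatSegreVar k n d (toLex (Fin.last n, c)) ^ d =
      ∑ i : Fin n, fermatSegreVar k n d (toLex (i.castSucc, c)) ^ d := by
  apply segreToLaurent_injective k n d
  rw [map_sum, map_pow, segreToLaurent_var]
  simp only [map_pow, segreToLaurent_var, ofLex_toLex, mul_pow]
  rw [fVar_last_pow, Finset.sum_mul]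

theorem fermatSegreVar_mem_radical (w : Fin (n + 1) ×ₗ Fin 2) : fermatSegreVar k n d w ∈
    (Ideal.span (fermatSegreVar k n d '' segreIdx n)).radical := by
  have hmem : ∀ (i : Fin n) (c), fermatSegreVar k n d (toLex (i.castSucc, c)) ∈
      Ideal.span (fermatSegreVar k n d '' segreIdx n) := fun i c =>
    Ideal.subset_span ⟨_, Finset.mem_coe.2 (mem_segreIdx i c), rfl⟩
  obtain ⟨⟨i, c⟩, rfl⟩ := toLex.surjective w
  induction i using Fin.lastCases with
  | last =>
    refine ⟨d, ?_⟩
    rw [fermatSegreVar_last_pow]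
    exact sum_mem fun i _ => Ideal.pow_mem_of_mem _ (hmem i c) d (NeZero.pos d)
  | cast i => exact Ideal.le_radical (hmem i c)

variable (p : ℕ) [hp : Fact p.Prime] [CharP k p]

theorem lcNilpotent_segre_zero (hn : 0 < n) : LCNilpotent k p (fermatSegreVar k n d) 0 := by
  have : Nonempty (Fin (n + 1) ×ₗ Fin 2) := ⟨toLex (0, 0)⟩
  exact lcNilpotent_zero k p _ _ (isUnit_fermatSegreVar k n d hn)
    (toFrac_injective (segreToLaurent_injective k n d))

/-- The hypothesis `he` concerns only the top case `j + 1 = n`: after Frobenius, no exponent with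
all `x_i` negative and both `u, v` nonnegative may remain. -/
theorem isFrobBoundary_segre (hn : 0 < n) {j : ℕ} (hj : j + 1 ≤ n)
    (z : cechZ (fermatSegreVar k n d) (j + 1)) (e : ℕ)
    (he : j + 1 = n → ∀ J ⊆ segreIdx n, J.card = n → ∀ f ∈ fSpan k n d (segreExps n d J),
      f ^ p ^ e ∈ fSpan k n d {μ | (∀ i, μ.1.1 i < 0) → ∃ c, μ.1.2 c < 0}) :
    IsFrobBoundary p (toFrac (segreToLaurent k n d)) _ (isUnit_fermatSegreVar k n d hn) z e := by
  have hu := isUnit_fermatSegreVar k n d hn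
  set z' := (cocycleFrob k p (fermatSegreVar k n d) (j + 1))^[e] z with hz'
  have hzz : ∀ J, J.card = j + 1 → cochainFun (toFrac (segreToLaurent k n d)) _ hu z'.1 J =
      cochainFun (toFrac (segreToLaurent k n d)) _ hu z.1 J ^ p ^ e := fun J hJ =>
    cochainFun_cocycleFrob k p _ _ hu e z hJ
  have hd : ∀ J : Finset (Fin (n + 1) ×ₗ Fin 2), J.card = j + 2 →
      altD (cochainFun (toFrac (segreToLaurent k n d)) _ hu z'.1) J = 0 := fun J hJ =>
    altD_cochainFun_eq_zero _ _ hu z' hJ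
  obtain ⟨b, hb, hbz⟩ := exists_altD_eq (toFrac (segreToLaurent k n d)) _ hu (j := j)
    (fun J _ => cochainFun_mem _ _ hu z'.1 J) hd (segreIdx n) (fermatSegreVar_mem_radical k n d)
    (exists_altD_eq_of_monomials (segreToLaurent k n d) _ hu (segreIdx n) (segreExps n d)
      {μ | j + 1 = n → (∀ i, μ.1.1 i < 0) → ∃ c, μ.1.2 c < 0}
      (fun J hJ f hf => (mem_cechRange_segre k n d hn hJ).2 ⟨f, hf, rfl⟩)
      (fun J hJ hcard => by
        obtain ⟨f, hf, hfz⟩ := (mem_cechRange_segre k n d hn hJ).1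
          (cochainFun_mem (toFrac (segreToLaurent k n d)) _ hu z.1 J)
        obtain ⟨f', hf', hfz'⟩ := (mem_cechRange_segre k n d hn hJ).1
          (cochainFun_mem (toFrac (segreToLaurent k n d)) _ hu z'.1 J)
        have hff' : f' = f ^ p ^ e := by
          apply algebraMap_frac_injective
          rw [hfz', map_pow, hfz, hzz J hcard]
        refine ⟨f', mem_fSpan_inter k n d hf' (mem_fSpan.2 fun μ hμ hjn => ?_), hfz'⟩
        rw [hff'] at hμ
        exact mem_fSpan.1 (he hjn J hJ (hcard.trans hjn) f hf) μ hμ)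
      hd (fun μ hμ c hc hcd => exists_altD_eq_segre hj hμ hc hcd))
  exact ⟨b, hb, fun J hJ => (hbz J hJ).trans (hzz J hJ)⟩

theorem lcNilpotent_segre_of_lt (hn : 0 < n) {j : ℕ} (hj : j < n) :
    LCNilpotent k p (fermatSegreVar k n d) j := by
  cases j with
  | zero => exact lcNilpotent_segre_zero k n d p hn
  | succ j =>
    exact (lcNilpotent_succ_iff k p _ _ (isUnit_fermatSegreVar k n d hn)
      (toFrac_injective (segreToLaurent_injective k n d)) j).2 fun z =>
        ⟨0, isFrobBoundary_segre k n d p hn hj.le z 0 fun h => by omega⟩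

theorem lcNilpotent_segre_of_le (hn : 2 ≤ n) (hpd : d < p) (hp1 : (p : ℤ) ≡ -1 [ZMOD (d : ℤ)])
    {j : ℕ} (hj : j ≤ n) : LCNilpotent k p (fermatSegreVar k n d) j := by
  cases j with
  | zero => exact lcNilpotent_segre_zero k n d p (by omega)
  | succ j =>
    refine (lcNilpotent_succ_iff k p _ _ (isUnit_fermatSegreVar k n d (by omega))
      (toFrac_injective (segreToLaurent_injective k n d)) j).2 fun z =>
        ⟨1, isFrobBoundary_segre k n d p (by omega) hj z 1 fun _ J _ _ f hf => ?_⟩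
    rw [pow_one]
    refine pow_mem_fSpan p (fun μ hμ => fSpan_mono ?_ (fBasis_pow_mem p μ)) hf
    -- A bad exponent would come from one of negative degree in the `x`-variables; but nonnegative
    -- exponents of `u, v` force that degree, equal to theirs, to be nonnegative.
    rintro ν ⟨b, hb, h1, -⟩ hneg
    by_contra! hnn
    rw [h1] at hneg hnn
    have h2 := degree_neg_of_frobenius_neg p hp.out.pos hn hpd hp1 μ.1.1 μ.2 μ.2.2 b hb hneg
    have h3 : 0 ≤ ∑ c, μ.1.2 c := Finset.sum_nonneg fun c _ => by
      have hp0 : (0 : ℤ) < p := by exact_mod_cast hp.out.pos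
      exact nonneg_of_mul_nonneg_right (hnn c) hp0
    have h4 := hμ.2.2
    omega

omit hp [CharP k p] in
-- Translates the degree of a Čech fraction, defined by numerator and denominator, into the degree
-- of its Laurent monomials.
theorem mem_fSpan_of_mul_eq {J : Finset (Fin (n + 1))} (hJ : J ⊆ fermatIdx n)
    {j : ℕ} (hcard : J.card = j) {m s : ℕ} {a : FermatRing k n d} (ha : a ∈ fermatGrading k n d s)
    {f : FermatLaurent k n d}
    (h : f * fermatToLaurent k n d (∏ i ∈ J, fermatVar k n d i) ^ m = fermatToLaurent k n d a)
    {t : ℤ} (hmt : (s : ℤ) - m * j = t) :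
    f ∈ fSpan k n d {μ | (μ.2 : ℤ) + ∑ i, μ.1.1 i = t} := by
  set V : FermatExp n := (fun i => if i.castSucc ∈ J then 1 else 0, 0) with hV
  have hx : fermatToLaurent k n d (∏ i ∈ J, fermatVar k n d i) = fMon k n d V := by
    have hs : V = ∑ j ∈ J, ((fun i => if Fin.castSucc i = j then 1 else 0), 0) := by
      refine Prod.ext (funext fun i => ?_) (funext fun i => ?_)
      · simp [hV, Prod.fst_sum, Finset.sum_apply]
      · simp [hV, Prod.snd_sum]
    rw [map_prod, hs, fMon_sum]
    refine Finset.prod_congr rfl fun j hj => ?_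
    obtain ⟨i, rfl⟩ := Fin.exists_castSucc_eq.2 (Finset.mem_filter.1 (hJ hj)).2
    rw [fermatToLaurent_fermatVar, fVar_castSucc]
    congr 2
    funext l
    simp [Pi.single_apply]
  have hf : f = fMon k n d (-(m • V)) * fermatToLaurent k n d a := by
    rw [← h, hx, ← fMon_nsmul, mul_left_comm, ← fMon_add, neg_add_cancel, fMon_zero, mul_one]
  rw [hf]
  refine fSpan_mono ?_ (fMon_mul_mem_fSpan (fermatToLaurent_mem k n d ha) _)
  rintro μ ⟨-, -, h3⟩
  have hVs : ∑ i, V.1 i = j := by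
    have h4 : ∑ i : Fin (n + 1), (if i ∈ J then (1 : ℤ) else 0) = j := by simp [hcard]
    have h5 : Fin.last n ∉ J := fun h => (Finset.mem_filter.1 (hJ h)).2 rfl
    rw [Fin.sum_univ_castSucc, if_neg h5, add_zero] at h4
    exact h4
  simp only [neg_neg, Prod.fst_add, Prod.smul_fst, Pi.add_apply, Pi.smul_apply,
    Finset.sum_add_distrib, ← Finset.smul_sum, hVs] at h3
  change (μ.2 : ℤ) + ∑ i, μ.1.1 i = t
  simp at h3
  linarith

/-- Local cohomology of the Fermat ring is nilpotent in positive degrees. -/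
theorem lcNilpotentInDegree_fermat (hn : 0 < n) (hpd : d < p) {t : ℤ} (ht : 0 < t) :
    LCNilpotentInDegree k p (fermatGrading k n d) (fermatVar k n d) n t := by
  obtain ⟨j, rfl⟩ : ∃ j, n = j + 1 := ⟨n - 1, by omega⟩
  have hu := isUnit_fermatVar k (j + 1) d hn
  refine (lcNilpotentInDegree_succ_iff k p _ _ hu
    (toFrac_injective (fermatToLaurent_injective k (j + 1) d)) _ j t).2 fun z hzt => ⟨1, ?_⟩
  set z' := (cocycleFrob k p (fermatVar k (j + 1) d) (j + 1))^[1] z with hz'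
  have hzz : ∀ J, J.card = j + 1 → cochainFun (toFrac (fermatToLaurent k (j + 1) d)) _ hu z'.1 J =
      cochainFun (toFrac (fermatToLaurent k (j + 1) d)) _ hu z.1 J ^ p ^ 1 := fun J hJ =>
    cochainFun_cocycleFrob k p _ _ hu 1 z hJ
  have hd : ∀ J : Finset (Fin (j + 1 + 1)), J.card = j + 2 →
      altD (cochainFun (toFrac (fermatToLaurent k (j + 1) d)) _ hu z'.1) J = 0 := fun J hJ =>
    altD_cochainFun_eq_zero _ _ hu z' hJ
  have hmemIdx : ∀ i : Fin (j + 1), i.castSucc ∈ fermatIdx (j + 1) := fun i =>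
    Finset.mem_filter.2 ⟨Finset.mem_univ _, (Fin.castSucc_lt_last i).ne⟩
  obtain ⟨b, hb, hbz⟩ := exists_altD_eq (toFrac (fermatToLaurent k (j + 1) d)) _ hu (j := j)
    (fun J _ => cochainFun_mem _ _ hu z'.1 J) hd (fermatIdx (j + 1)) (fermatVar_mem_radical k (j + 1) d)
    (exists_altD_eq_of_monomials (fermatToLaurent k (j + 1) d) _ hu (fermatIdx (j + 1))
      (fermatExps (j + 1) d) (someNonneg (j + 1) d)
      (fun J hJ f hf => (mem_cechRange_fermat k (j + 1) d hn hJ).2 ⟨f, hf, rfl⟩)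
      (fun J hJ hcard => by
        obtain ⟨f, hf, hfz⟩ := (mem_cechRange_fermat k (j + 1) d hn hJ).1
          (cochainFun_mem (toFrac (fermatToLaurent k (j + 1) d)) _ hu z.1 J)
        obtain ⟨f', hf', hfz'⟩ := (mem_cechRange_fermat k (j + 1) d hn hJ).1
          (cochainFun_mem (toFrac (fermatToLaurent k (j + 1) d)) _ hu z'.1 J)
        have hff' : f' = f ^ p := by
          apply algebraMap_frac_injective
          rw [hfz', map_pow, hfz, hzz J hcard, pow_one]
        refine ⟨f', mem_fSpan_inter k (j + 1) d hf' ?_, hfz'⟩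
        have hdeg : f ∈ fSpan k (j + 1) d {μ | (μ.2 : ℤ) + ∑ i, μ.1.1 i = t} := by
          obtain ⟨m, s, a, ha, hmt, hza⟩ := hzt ⟨J, hcard⟩
          refine mem_fSpan_of_mul_eq k (j + 1) d hJ hcard (m := m) ha ?_ hmt
          apply algebraMap_frac_injective
          rw [map_mul, hfz, cochainFun_of_card _ _ _ _ hcard, hza]
          exact (congrArg _ (map_pow _ _ _)).trans (cechLift_mk (toFrac (fermatToLaurent k (j + 1) d))
            (fermatVar k (j + 1) d) hu J a m)
        rw [hff']
        refine pow_mem_fSpan p (fun μ hμ => fSpan_mono ?_ (fBasis_pow_mem p μ)) hdeg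
        rintro ν ⟨b, hb, h1, -⟩
        by_contra hneg
        have hneg' : ∀ i, ν.1.1 i < 0 := fun i => by
          by_contra! h
          exact hneg ⟨i, h⟩
        rw [h1] at hneg'
        have h2 := degree_nonpos_of_frobenius_neg p hn hpd μ.1.1 μ.2 b hb hneg'
        change (μ.2 : ℤ) + ∑ i, μ.1.1 i = t at hμ
        omega)
      hd (fun μ hμ c hc hcd => by
        -- A nonnegative exponent at `x_i` makes membership of `i` irrelevant to the supports, so
        -- the complex is a cone with vertex `i`.
        obtain ⟨i, hi⟩ := hμ
        refine exists_altD_eq_of_cone (fermatIdx (j + 1)) (fun J => μ ∈ fermatExps (j + 1) d J)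
          (hmemIdx i) (fun I hI => ⟨fun l hl => ?_, hI.2⟩) hc hcd
        by_cases hli : l = i
        · rw [hli]; exact hi
        · refine hI.1 l fun h => ?_
          rcases Finset.mem_insert.1 h with h | h
          · exact hli (Fin.castSucc_injective _ h)
          · exact hl h))
  exact ⟨b, hb, fun J hJ => (hbz J hJ).trans (hzz J hJ)⟩

end Nilpotency

/-! ### Criteria for non-nilpotence -/

section NonNilpotencyCriteria

variable (k : Type*) [Field k] (p : ℕ) [hp : Fact p.Prime] [CharP k p]
  {A : Type*} [CommRing A] [Algebra k A] {K : Type*} [CommRing K] (φ : A →+* K)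
  {ι : Type*} [LinearOrder ι] (x : ι → A) (hu : ∀ i, IsUnit (φ (x i)))

theorem not_lcNilpotent_succ (hφ : Function.Injective φ) {j : ℕ} {g : Finset ι → K}
    (hg : ∀ J, J.card = j + 1 → g J ∈ cechRange φ x hu J)
    (hd : ∀ J, J.card = j + 2 → altD g J = 0)
    (h : ∀ (e : ℕ) (b : Finset ι → K), (∀ I, I.card = j → b I ∈ cechRange φ x hu I) →
      ∃ J, J.card = j + 1 ∧ altD b J ≠ g J ^ p ^ e) : ¬ LCNilpotent k p x (j + 1) := by
  rw [lcNilpotent_succ_iff k p φ x hu hφ]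
  intro hnil
  obtain ⟨z, hz⟩ := exists_cocycle φ x hu hφ hg hd
  obtain ⟨e, b, hb, hbz⟩ := hnil z
  obtain ⟨J, hJ, hne⟩ := h e b hb
  exact hne (by rw [hbz J hJ, hz J hJ])

theorem not_lcNilpotentInDegree_succ (hφ : Function.Injective φ) {j : ℕ} {g : Finset ι → K}
    {𝒜 : ℕ → Submodule k A} {t : ℤ}
    (hg : ∀ J, J.card = j + 1 → ∃ (m s : ℕ) (a : A), a ∈ 𝒜 s ∧
      (s : ℤ) - (m : ℤ) * ((j + 1 : ℕ) : ℤ) = t ∧ g J * φ (∏ i ∈ J, x i) ^ m = φ a)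
    (hd : ∀ J, J.card = j + 2 → altD g J = 0)
    (h : ∀ (e : ℕ) (b : Finset ι → K), (∀ I, I.card = j → b I ∈ cechRange φ x hu I) →
      ∃ J, J.card = j + 1 ∧ altD b J ≠ g J ^ p ^ e) : ¬ LCNilpotentInDegree k p 𝒜 x (j + 1) t := by
  rw [lcNilpotentInDegree_succ_iff k p φ x hu hφ]
  intro hnil
  obtain ⟨z, hz⟩ := exists_cocycle φ x hu hφ (fun J hJ => by
    obtain ⟨m, s, a, -, -, hga⟩ := hg J hJ
    exact (mem_cechRange φ x hu).2 ⟨m, a, hga⟩) hd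
  obtain ⟨e, b, hb, hbz⟩ := hnil z fun J => by
    obtain ⟨m, s, a, ha, hst, hga⟩ := hg J.1 J.2
    refine ⟨m, s, a, ha, hst, cechLift_injective φ x hu hφ _ ?_⟩
    rw [← cochainFun_of_card φ x hu z.1 J.2, hz J.1 J.2]
    refine ((isUnit_map_prod φ x hu J.1).pow m).mul_right_cancel ?_
    rw [hga]
    exact (cechLift_mk φ x hu J.1 a m).symm
  obtain ⟨J, hJ, hne⟩ := h e b hb
  exact hne (by rw [hbz J hJ, hz J hJ])

end NonNilpotencyCriteria

/-! ### Coefficients of coboundaries -/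

section Coefficients

variable {k : Type*} [Field k] {n d : ℕ} [NeZero d] {A : Type*} [CommRing A] [Algebra k A]
  {ι : Type*} [LinearOrder ι] (φ : A →ₐ[k] FermatLaurent k n d) (x : ι → A)
  (hu : ∀ i, IsUnit (toFrac φ (x i)))

/-- The coefficients of a cochain at a fixed monomial. -/
theorem exists_coeff (Λ : Finset ι) (D : Finset ι → Set (FermatExp n × Fin d))
    (hD : ∀ I ⊆ Λ, ∀ y ∈ cechRange (toFrac φ) x hu I,
      ∃ f ∈ fSpan k n d (D I), algebraMap _ _ f = y)
    {j : ℕ} {b : Finset ι → FractionRing (FermatLaurent k n d)}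
    (hb : ∀ I, I.card = j → b I ∈ cechRange (toFrac φ) x hu I) (μ : FermatExp n × Fin d) :
    ∃ r : Finset ι → k, (∀ I ⊆ Λ, I.card = j → r I ≠ 0 → μ ∈ D I) ∧
      ∀ J ⊆ Λ, J.card = j + 1 → ∀ f : FermatLaurent k n d, altD b J = algebraMap _ _ f →
        altD r J = (fBasis k n d).repr f μ := by
  have hf : ∀ I : Finset ι, ∃ f : FermatLaurent k n d, I ⊆ Λ → I.card = j →
      f ∈ fSpan k n d (D I) ∧ algebraMap _ _ f = b I := by
    intro I
    by_cases h : I ⊆ Λ ∧ I.card = j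
    · obtain ⟨f, hf⟩ := hD I h.1 _ (hb I h.2)
      exact ⟨f, fun _ _ => hf⟩
    · exact ⟨0, fun h1 h2 => absurd ⟨h1, h2⟩ h⟩
  choose F hF using hf
  refine ⟨fun I => (fBasis k n d).repr (F I) μ,
    fun I hI hc h => mem_fSpan.1 (hF I hI hc).1 μ h, fun J hJ hc f hbf => ?_⟩
  have h1 := map_altD ((Finsupp.applyAddHom μ).comp
    (fBasis k n d).repr.toAddEquiv.toAddMonoidHom) F J
  refine h1.symm.trans ?_
  suffices h : altD F J = f by rw [h]; rfl
  apply algebraMap_frac_injective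
  rw [← hbf]
  refine (map_altD (algebraMap (FermatLaurent k n d)
    (FractionRing (FermatLaurent k n d))).toAddMonoidHom F J).trans (altD_congr fun i hi => ?_)
  exact (hF _ ((J.erase_subset i).trans hJ) (by rw [Finset.card_erase_of_mem hi, hc]; omega)).2

end Coefficients

/-! ### Explicit top cocycles of `R` -/

section FermatCochain

variable (k : Type*) [Field k] (n d : ℕ) [NeZero d]

theorem fermatIdx_eq : fermatIdx n = Finset.univ.erase (Fin.last n) := by
  ext i
  simp [fermatIdx]

/-- The cochain attached to a relation `x_0 ^ d + ⋯ + x_{n-1} ^ d = x_n ^ d`. -/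
theorem exists_cochain_of_relation {K : Type*} [CommRing K] {n d : ℕ} (X : Fin (n + 1) → K)
    (hX : X (Fin.last n) ^ d = ∑ i : Fin n, X i.castSucc ^ d) (ω : K) :
    ∃ a : Finset (Fin (n + 1)) → K, altD a Finset.univ = 0 ∧
      a (fermatIdx n) = ω * X (Fin.last n) ^ d ∧
      ∀ i, ∃ s : ℤ, a (Finset.univ.erase i) = s * (ω * X i ^ d) := by
  have hcompl : ∀ i : Fin (n + 1), (Finset.univ.erase i)ᶜ = {i} := fun i => by ext; simp
  -- The signs of the relation `x_n ^ d - ∑ x_i ^ d = 0`. An `n`-element set is recorded by its one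
  -- missing index, and the factors `altSign` cancel the signs of the differential.
  set ε : Fin (n + 1) → ℤ := fun i => if i = Fin.last n then 1 else -1 with hε
  refine ⟨fun I => ∑ i ∈ Iᶜ, ((altSign i Finset.univ * altSign (Fin.last n) Finset.univ * ε i : ℤ) : K) *
    (ω * X i ^ d), ?_, ?_,
    fun i => ⟨altSign i Finset.univ * altSign (Fin.last n) Finset.univ * ε i, ?_⟩⟩
  · rw [altD_apply]
    have hterm : ∀ i : Fin (n + 1), altSign i Finset.univ • (∑ i ∈ (Finset.univ.erase i)ᶜ,
        ((altSign i Finset.univ * altSign (Fin.last n) Finset.univ * ε i : ℤ) : K) *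
          (ω * X i ^ d)) =
        ((altSign (Fin.last n) Finset.univ : ℤ) : K) * ω * ((ε i : K) * X i ^ d) := by
      intro i
      rw [hcompl i, Finset.sum_singleton, zsmul_eq_mul]
      have := congrArg (fun z : ℤ => (z : K)) (altSign_mul_self i Finset.univ)
      push_cast at this ⊢
      linear_combination ((altSign (Fin.last n) Finset.univ : ℤ) : K) * ω * (ε i : K) * X i ^ d * this
    rw [Finset.sum_congr rfl fun i _ => hterm i, ← Finset.mul_sum, Fin.sum_univ_castSucc, hX]
    simp [hε, (Fin.castSucc_lt_last _).ne]
  · beta_reduce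
    rw [fermatIdx_eq, hcompl, Finset.sum_singleton, altSign_mul_self]
    simp [hε]
  · beta_reduce
    rw [hcompl, Finset.sum_singleton]

/-- The fraction `x_n ^ e / (x_0 ⋯ x_{n-1})` has to be extended from one `n`-element set to a
cocycle for all `n + 1` variables. The Fermat relation does this, with denominators `d`-th powers
and, up to sign, the common numerator `(x_0 ⋯ x_{n-1}) ^ (d - 1) x_n ^ e`. -/
theorem exists_fermat_cochain (hn : 0 < n) (e : ℕ) :
    ∃ a : Finset (Fin (n + 1)) → FractionRing (FermatLaurent k n d),
      altD a Finset.univ = 0 ∧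
      a (fermatIdx n) = algebraMap _ _ (fMon k n d (fun _ => -1, 0) * fRoot k n d ^ e) ∧
      ∀ i, ∃ s : ℤ, a (Finset.univ.erase i) *
          (∏ l ∈ Finset.univ.erase i, algebraMap _ _ (fVar k n d l)) ^ d =
        s * algebraMap _ _ (fermatToLaurent k n d (fermatMon k n d (fun _ => d - 1) e)) := by
  set X : Fin (n + 1) → FractionRing (FermatLaurent k n d) :=
    fun i => algebraMap _ _ (fVar k n d i) with hX
  have hXu : ∀ i, IsUnit (X i) := isUnit_frac_fVar k n d hn
  have hP : algebraMap _ (FractionRing (FermatLaurent k n d))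
      (fermatToLaurent k n d (fermatMon k n d (fun _ => d - 1) e)) =
      (∏ i : Fin n, X i.castSucc ^ (d - 1)) * X (Fin.last n) ^ e := by
    simp only [fermatMon, map_mul, map_prod, map_pow, fermatToLaurent_fermatVar, hX]
  set P := algebraMap _ (FractionRing (FermatLaurent k n d))
      (fermatToLaurent k n d (fermatMon k n d (fun _ => d - 1) e)) with hPdef
  obtain ⟨w, hw⟩ : IsUnit ((∏ i, X i) ^ d) := (IsUnit.prod_iff.2 fun i _ => hXu i).pow d
  -- With `ω = P / (x_0 ⋯ x_n) ^ d`, the factor `X i ^ d` removes exactly the missing variable from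
  -- the denominator.
  set ω : FractionRing (FermatLaurent k n d) := P * ↑w⁻¹ with hω
  have hωP : ω * (∏ i, X i) ^ d = P := by rw [hω, ← hw, Units.inv_mul_cancel_right]
  have hi : ∀ i, ω * X i ^ d * (∏ l ∈ Finset.univ.erase i, X l) ^ d = P := fun i => by
    rw [mul_assoc, ← mul_pow, Finset.mul_prod_erase _ _ (Finset.mem_univ i), hωP]
  obtain ⟨a, ha1, ha2, ha3⟩ := exists_cochain_of_relation (d := d) X
    (by simp only [hX, ← map_pow, ← map_sum, fVar_last_pow]) ω
  refine ⟨a, ha1, ha2.trans ?_, fun i => ?_⟩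
  · have hQ : IsUnit ((∏ i : Fin n, X i.castSucc) ^ d) :=
      (IsUnit.prod_iff.2 fun i _ => hXu _).pow d
    refine hQ.mul_right_cancel ?_
    have h1 := hi (Fin.last n)
    have h2 : ∏ l ∈ Finset.univ.erase (Fin.last n), X l = ∏ i : Fin n, X i.castSucc := by
      refine (hXu (Fin.last n)).mul_left_cancel ?_
      rw [Finset.mul_prod_erase _ _ (Finset.mem_univ _), Fin.prod_univ_castSucc, mul_comm]
    rw [h2] at h1
    have h3 : algebraMap _ (FractionRing (FermatLaurent k n d)) (fMon k n d (fun _ => -1, 0)) *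
        ∏ i : Fin n, X i.castSucc = 1 := by
      simp only [hX, fVar_castSucc]
      rw [← map_prod, ← fMon_sum, ← map_mul, ← fMon_add]
      refine (congrArg _ ?_).trans ((congrArg _ (fMon_zero k n d)).trans (map_one _))
      congr 1
      refine Prod.ext (funext fun i => ?_) (funext fun i => ?_)
      · simp [Prod.fst_sum, Finset.sum_apply, Pi.single_apply]
      · simp [Prod.snd_sum]
    rw [h1, hP, Finset.prod_pow, map_mul, map_pow, ← fVar_last]
    have h4 : ∀ y : FractionRing (FermatLaurent k n d), y ^ d = y * y ^ (d - 1) := fun y =>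
      (mul_pow_sub_one (NeZero.ne d) y).symm
    rw [h4 (∏ i : Fin n, X i.castSucc), mul_right_comm, ← mul_assoc _ (∏ i : Fin n, X i.castSucc), h3,
      one_mul]
  · obtain ⟨s, hs⟩ := ha3 i
    exact ⟨s, by rw [hs, mul_assoc, hi i]⟩

end FermatCochain

/-! ### Non-nilpotence of `H^n(R)` in degree `0` -/

section FermatNonNilpotent

variable (k : Type*) [Field k] (n d : ℕ) [NeZero d]

theorem fBasis_socleExp (hnd : n < d) : fBasis k n d (socleExp n d hnd) =
    fMon k n d (fun _ => -1, 0) * fRoot k n d ^ n := fBasis_apply k n d _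

theorem eq_univ_erase_of_card {n : ℕ} {J : Finset (Fin (n + 1))} (hJ : J.card = n) :
    ∃ i, J = Finset.univ.erase i := by
  obtain ⟨i, hi⟩ := Finset.card_eq_one.1
    (show Jᶜ.card = 1 by rw [Finset.card_compl, hJ, Fintype.card_fin]; omega)
  refine ⟨i, ?_⟩
  rw [← compl_compl J, hi]
  ext l
  simp

theorem card_fermatIdx : (fermatIdx n).card = n := by
  rw [fermatIdx_eq, Finset.card_erase_of_mem (Finset.mem_univ _), Finset.card_univ,
    Fintype.card_fin, Nat.add_sub_cancel]

omit [NeZero d] in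
theorem fermatMon_sub_one_mem (e : ℕ) :
    fermatMon k n d (fun _ => d - 1) e ∈ fermatGrading k n d (n * (d - 1) + e) := by
  have := fermatMon_mem k n d (fun _ => d - 1) e
  simpa using this

variable (p : ℕ) [hp : Fact p.Prime] [CharP k p]

/-- The socle coefficient survives every Frobenius power, whereas a coboundary has none: erasing `i`
forbids a negative exponent at `x_i`. -/
theorem not_lcNilpotentInDegree_fermat (hn : 0 < n) (hnd : n < d)
    (hp1 : (p : ℤ) ≡ 1 [ZMOD (d : ℤ)]) :
    ¬ LCNilpotentInDegree k p (fermatGrading k n d) (fermatVar k n d) n 0 := by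
  obtain ⟨a, had, ha0, ha⟩ := exists_fermat_cochain k n d hn n
  have hu := isUnit_fermatVar k n d hn
  have hinj := toFrac_injective (fermatToLaurent_injective k n d)
  rw [← fBasis_socleExp k n d hnd] at ha0
  obtain ⟨j, hj⟩ : ∃ j, n = j + 1 := ⟨n - 1, by omega⟩
  have h : ¬ LCNilpotentInDegree k p (fermatGrading k n d) (fermatVar k n d) (j + 1) 0 := by
    refine not_lcNilpotentInDegree_succ k p _ _ hu hinj (g := a) (fun J hJ => ?_) (fun J hJ => ?_)
      (fun e b hb => ⟨fermatIdx n, by rw [card_fermatIdx, hj], fun hbe => ?_⟩)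
    · obtain ⟨i, rfl⟩ := eq_univ_erase_of_card (hJ.trans hj.symm)
      obtain ⟨s, hs⟩ := ha i
      -- The numerator has degree `n (d - 1) + n = n d`, the same as the `d`-th power of a product
      -- of `n` variables.
      refine ⟨d, n * (d - 1) + n, s * fermatMon k n d (fun _ => d - 1) n,
        ?_, ?_, ?_⟩
      · rw [← zsmul_eq_mul]
        exact zsmul_mem (fermatMon_sub_one_mem k n d n) s
      · rw [← hj]
        have := Nat.sub_add_cancel (NeZero.one_le (n := d))
        push_cast [NeZero.one_le (n := d)]
        ring
      · rw [map_mul, map_intCast]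
        refine Eq.trans ?_ hs
        rw [map_prod]
        congr 2
        exact Finset.prod_congr rfl fun l _ =>
          congrArg (algebraMap _ (FractionRing (FermatLaurent k n d))) (fermatToLaurent_fermatVar k n d l)
    · have : J = Finset.univ := Finset.eq_univ_of_card J (by rw [hJ, Fintype.card_fin, hj])
      rw [this, had]
    · obtain ⟨r, hr, hrd⟩ := exists_coeff (fermatToLaurent k n d) (fermatVar k n d) hu (fermatIdx n)
        (fermatExps n d) (fun I hI y hy => (mem_cechRange_fermat k n d hn hI).1 hy) hb
        (socleExp n d hnd)
      have h1 := hrd (fermatIdx n) subset_rfl (by rw [card_fermatIdx, hj])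
        (fBasis k n d (socleExp n d hnd) ^ p ^ e) (by rw [hbe, ha0, map_pow])
      refine repr_pow_pow_ne_zero p hnd hp1 (fBasis_mem_fSpan (Set.mem_insert _ _))
        (by simp) e (h1.symm.trans ?_)
      rw [altD_apply]
      refine Finset.sum_eq_zero fun i hi => ?_
      suffices h0 : r ((fermatIdx n).erase i) = 0 by rw [h0, smul_zero]
      by_contra h0
      have h2 := hr _ (Finset.erase_subset _ _)
        (by rw [Finset.card_erase_of_mem hi, card_fermatIdx]; omega) h0
      obtain ⟨l, rfl⟩ := Fin.exists_castSucc_eq.2 (Finset.mem_filter.1 hi).2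
      have h3 := h2.1 l (Finset.notMem_erase _ _)
      simp [socleExp] at h3
  rwa [← hj] at h

end FermatNonNilpotent

/-! ### Pulling back alternating cochains along a projection -/

section Pullback

variable {α : Type*} [LinearOrder α] {M : Type*} [AddCommGroup M]

/-- The pullback of an alternating cochain along the projection `α ×ₗ Fin 2 → α`. -/
def pullFst (a : Finset α → M) (J : Finset (α ×ₗ Fin 2)) : M :=
  if (J.image fun w => (ofLex w).1).card = J.card then a (J.image fun w => (ofLex w).1) else 0

/-- On sets that project injectively, the lexicographic order preserves positions and hence signs.
On the others both sides vanish: the two terms that remove one element of a colliding pair cancel,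
and every other term still contains the collision. -/
theorem altD_pullFst (a : Finset α → M) (J : Finset (α ×ₗ Fin 2)) :
    altD (pullFst a) J = pullFst (altD a) J := by
  by_cases hJ : (J.image fun w => (ofLex w).1).card = J.card
  · have hinj : Set.InjOn (fun w : α ×ₗ Fin 2 => (ofLex w).1) J := Finset.card_image_iff.1 hJ
    rw [pullFst, if_pos hJ, altD_apply, altD_apply, Finset.sum_image hinj]
    refine Finset.sum_congr rfl fun w hw => ?_
    have h1 : (J.erase w).image (fun w => (ofLex w).1) =
        (J.image fun w => (ofLex w).1).erase (ofLex w).1 := by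
      ext i
      simp only [Finset.mem_image, Finset.mem_erase]
      constructor
      · rintro ⟨w', ⟨h, h'⟩, rfl⟩
        exact ⟨fun he => h (hinj h' hw he), w', h', rfl⟩
      · rintro ⟨h, w', h', rfl⟩
        exact ⟨w', ⟨fun he => h (he ▸ rfl), h'⟩, rfl⟩
    rw [pullFst, h1, if_pos]
    · congr 1
      unfold altSign
      congr 1
      rw [Finset.filter_image, Finset.card_image_of_injOn]
      · congr 1
        refine Finset.filter_congr fun w' hw' => ?_
        rw [Prod.Lex.lt_iff]
        refine ⟨fun h => h.resolve_right fun h => ?_, Or.inl⟩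
        have := hinj hw' hw h.1
        rw [this] at h
        exact lt_irrefl _ h.2
      · exact hinj.mono (Finset.coe_subset.2 (Finset.filter_subset _ _))
    · rw [Finset.card_erase_of_mem (Finset.mem_image_of_mem _ hw), Finset.card_erase_of_mem hw, hJ]
  · rw [pullFst, if_neg hJ]
    obtain ⟨w, hw, w', hw', hne, heq⟩ : ∃ w ∈ J, ∃ w' ∈ J, w ≠ w' ∧ (ofLex w).1 = (ofLex w').1 := by
      by_contra! h
      exact hJ (Finset.card_image_iff.2 fun w hw w' hw' he => by
        by_contra hne
        exact h w hw w' hw' hne he)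
    wlog hlt : w < w' generalizing w w'
    · exact this w' hw' w hw hne.symm heq.symm (lt_of_le_of_ne (not_lt.1 hlt) hne.symm)
    have himg : ∀ t ∈ J, ∀ u ∈ J, t ≠ u → (ofLex t).1 = (ofLex u).1 →
        (J.erase t).image (fun w => (ofLex w).1) = J.image fun w => (ofLex w).1 := by
      intro t ht u hu htu he
      refine Finset.Subset.antisymm (Finset.image_subset_image (Finset.erase_subset _ _)) ?_
      intro i hi
      obtain ⟨v, hv, rfl⟩ := Finset.mem_image.1 hi
      by_cases h : v = t
      · exact Finset.mem_image.2 ⟨u, Finset.mem_erase.2 ⟨htu.symm, hu⟩, by rw [h]; exact he.symm⟩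
      · exact Finset.mem_image_of_mem _ (Finset.mem_erase.2 ⟨h, hv⟩)
    have hlt2 : (ofLex w).2 < (ofLex w').2 := by
      rcases Prod.Lex.lt_iff.1 hlt with h | h
      · exact absurd heq h.ne
      · exact h.2
    -- The colliding elements are neighbours in `J`: the order is lexicographic and `Fin 2` leaves
    -- no room between them.
    have hsign : altSign w' J = -altSign w J := by
      have : J.filter (· < w') = insert w (J.filter (· < w)) := by
        ext t
        simp only [Finset.mem_filter, Finset.mem_insert]
        constructor
        · rintro ⟨ht, h⟩
          rcases lt_trichotomy t w with h1 | h1 | h1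
          · exact Or.inr ⟨ht, h1⟩
          · exact Or.inl h1
          · exfalso
            have h2 : (ofLex w).1 ≤ (ofLex t).1 := (Prod.Lex.lt_iff.1 h1).elim le_of_lt fun h => h.1.le
            have h3 : (ofLex t).1 ≤ (ofLex w').1 := (Prod.Lex.lt_iff.1 h).elim le_of_lt fun h => h.1.le
            have h4 := (Prod.Lex.lt_iff.1 h1).resolve_left fun h => by rw [heq] at h; exact absurd h3 (not_le.2 h)
            have h5 := (Prod.Lex.lt_iff.1 h).resolve_left fun h => by rw [← heq] at h; exact absurd h2 (not_le.2 h)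
            have h6 := h4.2
            have h7 := h5.2
            change (ofLex w).2 < (ofLex t).2 at h6
            change (ofLex t).2 < (ofLex w').2 at h7
            omega
        · rintro (rfl | ⟨ht, h⟩)
          · exact ⟨hw, hlt⟩
          · exact ⟨ht, h.trans hlt⟩
      unfold altSign
      rw [this, Finset.card_insert_of_notMem (by simp), pow_succ]
      ring
    rw [altD_apply, ← Finset.add_sum_erase _ _ hw,
      ← Finset.add_sum_erase _ _ (Finset.mem_erase.2 ⟨hne.symm, hw'⟩), Finset.sum_eq_zero, hsign]
    · have : pullFst a (J.erase w') = pullFst a (J.erase w) := by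
        unfold pullFst
        rw [himg w hw w' hw' hne heq, himg w' hw' w hw hne.symm heq.symm,
          Finset.card_erase_of_mem hw, Finset.card_erase_of_mem hw']
      rw [this, add_zero, neg_smul, add_neg_cancel]
    · intro t ht
      simp only [Finset.mem_erase] at ht
      rw [pullFst, if_neg, smul_zero]
      intro h
      exact hne (Finset.card_image_iff.1 h (Finset.mem_erase.2 ⟨ht.2.1.symm, hw⟩)
        (Finset.mem_erase.2 ⟨ht.1.symm, hw'⟩) heq)

end Pullback

/-! ### Non-nilpotence of `H^n(T)` for `p ≡ 1` -/

section SegreNonNilpotent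

variable (k : Type*) [Field k] (n d : ℕ) [NeZero d]

omit [NeZero d] in
theorem exists_toFrac_segre_eq {t : ℕ} {r : FermatRing k n d} (hr : r ∈ fermatGrading k n d t)
    {s : MvPolynomial (Fin 2) k} (hs : s ∈ MvPolynomial.homogeneousSubmodule (Fin 2) k t) :
    ∃ y : FermatSegre k n d, toFrac (segreToLaurent k n d) y =
      algebraMap _ _ (fermatToLaurent k n d r) * algebraMap _ _ (uvToLaurent k n d s) :=
  ⟨⟨r ⊗ₜ s, tmul_mem_segre _ _ hr hs⟩,
    (congrArg (algebraMap _ (FractionRing (FermatLaurent k n d)))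
      (segreToLaurent_mk k n d r s _)).trans (map_mul _ _ _)⟩

omit [NeZero d] in
theorem toFrac_fermatSegreVar (w : Fin (n + 1) ×ₗ Fin 2) :
    toFrac (segreToLaurent k n d) (fermatSegreVar k n d w) =
      algebraMap _ _ (fVar k n d (ofLex w).1) * algebraMap _ _ (fUV k n d (ofLex w).2) :=
  (congrArg (algebraMap _ (FractionRing (FermatLaurent k n d))) (segreToLaurent_var k n d w)).trans (map_mul _ _ _)

variable {n}

theorem image_eq_univ_erase_of_card {J : Finset (Fin (n + 1) ×ₗ Fin 2)} (hJ : J.card = n)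
    (h : (J.image fun w => (ofLex w).1).card = J.card) :
    (∃ i, J.image (fun w => (ofLex w).1) = Finset.univ.erase i) ∧
      ∀ {M : Type _} [CommMonoid M] (f : Fin (n + 1) → M),
        ∏ w ∈ J, f (ofLex w).1 = ∏ i ∈ J.image (fun w => (ofLex w).1), f i :=
  ⟨eq_univ_erase_of_card (h.trans hJ), fun f => (Finset.prod_image (Finset.card_image_iff.1 h)).symm⟩

theorem altD_pullFst_eq_zero {M : Type*} [AddCommGroup M] {a : Finset (Fin (n + 1)) → M}
    (ha : altD a Finset.univ = 0) {J : Finset (Fin (n + 1) ×ₗ Fin 2)} (hJ : J.card = n + 1) :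
    altD (pullFst a) J = 0 := by
  rw [altD_pullFst, pullFst]
  split_ifs with h
  · rw [Finset.eq_univ_of_card (J.image fun w => (ofLex w).1) (by rw [h, hJ, Fintype.card_fin]), ha]
  · rfl

variable (n) (p : ℕ) [hp : Fact p.Prime] [CharP k p]

/-- The socle cocycle has degree `0`, so its pullback takes values in the localizations of `T`. It
is tested on `J₀ = {x_0 u, …, x_{n-1} u}`, where erasing any element uncovers a row with negative
exponent. -/
theorem not_lcNilpotent_segre_of_lt (hn : 0 < n) (hnd : n < d)
    (hp1 : (p : ℤ) ≡ 1 [ZMOD (d : ℤ)]) : ¬ LCNilpotent k p (fermatSegreVar k n d) n := by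
  obtain ⟨a, had, ha0, ha⟩ := exists_fermat_cochain k n d hn n
  have hu := isUnit_fermatSegreVar k n d hn
  have hinj := toFrac_injective (segreToLaurent_injective k n d)
  rw [← fBasis_socleExp k n d hnd] at ha0
  obtain ⟨j, hj⟩ : ∃ j, n = j + 1 := ⟨n - 1, by omega⟩
  set J₀ : Finset (Fin (n + 1) ×ₗ Fin 2) := (fermatIdx n).image fun i => toLex (i, 0) with hJ₀
  have hJ₀c : J₀.card = n := by
    rw [hJ₀, Finset.card_image_of_injective, card_fermatIdx]
    intro i i' h
    exact congrArg (fun w => (ofLex w).1) h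
  have hJ₀i : J₀.image (fun w => (ofLex w).1) = fermatIdx n := by
    rw [hJ₀, Finset.image_image]
    exact Finset.image_id
  have hJ₀s : J₀ ⊆ segreIdx n := by
    intro w hw
    obtain ⟨i, hi, rfl⟩ := Finset.mem_image.1 hw
    exact Finset.mem_filter.2 ⟨Finset.mem_univ _, (Finset.mem_filter.1 hi).2⟩
  have hJ₀a : pullFst a J₀ = algebraMap _ _ (fBasis k n d (socleExp n d hnd)) := by
    rw [pullFst, hJ₀i, hJ₀c, card_fermatIdx, if_pos rfl, ha0]
  have h : ¬ LCNilpotent k p (fermatSegreVar k n d) (j + 1) := by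
    refine not_lcNilpotent_succ k p _ _ hu hinj (g := pullFst a) (fun J hJ => ?_) (fun J hJ => ?_)
      (fun e b hb => ⟨J₀, by rw [hJ₀c, hj], fun hbe => ?_⟩)
    · rw [← hj] at hJ
      rw [pullFst]
      split_ifs with hJi
      swap; · exact zero_mem _
      obtain ⟨⟨i, hi⟩, hprod⟩ := image_eq_univ_erase_of_card hJ hJi
      obtain ⟨s, hs⟩ := ha i
      have hq : ∏ w ∈ J, (MvPolynomial.X (ofLex w).2 : MvPolynomial (Fin 2) k) ^ d ∈
          MvPolynomial.homogeneousSubmodule (Fin 2) k (n * (d - 1) + n) := by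
        have h1 := MvPolynomial.IsHomogeneous.prod J
          (fun w => (MvPolynomial.X (ofLex w).2 : MvPolynomial (Fin 2) k) ^ d) (fun _ => 1 * d)
          fun w _ => (MvPolynomial.isHomogeneous_X k _).pow d
        have h2 : ∑ _w ∈ J, 1 * d = n * (d - 1) + n := by
          rw [Finset.sum_const, hJ, one_mul, smul_eq_mul, ← Nat.mul_succ,
            Nat.succ_eq_add_one, Nat.sub_add_cancel NeZero.one_le]
        rw [h2] at h1
        exact h1
      obtain ⟨y, hy⟩ := exists_toFrac_segre_eq k n d (fermatMon_sub_one_mem k n d n) hq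
      -- The numerator is balanced by the product of the `d`-th powers of the `u, v` factors in the
      -- denominator.
      refine (mem_cechRange _ _ _).2 ⟨d, s * y, ?_⟩
      rw [map_mul, map_intCast, hy, ← mul_assoc, ← hs, map_prod, hi]
      simp only [toFrac_fermatSegreVar]
      rw [Finset.prod_mul_distrib, hprod (fun i => algebraMap _ _ (fVar k n d i)), hi, mul_pow,
        mul_assoc]
      congr 2
      rw [map_prod, map_prod, ← Finset.prod_pow]
      refine Finset.prod_congr rfl fun w _ => ?_
      rw [map_pow, map_pow]
      simp [uvToLaurent]
    · exact altD_pullFst_eq_zero had (by rw [hJ, hj])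
    · obtain ⟨r, hr, hrd⟩ := exists_coeff (segreToLaurent k n d) (fermatSegreVar k n d) hu
        (segreIdx n) (segreExps n d) (fun I hI y hy => (mem_cechRange_segre k n d hn hI).1 hy) hb
        (socleExp n d hnd)
      have h1 := hrd J₀ hJ₀s (by rw [hJ₀c, hj])
        (fBasis k n d (socleExp n d hnd) ^ p ^ e) (by rw [hbe, hJ₀a, map_pow])
      refine repr_pow_pow_ne_zero p hnd hp1 (fBasis_mem_fSpan (Set.mem_insert _ _))
        (by simp) e (h1.symm.trans ?_)
      rw [altD_apply]
      refine Finset.sum_eq_zero fun w hw => ?_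
      suffices h0 : r (J₀.erase w) = 0 by rw [h0, smul_zero]
      by_contra h0
      have h2 := hr _ ((Finset.erase_subset _ _).trans hJ₀s)
        (by rw [Finset.card_erase_of_mem hw, hJ₀c]; omega) h0
      obtain ⟨i, hi, rfl⟩ := Finset.mem_image.1 hw
      obtain ⟨l, rfl⟩ := Fin.exists_castSucc_eq.2 (Finset.mem_filter.1 hi).2
      obtain ⟨c, hc⟩ := (mem_segreExps_iff.1 h2).1 l (by simp [socleExp])
      obtain ⟨hne, hc⟩ := Finset.mem_erase.1 hc
      obtain ⟨i', -, hi'⟩ := Finset.mem_image.1 hc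
      have h3 : i' = l.castSucc := congrArg (fun w => (ofLex w).1) hi'
      rw [← hi', h3] at hne
      exact hne rfl
  rwa [← hj] at h

end SegreNonNilpotent

/-! ### Non-nilpotence of `H^{n+1}(T)` -/

section TopSegre

variable (k : Type*) [Field k] (n d : ℕ) [NeZero d]

/-- `γ` times the pullback of a cochain, extended by zero from the subsets of `{x_0 v, …, x_n v}`. -/
noncomputable def extendFst {K : Type*} [CommRing K] (γ : K) (a : Finset (Fin (n + 1)) → K)
    (I : Finset (Fin (n + 1) ×ₗ Fin 2)) : K :=
  if ∀ w ∈ I, (ofLex w).2 = 1 then γ * pullFst a I else 0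

/-- The factor `u⁻¹` is not allowed on sets inside column `v`, but becomes so once an element `w`
with second coordinate `u` is adjoined. -/
theorem mem_cechRange_extendFst (hn : 0 < n)
    {a : Finset (Fin (n + 1)) → FractionRing (FermatLaurent k n d)}
    (ha : ∀ i, ∃ s : ℤ, a (Finset.univ.erase i) *
          (∏ l ∈ Finset.univ.erase i, algebraMap _ _ (fVar k n d l)) ^ d =
        s * algebraMap _ _ (fermatToLaurent k n d (fermatMon k n d (fun _ => d - 1) 0)))
    {J : Finset (Fin (n + 1) ×ₗ Fin 2)} (hJ : J.card = n + 1) {w : Fin (n + 1) ×ₗ Fin 2}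
    (hw : w ∈ J) (hw0 : (ofLex w).2 = 0) :
    extendFst n (algebraMap _ _ (fMon k n d (0, ![-1, -(n - 1 : ℤ)]))) a (J.erase w) ∈
      cechRange (toFrac (segreToLaurent k n d)) (fermatSegreVar k n d)
        (isUnit_fermatSegreVar k n d hn) J := by
  unfold extendFst
  split_ifs with hv
  swap; · exact zero_mem _
  have hI : (J.erase w).card = n := by rw [Finset.card_erase_of_mem hw, hJ, Nat.add_sub_cancel]
  rw [pullFst]
  split_ifs with hJi
  swap; · rw [mul_zero]; exact zero_mem _
  obtain ⟨⟨i, hi⟩, hprod⟩ := image_eq_univ_erase_of_card hI hJi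
  obtain ⟨s, hs⟩ := ha i
  have hd1 : d - 1 + 1 = d := Nat.sub_add_cancel NeZero.one_le
  -- Multiplying `u⁻¹ v^{-(n-1)}` by the denominator part `u^d v^{n d}` leaves `u^{d-1} v^N`.
  obtain ⟨N, hN⟩ : ∃ N, N + (n - 1) = n * d :=
    ⟨n * d - (n - 1), Nat.sub_add_cancel ((Nat.sub_le n 1).trans
      (Nat.le_mul_of_pos_right n (NeZero.pos d)))⟩
  have hr : fermatMon k n d (fun _ => d - 1) 0 * fermatVar k n d (ofLex w).1 ^ d ∈
      fermatGrading k n d (n * (d - 1) + 0 + d) := by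
    have := SetLike.pow_mem_graded (A := fermatGrading k n d) d (fermatVar_mem k n d (ofLex w).1)
    rw [smul_eq_mul, mul_one] at this
    exact SetLike.GradedMul.mul_mem (fermatMon_sub_one_mem k n d 0) this
  have hq : uvMon k ![d - 1, N] ∈
      MvPolynomial.homogeneousSubmodule (Fin 2) k (n * (d - 1) + 0 + d) := by
    have h1 := uvMon_mem k ![d - 1, N]
    have h2 : n * (d - 1) + n = n * d := by rw [← Nat.mul_succ, Nat.succ_eq_add_one, hd1]
    have h3 : ∑ c, ![d - 1, N] c = n * (d - 1) + 0 + d := by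
      simp only [Fin.sum_univ_two, Matrix.cons_val_zero, Matrix.cons_val_one]
      omega
    rwa [h3] at h1
  obtain ⟨y, hy⟩ := exists_toFrac_segre_eq k n d hr hq
  refine (mem_cechRange _ _ _).2 ⟨d, s * y, ?_⟩
  have hU : fMon k n d (0, ![-1, -(n - 1 : ℤ)]) * (fUV k n d 0 ^ d * (fUV k n d 1 ^ n) ^ d) =
      uvToLaurent k n d (uvMon k ![d - 1, N]) := by
    rw [uvToLaurent_uvMon]
    unfold fUV
    rw [← pow_mul, ← fMon_nsmul, ← fMon_nsmul, ← fMon_add, ← fMon_add]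
    congr 1
    refine Prod.ext (funext fun i => ?_) (funext fun c => ?_)
    · simp
    · have h4 : (N : ℤ) + (n - 1) = n * d := by
        have : ((N + (n - 1) : ℕ) : ℤ) = ((n * d : ℕ) : ℤ) := congrArg _ hN
        push_cast [Nat.one_le_iff_ne_zero.2 hn.ne'] at this
        exact this
      have h5 : ((d - 1 : ℕ) : ℤ) + 1 = d := by exact_mod_cast hd1
      fin_cases c
      · simp [Matrix.vecHead]
        linarith
      · simp [Matrix.vecHead, Matrix.vecTail]
        linarith
  have hV : ∏ w' ∈ J.erase w, algebraMap _ (FractionRing (FermatLaurent k n d))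
      (fUV k n d (ofLex w').2) = algebraMap _ _ (fUV k n d 1) ^ n := by
    rw [Finset.prod_congr rfl fun w' hw' => by rw [hv w' hw'], Finset.prod_const, hI]
  rw [map_mul, map_intCast, hy, map_prod, ← Finset.mul_prod_erase _ _ hw]
  simp only [toFrac_fermatSegreVar]
  rw [Finset.prod_mul_distrib, hprod (fun i => algebraMap _ _ (fVar k n d i)), hi,
    hV, hw0, ← hU]
  simp only [map_mul, map_pow, fermatToLaurent_fermatVar]
  linear_combination algebraMap _ (FractionRing (FermatLaurent k n d))
      (fMon k n d (0, ![-1, -(n - 1 : ℤ)])) *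
    (algebraMap _ _ (fVar k n d (ofLex w).1) ^ d * algebraMap _ _ (fUV k n d 0) ^ d *
      (algebraMap _ _ (fUV k n d 1) ^ n) ^ d) * hs

/-- The set `{x_0 u, …, x_{i-1} u, x_i v, …, x_{n-1} v}`. -/
def stairs (i : ℕ) : Finset (Fin (n + 1) ×ₗ Fin 2) :=
  Finset.univ.image fun l : Fin n => toLex (l.castSucc, if (l : ℕ) < i then 0 else 1)

variable {n} in
theorem mem_stairs {i : ℕ} {l : Fin n} {c : Fin 2} :
    toLex (l.castSucc, c) ∈ stairs n i ↔ c = if (l : ℕ) < i then 0 else 1 := by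
  unfold stairs
  rw [Finset.mem_image]
  constructor
  · rintro ⟨l', -, h⟩
    have h1 : l' = l := Fin.castSucc_injective n (congrArg (fun w => (ofLex w).1) h)
    rw [← h1]
    exact (congrArg (fun w => (ofLex w).2) h).symm
  · rintro rfl
    exact ⟨l, Finset.mem_univ _, rfl⟩

theorem stairs_subset (i : ℕ) : stairs n i ⊆ segreIdx n := by
  intro w hw
  obtain ⟨l, -, rfl⟩ := Finset.mem_image.1 hw
  exact mem_segreIdx l _

theorem card_stairs (i : ℕ) : (stairs n i).card = n := by
  unfold stairs
  rw [Finset.card_image_of_injective, Finset.card_univ, Fintype.card_fin]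
  exact fun l l' h => Fin.castSucc_injective n (congrArg (fun w => (ofLex w).1) h)

theorem image_stairs (i : ℕ) : (stairs n i).image (fun w => (ofLex w).1) = fermatIdx n := by
  unfold stairs
  rw [Finset.image_image]
  ext l
  simp only [Finset.mem_image, Finset.mem_univ, true_and, Function.comp, ofLex_toLex, fermatIdx,
    Finset.mem_filter]
  exact Fin.exists_castSucc_eq

variable {n}

/-- Two consecutive stairs, joined. -/
def stairsStep (i : Fin n) : Finset (Fin (n + 1) ×ₗ Fin 2) :=
  insert (toLex (i.castSucc, 0)) (stairs n i)

theorem notMem_stairs (i : Fin n) : toLex (i.castSucc, 0) ∉ stairs n i := by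
  rw [mem_stairs, if_neg (lt_irrefl _)]
  exact zero_ne_one

theorem card_stairsStep (i : Fin n) : (stairsStep i).card = n + 1 := by
  unfold stairsStep
  rw [Finset.card_insert_of_notMem (notMem_stairs i), card_stairs]

theorem stairsStep_subset (i : Fin n) : stairsStep i ⊆ segreIdx n :=
  Finset.insert_subset (mem_segreIdx _ _) (stairs_subset n i)

theorem mem_stairsStep {i l : Fin n} {c : Fin 2} (h : l ≠ i) :
    toLex (l.castSucc, c) ∈ stairsStep i ↔ toLex (l.castSucc, c) ∈ stairs n i := by
  unfold stairsStep
  rw [Finset.mem_insert, or_iff_right]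
  exact fun h1 => h (Fin.castSucc_injective n (congrArg (fun w => (ofLex w).1) h1))

theorem mem_stairsStep_self (i : Fin n) (c : Fin 2) : toLex (i.castSucc, c) ∈ stairsStep i := by
  unfold stairsStep
  rw [Finset.mem_insert, mem_stairs, if_neg (lt_irrefl _)]
  fin_cases c
  · exact Or.inl rfl
  · exact Or.inr rfl

theorem stairsStep_erase_zero (i : Fin n) :
    (stairsStep i).erase (toLex (i.castSucc, 0)) = stairs n i :=
  Finset.erase_insert (notMem_stairs i)

theorem stairsStep_erase_one (i : Fin n) :
    (stairsStep i).erase (toLex (i.castSucc, 1)) = stairs n (i + 1) := by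
  refine (Finset.eq_of_subset_of_card_le ?_ ?_).symm
  · intro w hw
    obtain ⟨l, -, rfl⟩ := Finset.mem_image.1 hw
    by_cases h : l = i
    · rw [h, if_pos (Nat.lt_succ_self _)]
      refine Finset.mem_erase.2 ⟨fun h1 => ?_, mem_stairsStep_self i 0⟩
      exact absurd (congrArg (fun w => (ofLex w).2) h1) zero_ne_one
    · refine Finset.mem_erase.2 ⟨fun h1 => h (Fin.castSucc_injective n
        (congrArg (fun w => (ofLex w).1) h1)), ?_⟩
      rw [mem_stairsStep h, mem_stairs]
      have : (l : ℕ) ≠ i := fun h1 => h (Fin.ext h1)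
      congr 1
      exact propext (by omega)
  · rw [card_stairs, Finset.card_erase_of_mem (mem_stairsStep_self i 1), card_stairsStep,
      Nat.add_sub_cancel]

/-- Rows other than `i` are occupied once, so when `r` vanishes on sets that lose such a row, only
the two adjacent stairs remain. -/
theorem altD_stairsStep {M : Type*} [AddCommGroup M] (r : Finset (Fin (n + 1) ×ₗ Fin 2) → M)
    (i : Fin n) (h : ∀ l : Fin n, l ≠ i → ∀ c, toLex (l.castSucc, c) ∈ stairs n i →
      r ((stairsStep i).erase (toLex (l.castSucc, c))) = 0) :
    altD r (stairsStep i) = altSign (toLex (i.castSucc, 0)) (stairsStep i) • r (stairs n i) +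
      altSign (toLex (i.castSucc, 1)) (stairsStep i) • r (stairs n (i + 1)) := by
  have hne : (toLex (i.castSucc, 1) : Fin (n + 1) ×ₗ Fin 2) ≠ toLex (i.castSucc, 0) := fun h1 =>
    absurd (congrArg (fun w => (ofLex w).2) h1) one_ne_zero
  rw [altD_apply, ← Finset.add_sum_erase _ _ (mem_stairsStep_self i 0),
    ← Finset.add_sum_erase _ _ (Finset.mem_erase.2 ⟨hne, mem_stairsStep_self i 1⟩),
    stairsStep_erase_zero, stairsStep_erase_one, Finset.sum_eq_zero, add_zero]
  intro w hw
  obtain ⟨h1, hw⟩ := Finset.mem_erase.1 hw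
  obtain ⟨l, -, rfl⟩ := Finset.mem_image.1 hw
  rw [h l ?_ _ hw, smul_zero]
  rintro rfl
  rw [if_neg (lt_irrefl _)] at h1
  exact h1 rfl

theorem altSign_smul_eq_zero {ι M : Type*} [LinearOrder ι] [AddCommGroup M] {i : ι} {J : Finset ι}
    {m : M} (h : altSign i J • m = 0) : m = 0 := by
  have := congrArg (fun y => altSign i J • y) h
  simpa only [smul_smul, altSign_mul_self, one_smul, smul_zero] using this

theorem altD_eq_zero_of_forall {ι M : Type*} [LinearOrder ι] [AddCommGroup M] {g : Finset ι → M}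
    {J : Finset ι} (h : ∀ w ∈ J, g (J.erase w) = 0) : altD g J = 0 :=
  Finset.sum_eq_zero fun w hw => by rw [h w hw, smul_zero]

theorem altD_eq_of_forall_ne {ι K : Type*} [LinearOrder ι] [CommRing K] {g : Finset ι → K}
    {J : Finset ι} {v : ι} (hv : v ∈ J) (h : ∀ w ∈ J, w ≠ v → g (J.erase w) = 0) :
    altD g J = altSign v J * g (J.erase v) := by
  rw [altD_apply, Finset.sum_eq_single v (fun w hw hwv => by rw [h w hw hwv, smul_zero])
    (fun hv' => absurd hv hv'), zsmul_eq_mul]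

variable (n) (p : ℕ) [hp : Fact p.Prime] [CharP k p]

/-- The cocycle is a connecting class: `h` is not a cochain with values in the localizations of `T`,
but `altD h` is. Along the staircase from column `v` to column `u`, a primitive vanishes at both
ends, while the cocycle is nonzero on the first step only. -/
theorem not_lcNilpotent_segre_succ (hn : 2 ≤ n) :
    ¬ LCNilpotent k p (fermatSegreVar k n d) (n + 1) := by
  have hn0 : 0 < n := by omega
  obtain ⟨a, had, ha0, ha⟩ := exists_fermat_cochain k n d hn0 0
  have hu := isUnit_fermatSegreVar k n d hn0
  have hinj := toFrac_injective (segreToLaurent_injective k n d)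
  rw [pow_zero, mul_one] at ha0
  -- The degree `-n` matches that of `1 / (x_0 ⋯ x_{n-1})`, and for `n ≥ 2` both exponents are
  -- negative.
  set γ : FractionRing (FermatLaurent k n d) :=
    algebraMap _ _ (fMon k n d (0, ![-1, -(n - 1 : ℤ)])) with hγ
  set h := extendFst n γ a with hh
  have hu0 : ∀ {I : Finset (Fin (n + 1) ×ₗ Fin 2)} {w}, w ∈ I → (ofLex w).2 = 0 → h I = 0 := by
    intro I w hw hw0
    rw [hh, extendFst, if_neg]
    intro h1
    exact absurd (hw0.symm.trans (h1 w hw)) zero_ne_one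
  refine not_lcNilpotent_succ k p _ _ hu hinj (g := altD h) (fun J hJ => ?_)
    (fun J _ => altD_altD h J) (fun e b hb => ?_)
  · by_cases hv : ∀ w ∈ J, (ofLex w).2 = 1
    · have h1 : altD h J = altD (fun I => γ * pullFst a I) J := altD_congr fun w _ =>
        if_pos fun w' hw' => hv w' (Finset.mem_of_mem_erase hw')
      have h2 := map_altD (AddMonoidHom.mulLeft γ) (pullFst a) J
      rw [altD_pullFst_eq_zero had hJ, map_zero] at h2
      rw [h1.trans h2.symm]
      exact zero_mem _
    · push Not at hv
      obtain ⟨w, hw, hw1⟩ := hv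
      have hw0 : (ofLex w).2 = 0 := by omega
      rw [altD_apply]
      refine sum_mem fun w' hw' => zsmul_mem ?_ _
      by_cases hww : w' = w
      · rw [hww]
        exact mem_cechRange_extendFst k n d hn0 ha hJ hw hw0
      · rw [hu0 (Finset.mem_erase.2 ⟨Ne.symm hww, hw⟩) hw0]
        exact zero_mem _
  · by_contra! hbe
    set q : ℕ := p ^ e with hq
    have hq0 : 0 < q := pow_pos hp.out.pos e
    set ν : FermatExp n := (fun _ => -1, ![-1, -(n - 1 : ℤ)]) with hν
    -- There is no factor `x_n`, so the Frobenius power of the monomial is again a single basis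
    -- monomial.
    set μ : FermatExp n × Fin d := (q • ν, 0) with hμ
    obtain ⟨r, hr, hrd⟩ := exists_coeff (segreToLaurent k n d) (fermatSegreVar k n d) hu
      (segreIdx n) (segreExps n d) (fun I hI y hy => (mem_cechRange_segre k n d hn0 hI).1 hy) hb μ
    have hr' : ∀ I ⊆ segreIdx n, I.card = n → r I ≠ 0 →
        (∀ l : Fin n, ∃ c, toLex (l.castSucc, c) ∈ I) ∧
          ∀ c, ∃ l : Fin n, toLex (l.castSucc, c) ∈ I := by
      intro I hI hc h0
      have h1 := mem_segreExps_iff.1 (hr I hI hc h0)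
      refine ⟨fun l => h1.1 l ?_, fun c => h1.2.1 c ?_⟩
      · simp [hμ, hν, hq0]
      · fin_cases c
        · simp [hμ, hν, hq0]
        · have h2 : μ.1.2 1 = q * (-(n - 1 : ℤ)) := by simp [hμ, hν]
          change μ.1.2 1 < 0
          rw [h2]
          exact mul_neg_of_pos_of_neg (by exact_mod_cast hq0) (by omega)
    have hstep : ∀ i : Fin n, altD r (stairsStep i) =
        altSign (toLex (i.castSucc, 0)) (stairsStep i) • r (stairs n i) +
        altSign (toLex (i.castSucc, 1)) (stairsStep i) • r (stairs n (i + 1)) := by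
      intro i
      refine altD_stairsStep r i fun l hl c hc => ?_
      by_contra h0
      have hmem := (mem_stairsStep hl).2 hc
      obtain ⟨c', hc'⟩ := (hr' _ ((Finset.erase_subset _ _).trans (stairsStep_subset i))
        (by rw [Finset.card_erase_of_mem hmem, card_stairsStep, Nat.add_sub_cancel]) h0).1 l
      obtain ⟨hne, hc'⟩ := Finset.mem_erase.1 hc'
      rw [mem_stairsStep hl, mem_stairs] at hc'
      rw [mem_stairs] at hc
      exact hne (by rw [hc, hc'])
    -- The end stairs lie in one column, while `μ` has negative exponents at both `u` and `v`.
    have hr0 : r (stairs n 0) = 0 := by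
      by_contra h0
      obtain ⟨l, hl⟩ := (hr' _ (stairs_subset n 0) (card_stairs n 0) h0).2 0
      rw [mem_stairs, if_neg (Nat.not_lt_zero _)] at hl
      exact zero_ne_one hl
    have hrn : r (stairs n n) = 0 := by
      by_contra h0
      obtain ⟨l, hl⟩ := (hr' _ (stairs_subset n n) (card_stairs n n) h0).2 1
      rw [mem_stairs, if_pos l.2] at hl
      exact one_ne_zero hl
    -- Every later step contains two elements with second coordinate `u`. One of them survives each
    -- erasure, so `h` vanishes on all faces.
    have hpos : ∀ i : Fin n, 0 < (i : ℕ) → altD r (stairsStep i) = 0 := by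
      intro i hi
      rw [hrd _ (stairsStep_subset i) (card_stairsStep i) 0, map_zero]
      · rfl
      rw [hbe _ (card_stairsStep i), map_zero]
      have h0 : toLex ((⟨0, hn0⟩ : Fin n).castSucc, 0) ∈ stairsStep i := by
        rw [mem_stairsStep (fun h => by rw [← h] at hi; exact lt_irrefl _ hi), mem_stairs,
          if_pos hi]
      have : altD h (stairsStep i) = 0 := by
        refine altD_eq_zero_of_forall fun w _ => ?_
        by_cases hw : w = toLex (i.castSucc, 0)
        · have hne : (toLex ((⟨0, hn0⟩ : Fin n).castSucc, 0) : Fin (n + 1) ×ₗ Fin 2) ≠ w := by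
            rw [hw]
            intro h1
            have h2 := Fin.castSucc_injective n (congrArg (fun w => (ofLex w).1) h1)
            rw [← h2] at hi
            exact lt_irrefl _ hi
          exact hu0 (Finset.mem_erase.2 ⟨hne, h0⟩) rfl
        · exact hu0 (Finset.mem_erase.2 ⟨Ne.symm hw, mem_stairsStep_self i 0⟩) rfl
      rw [this, zero_pow hq0.ne']
    -- Descending from the last stair, each vanishing step passes `r = 0` down to the previous
    -- stair, as far as `stairs n 1`.
    have hall : ∀ m < n, r (stairs n (n - m)) = 0 := by
      intro m
      induction m with
      | zero => exact fun _ => hrn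
      | succ m ih =>
        intro hm
        have h1 := hpos ⟨n - (m + 1), by omega⟩ (by simp only; omega)
        rw [hstep] at h1
        have h2 : n - (m + 1) + 1 = n - m := by omega
        simp only [h2, ih (by omega), smul_zero, add_zero] at h1
        exact altSign_smul_eq_zero h1
    have h1 := hstep ⟨0, hn0⟩
    have h2 := hall (n - 1) (by omega)
    rw [Nat.sub_sub_self (by omega)] at h2
    simp only [zero_add, hr0, h2, smul_zero, add_zero] at h1
    set σ : ℤ := altSign (toLex ((⟨0, hn0⟩ : Fin n).castSucc, 0)) (stairsStep ⟨0, hn0⟩) with hσ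
    have hJ0 : altD h (stairsStep ⟨0, hn0⟩) = (σ : FractionRing (FermatLaurent k n d)) *
        algebraMap _ _ (fMon k n d ν) := by
      rw [altD_eq_of_forall_ne (mem_stairsStep_self ⟨0, hn0⟩ 0) fun w _ hw =>
          hu0 (Finset.mem_erase.2 ⟨Ne.symm hw, mem_stairsStep_self _ 0⟩) rfl,
        stairsStep_erase_zero, hh, extendFst, if_pos, pullFst, image_stairs,
        card_fermatIdx, card_stairs, if_pos rfl, ha0, hγ, ← map_mul, ← fMon_add]
      · congr 3
        simp [hν]
      · intro w hw
        obtain ⟨l, -, rfl⟩ := Finset.mem_image.1 hw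
        simp
    rw [hrd _ (stairsStep_subset _) (card_stairsStep _) (((σ : k) ^ q) • fBasis k n d μ)] at h1
    · rw [map_smul, Module.Basis.repr_self, Finsupp.smul_single, Finsupp.single_eq_same,
        smul_eq_mul, mul_one] at h1
      have h3 : (σ : k) * σ = 1 := by exact_mod_cast congrArg (fun z : ℤ => (z : k)) (altSign_mul_self _ _)
      rw [pow_eq_zero_iff hq0.ne'] at h1
      rw [h1, mul_zero] at h3
      exact zero_ne_one h3
    · rw [hbe _ (card_stairsStep _), hJ0, fBasis_apply, hμ]
      simp only [Fin.val_zero, pow_zero, mul_one]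
      rw [fMon_nsmul, Algebra.smul_def, mul_pow, map_mul, map_pow, map_pow, map_intCast,
        map_pow, map_intCast]

end TopSegre

/-! ### The bound `dim T ≤ n + 1` -/

section KrullDim

/-- Incomparability: contraction of primes along an integral map is strictly monotone. -/
theorem ringKrullDim_le_of_isIntegral {A T : Type*} [CommRing A] [CommRing T] (f : A →+* T)
    (hf : f.IsIntegral) : ringKrullDim T ≤ ringKrullDim A := by
  let := f.toAlgebra
  refine Order.krullDim_le_of_strictMono (PrimeSpectrum.comap f) fun P Q hPQ => ?_
  obtain ⟨hle, x, hxQ, hxP⟩ := SetLike.lt_iff_le_and_exists.1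
    (show P.asIdeal < Q.asIdeal from hPQ)
  exact Ideal.comap_lt_comap_of_integral_mem_sdiff (R := A) hle ⟨hxQ, hxP⟩ (hf x)

/-- Noether normalization of a `2 × n` matrix with vanishing minors by its antidiagonal sums. -/
theorem isIntegral_of_minors {A T : Type*} [CommRing A] [CommRing T] [Algebra A T] {n : ℕ}
    {a b : ℕ → T} (hab : ∀ i j, b i * a j = a i * b j) (hn : a n = 0) (h0 : IsIntegral A (a 0))
    (h : ∀ j < n, IsIntegral A (a (j + 1) + b j)) :
    ∀ j < n, IsIntegral A (a j) ∧ IsIntegral A (b j) := by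
  set θ : ℕ → T := fun j => Nat.casesOn j (a 0) fun j => a (j + 1) + b j with hθ
  have hθi : ∀ j ≤ n, IsIntegral A (θ j) := by
    intro j hj
    cases j with
    | zero => exact h0
    | succ j => exact h j hj
  -- A telescoping sum: the vanishing minors turn `b_s a_m` into `a_s b_m`, and successive
  -- contributions cancel.
  have hsum : ∀ m s, ∑ j ∈ Finset.range (s + 1), θ j * (-a m) ^ j * b m ^ (s - j) =
      a s * (-a m) ^ s := by
    intro m s
    induction s with
    | zero => simp [hθ]
    | succ s ih =>
      rw [Finset.sum_range_succ]
      have h1 : ∑ j ∈ Finset.range (s + 1), θ j * (-a m) ^ j * b m ^ (s + 1 - j) =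
          (∑ j ∈ Finset.range (s + 1), θ j * (-a m) ^ j * b m ^ (s - j)) * b m := by
        rw [Finset.sum_mul]
        refine Finset.sum_congr rfl fun j hj => ?_
        rw [Nat.succ_sub (Nat.lt_succ_iff.1 (Finset.mem_range.1 hj)), pow_succ, ← mul_assoc]
      rw [h1, ih]
      simp only [hθ, Nat.sub_self, pow_zero, mul_one]
      linear_combination (-(-a m) ^ s) * hab s m
  -- For `s = m` the identity says that `-a_m` is a root of the monic polynomial `X^{m+1} + ∑ θ_j
  -- b_m^{m-j} X^j`, whose coefficients are integral once `b_m` is.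
  have hroot : ∀ m < n, IsIntegral A (b m) → IsIntegral A (a m) := by
    intro m hm hb
    have hc : ∀ j : Fin (m + 1), θ j * b m ^ (m - j) ∈ integralClosure A T := fun j =>
      mul_mem (hθi j (by omega)) (pow_mem (show b m ∈ integralClosure A T from hb) _)
    set q : Polynomial (integralClosure A T) := ∑ j : Fin (m + 1), Polynomial.C ⟨_, hc j⟩ *
      Polynomial.X ^ (j : ℕ) with hq
    have hneg : IsIntegral A (-a m) := by
      refine isIntegral_trans (A := integralClosure A T) _ ⟨Polynomial.X ^ (m + 1) + q,
        Polynomial.monic_X_pow_add (Polynomial.degree_sum_fin_lt _), ?_⟩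
      rw [Polynomial.eval₂_add, Polynomial.eval₂_X_pow, hq, Polynomial.eval₂_finsetSum]
      simp only [Polynomial.eval₂_mul, Polynomial.eval₂_C, Polynomial.eval₂_X_pow]
      have h1 := hsum m m
      rw [Finset.sum_range] at h1
      refine Eq.trans (congrArg _ (Finset.sum_congr rfl fun j _ => ?_)) (?_ : (-a m) ^ (m + 1) +
        ∑ j : Fin (m + 1), θ j * (-a m) ^ (j : ℕ) * b m ^ (m - j) = 0)
      · exact mul_right_comm _ _ _
      · rw [h1]
        ring
    simpa using hneg.neg
  -- Descent from the last column, where `a n = 0` makes `b (n - 1)` itself one of the sums. Then `b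
  -- j` is the difference of an integral sum and `a (j + 1)`.
  have hdesc : ∀ m, ∀ j, j + m + 1 = n → IsIntegral A (b j) := by
    intro m
    induction m with
    | zero =>
      intro j hj
      have h1 := h j (by omega)
      have h2 : j + 1 = n := hj
      rwa [h2, hn, zero_add] at h1
    | succ m ih =>
      intro j hj
      have h1 := h j (by omega)
      have h2 := hroot (j + 1) (by omega) (ih (j + 1) (by omega))
      simpa using h1.sub h2
  intro j hj
  have hbj := hdesc (n - j - 1) j (by omega)
  exact ⟨hroot j hj hbj, hbj⟩

variable (k : Type*) [Field k] (n d : ℕ)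

/-- The Segre product is generated by the `x_i u`, `x_i v`. -/
theorem subalgebra_eq_top_of_fermatSegreVar_mem (C : Subalgebra k (FermatSegre k n d))
    (hC : ∀ w, fermatSegreVar k n d w ∈ C) (y : FermatSegre k n d) : y ∈ C := by
  set L : Submodule k (FermatRing k n d ⊗[k] MvPolynomial (Fin 2) k) :=
    (Subalgebra.toSubmodule C).map (segre (fermatGrading k n d)
      (MvPolynomial.homogeneousSubmodule (Fin 2) k)).val.toLinearMap with hL
  have hle : ∀ t, segrePiece (fermatGrading k n d)
      (MvPolynomial.homogeneousSubmodule (Fin 2) k) t ≤ L := by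
    intro t
    induction t with
    | zero =>
      have h1 : fermatGrading k n d 0 ≤ Submodule.span k {1} := by
        refine (Submodule.map_mono (homogeneousSubmodule_zero_le k)).trans ?_
        rw [Submodule.map_span, Set.image_singleton]
        exact (congrArg (fun r => Submodule.span k {r})
          (map_one (Ideal.Quotient.mkₐ k (Ideal.span {fermatPoly k n d})))).le
      refine (Submodule.map₂_le_map₂ h1 (homogeneousSubmodule_zero_le k)).trans ?_
      rw [Submodule.map₂_span_span, Submodule.span_le]
      rintro _ ⟨_, rfl, _, rfl, rfl⟩
      exact ⟨1, one_mem C, rfl⟩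
    | succ t ih =>
      refine (Submodule.map₂_le_map₂ (fermatGrading_succ_le k n d t)
        (homogeneous_succ_le k t)).trans ?_
      rw [span_mul_submodule, span_mul_submodule, Submodule.map₂_span_span, Submodule.span_le]
      rintro _ ⟨_, ⟨_, ⟨i, rfl⟩, r, hr, rfl⟩, _, ⟨_, ⟨c, rfl⟩, s, hs, rfl⟩, rfl⟩
      obtain ⟨y, hy, hyr⟩ := ih (Submodule.apply_mem_map₂ (TensorProduct.mk k _ _) hr hs)
      refine ⟨fermatSegreVar k n d (toLex (i, c)) * y, C.mul_mem (hC _) hy, ?_⟩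
      change (fermatVar k n d i ⊗ₜ[k] MvPolynomial.X c) * y.1 = _
      have hyr' : y.1 = r ⊗ₜ[k] s := hyr
      rw [hyr', Algebra.TensorProduct.tmul_mul_tmul]
      rfl
  obtain ⟨y', hy', h⟩ := (iSup_le hle : _ ≤ L) y.2
  have : y' = y := Subtype.ext h
  exact this ▸ hy'

variable [NeZero d]

/-- The elements `x_i u`, `x_i v` with `i < n` form a `2 × n` matrix with vanishing minors. They are
integral over its `n + 1` antidiagonal sums, and `x_n u`, `x_n v` are integral over them by the
Fermat relation. -/
theorem ringKrullDim_fermatSegre_le : ringKrullDim (FermatSegre k n d) ≤ (n + 1 : ℕ) := by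
  -- The default value `0` beyond the last column makes the last antidiagonal sum equal to `x_{n-1}
  -- v`.
  set a : Fin 2 → ℕ → FermatSegre k n d := fun c j =>
    if h : j < n then fermatSegreVar k n d (toLex ((⟨j, h⟩ : Fin n).castSucc, c)) else 0 with ha
  set θ : Fin (n + 1) → FermatSegre k n d := fun j =>
    Fin.cases (a 0 0) (fun j : Fin n => a 0 (j + 1) + a 1 j) j with hθ
  set f : MvPolynomial (Fin (n + 1)) k →ₐ[k] FermatSegre k n d := MvPolynomial.aeval θ with hf
  suffices h : f.toRingHom.IsIntegral by
    refine (ringKrullDim_le_of_isIntegral _ h).trans ?_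
    rw [MvPolynomial.ringKrullDim_of_isNoetherianRing, ringKrullDim_eq_zero_of_field]
    simp
  have hab : ∀ i j, a 1 i * a 0 j = a 0 i * a 1 j := by
    intro i j
    simp only [ha]
    split_ifs
    · apply segreToLaurent_injective k n d
      simp only [map_mul, segreToLaurent_var, ofLex_toLex]
      ring
    all_goals simp
  have hθi : ∀ j, f.toRingHom.IsIntegralElem (θ j) := fun j => by
    have := f.toRingHom.isIntegralElem_map (x := MvPolynomial.X j)
    have h1 : f.toRingHom (MvPolynomial.X j) = θ j := MvPolynomial.aeval_X θ j
    rwa [h1] at this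
  have hcast : ∀ j < n, ∀ c, f.toRingHom.IsIntegralElem (a c j) := by
    let := f.toRingHom.toAlgebra
    have h1 := isIntegral_of_minors (A := MvPolynomial (Fin (n + 1)) k) (n := n) hab (by simp [ha])
      (hθi 0) fun j hj => hθi (Fin.succ ⟨j, hj⟩)
    intro j hj c
    fin_cases c
    · exact (h1 j hj).1
    · exact (h1 j hj).2
  let C : Subalgebra k (FermatSegre k n d) :=
    { carrier := {y | f.toRingHom.IsIntegralElem y}
      mul_mem' := fun hx hy => RingHom.IsIntegralElem.mul _ hx hy
      add_mem' := fun hx hy => RingHom.IsIntegralElem.add _ hx hy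
      algebraMap_mem' := fun c => by
        have := f.toRingHom.isIntegralElem_map (x := algebraMap k _ c)
        have h1 : f.toRingHom (algebraMap k _ c) = algebraMap k _ c := f.commutes c
        rwa [h1] at this }
  have hC : ∀ (i : Fin n) c, fermatSegreVar k n d (toLex (i.castSucc, c)) ∈ C := by
    intro i c
    have := hcast i i.2 c
    simp only [ha, i.2, dif_pos] at this
    exact this
  refine fun y => subalgebra_eq_top_of_fermatSegreVar_mem k n d C ?_ y
  rintro ⟨i, c⟩
  induction i using Fin.lastCases with
  | last =>
    have h1 : fermatSegreVar k n d (toLex (Fin.last n, c)) ^ d ∈ C := by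
      rw [fermatSegreVar_last_pow]
      exact sum_mem fun i _ => pow_mem (hC i c) d
    let := f.toRingHom.toAlgebra
    exact IsIntegral.of_pow (R := MvPolynomial (Fin (n + 1)) k) (NeZero.pos d) h1
  | cast i => exact hC i c

end KrullDim

/-! ### Assembling the invariants -/

section Main

variable (k : Type*) [Field k] (p : ℕ) [hp : Fact p.Prime] [CharP k p]
  {A : Type*} [CommRing A] [Algebra k A] {ι : Type*} [LinearOrder ι] {x : ι → A} {j : ℕ}

theorem fDepth_eq (h : ∀ i < j, LCNilpotent k p x i) (hj : ¬ LCNilpotent k p x j) :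
    FDepth k p x = (j : ℕ∞) := by
  refine le_antisymm (sInf_le ⟨j, hj, rfl⟩) (le_sInf ?_)
  rintro _ ⟨i, hi, rfl⟩
  by_contra hlt
  exact hi (h i (Nat.cast_lt.1 (not_le.1 hlt)))

theorem baseNilpotentIndex_eq {𝒜 : ℕ → Submodule k A} {t : ℤ}
    (h : ∀ s, t < s → LCNilpotentInDegree k p 𝒜 x j s)
    (ht : ¬ LCNilpotentInDegree k p 𝒜 x j t) :
    baseNilpotentIndex k p 𝒜 x j = ((t : WithTop ℤ) : WithBot (WithTop ℤ)) := by
  refine le_antisymm (sSup_le ?_) (le_sSup ⟨t, ht, rfl⟩)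
  rintro _ ⟨s, hs, rfl⟩
  refine WithBot.coe_le_coe.2 (WithTop.coe_le_coe.2 ?_)
  by_contra hlt
  exact hs (h s (not_le.1 hlt))

end Main

theorem mainTheorem6 (k : Type*) [Field k] (p : ℕ) [Fact p.Prime] [CharP k p]
    (n d : ℕ) (hn : 2 ≤ n) (hd : 1 ≤ d) (hpd : d < p) :
    ((p : ℤ) ≡ 1 [ZMOD (d : ℤ)] → n < d →
      baseNilpotentIndex k p (fermatGrading k n d) (fermatVar k n d) n =
          (((0 : ℤ) : WithTop ℤ) : WithBot (WithTop ℤ)) ∧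
        FDepth k p (fermatSegreVar k n d) = (n : ℕ∞)) ∧
    ((p : ℤ) ≡ -1 [ZMOD (d : ℤ)] →
      (∀ j ≤ n, LCNilpotent k p (fermatSegreVar k n d) j) ∧
        FDepth k p (fermatSegreVar k n d) = ((n + 1 : ℕ) : ℕ∞) ∧
        WeaklyFNilpotent k p (fermatSegreVar k n d)) := by
  have : NeZero d := ⟨by omega⟩
  refine ⟨fun hp1 hnd => ⟨?_, ?_⟩, fun hp1 => ⟨fun j hj => ?_, ?_, fun j hj => ?_⟩⟩
  · exact baseNilpotentIndex_eq k p
      (fun s hs => lcNilpotentInDegree_fermat k n d p (by omega) hpd hs)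
      (not_lcNilpotentInDegree_fermat k n d p (by omega) hnd hp1)
  · exact fDepth_eq k p (fun i hi => lcNilpotent_segre_of_lt k n d p (by omega) hi)
      (not_lcNilpotent_segre_of_lt k n d p (by omega) hnd hp1)
  · exact lcNilpotent_segre_of_le k n d p hn hpd hp1 hj
  · exact fDepth_eq k p
      (fun i hi => lcNilpotent_segre_of_le k n d p hn hpd hp1 (Nat.lt_succ_iff.1 hi))
      (not_lcNilpotent_segre_succ k n d p hn)
  · refine lcNilpotent_segre_of_le k n d p hn hpd hp1 (Nat.lt_succ_iff.1 ?_)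
    have h := hj.trans_le (ringKrullDim_fermatSegre_le k n d)
    exact_mod_cast h
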